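/- Let $q$ be a real-valued function in $W_2^2[0,1]$ (that is, $q$ is differentiable on $[0,1]$, $q'$ is absolutely continuous and $q''\in L^2(0,1)$), let $h\in\mathbb R$, and assume $q(1)=0$ and $q'(1)\neq 0$. Consider the problem $R(q,h)$: $$-\psi''+q\psi=\lambda\psi,\qquad -\psi_0''=\lambda\psi_0\qquad(0<x<1),$$ $$\psi'(0)-h\psi(0)=0,\quad \psi_0'(0)-h\psi_0(0)=0,\quad \psi_0(1)=\psi(1),\quad \psi_0'(1)=\psi'(1).$$ The transmission eigenvalues are the $\lambda\in\mathbb C$ for which $R(q,h)$ has a pair of nontrivial solutions $\psi,\psi_0$. The multiplicity of an eigenvalue is its order as a zero of the entire function $\Delta$ given by $$\Delta(k^2)=D(k)=\frac1{2i}[F(k)+F(-k)]-\frac h{2k}[F(k)-F(-k)],\qquad F(k)=-i[f'(k,0)-hf(k,0)],$$ where $f(k,\cdot)$ solves $-f''+qf=k^2f$ on $[0,1]$ with $f(k,1)=e^{ik}$, $f'(k,1)=ike^{ik}$ (the singularity of $D$ at $k=0$ is removable). Put $$\omega=\int_0^1q(x)\,dx,\qquad Q_2=-q'(0)+\int_0^1q(x)^2dx+q(0)\omega-\frac{\omega^3}6+4h[q(0)+\omega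 h].$$ Below, "the transmission eigenvalues are denoted by" means that the given family lists exactly the transmission eigenvalues, each as many times as its multiplicity; $\sqrt{\cdot}$ of a complex number and $\log$ are the principal branches ($-\pi<\arg\le\pi$); asymptotic formulas are for $n\ge1$. (i) Let $\omega\neq0$. The transmission eigenvalues can be denoted by $\{\lambda_n\}_{n\ge0}\cup\{\lambda_n'\}_{n\ge1}$ if $\frac{q'(1)}{\omega}>0$, and by $\{\lambda_n\}_{n\ge1}\cup\{\lambda_n'\}_{n\ge1}$ if $\frac{q'(1)}{\omega}<0$, where for every $n\ge1$ either $\lambda_n'=\overline{\lambda_n}$ or both $\lambda_n$ and $\lambda_n'$ are real (the latter is possible for finitely many $n$ only), such that $$\sqrt{\lambda_n}=\mu_n^1+\varepsilon_n,\qquad \{\varepsilon_n\}_{n\ge1}\in\ell^2,$$ $$\mu_n^1=\begin{cases} n\pi+i\left[\log(2n\pi)-\frac12\log\left(-\frac{q'(1)}{2\omega}\right)\right] &\text{if } \frac{q'(1)}{\omega}<0,\\[1ex] \left(n+\frac12\right)\pi+i\left[\log(2n\pi)-\frac12\log\left(\frac{q'(1)}{2\omega}\right)\right] &\text{if } \frac{q'(1)}{\omega}>0.\end{cases}$$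 (ii) Let $\omega=0$ and $\left|\frac{Q_2}{q'(1)}\right|\neq1$. The transmission eigenvalues can be denoted by $\{\lambda_n^+\}_{n\ge1}\cup\{\lambda_n^-\}_{n\ge1}$ if $\frac{Q_2}{q'(1)}<1$, and by $\{\lambda_0\}\cup\{\lambda_n^+\}_{n\ge1}\cup\{\lambda_n^-\}_{n\ge1}$ if $\frac{Q_2}{q'(1)}>1$, such that $$\sqrt{\lambda_n^\pm}=n\pi+s^\pm+\alpha_n^\pm,\qquad \{\alpha_n^\pm\}_{n\ge1}\in\ell^2,$$ $$s^\pm=\begin{cases}\pm\frac12\arccos\left(-\frac{Q_2}{q'(1)}\right)&\text{if }\left|\frac{Q_2}{q'(1)}\right|<1,\\[1ex] -\frac i2\log\left(-\frac{Q_2}{q'(1)}\pm\sqrt{\frac{Q_2^2}{q'(1)^2}-1}\right)&\text{if }\left|\frac{Q_2}{q'(1)}\right|>1.\end{cases}$$ -/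

import Mathlib

open MeasureTheory Set Filter Topology

noncomputable section

namespace RobinTransmission

/-- The first derivative of `q` on `[0,1]` (one-sided at the end points). -/
def deriv01 (q : ℝ → ℝ) : ℝ → ℝ := derivWithin q (Icc 0 1)

/-- `q ∈ W_2^2[0,1]`, `q` being the continuously differentiable representative: `q` is differentiable
on `[0,1]`, `q'` is absolutely continuous on `[0,1]`, and `q''` (which then exists almost everywhere)
is square integrable. -/
structure MemW22 (q : ℝ → ℝ) : Prop where
  differentiableOn : DifferentiableOn ℝ q (Icc 0 1)
  absolutelyContinuous : AbsolutelyContinuousOnInterval (deriv01 q) 0 1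
  memLp : MemLp (deriv (deriv01 q)) 2 (volume.restrict (Ioo 0 1))

/-- `ψ` is a solution of `-ψ'' + q ψ = z ψ` on `[0,1]`, with derivative `ψ'`. -/
def IsSolution (q : ℝ → ℝ) (z : ℂ) (ψ ψ' : ℝ → ℂ) : Prop :=
  ∀ x ∈ Icc (0 : ℝ) 1,
    HasDerivWithinAt ψ (ψ' x) (Icc 0 1) x ∧
    HasDerivWithinAt ψ' (((q x : ℂ) - z) * ψ x) (Icc 0 1) x

/-- `z` is a transmission eigenvalue of the problem `R(q,h)`: there are nontrivial solutions `ψ`, `ψ₀`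
of the perturbed and of the unperturbed equation, both subject to the condition `y'(0) = h y(0)`,
with the same Cauchy data at `x = 1`. -/
def IsTransmissionEigenvalue (q : ℝ → ℝ) (h : ℝ) (z : ℂ) : Prop :=
  ∃ ψ ψ' ψ₀ ψ₀' : ℝ → ℂ,
    IsSolution q z ψ ψ' ∧ IsSolution (fun _ => 0) z ψ₀ ψ₀' ∧
    (∃ x ∈ Icc (0 : ℝ) 1, ψ x ≠ 0) ∧ (∃ x ∈ Icc (0 : ℝ) 1, ψ₀ x ≠ 0) ∧
    ψ' 0 - h * ψ 0 = 0 ∧ ψ₀' 0 - h * ψ₀ 0 = 0 ∧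
    ψ₀ 1 = ψ 1 ∧ ψ₀' 1 = ψ' 1

/-- `(f, f')` is the Jost solution at `k` with its derivative: `-f'' + q f = k² f` on `[0,1]`,
`f(1) = e^{ik}`, `f'(1) = i k e^{ik}`. -/
def IsJostSolution (q : ℝ → ℝ) (k : ℂ) (f : (ℝ → ℂ) × (ℝ → ℂ)) : Prop :=
  IsSolution q (k ^ 2) f.1 f.2 ∧
    f.1 1 = Complex.exp (Complex.I * k) ∧
    f.2 1 = Complex.I * k * Complex.exp (Complex.I * k)

/-- The Jost solution and its derivative; they are unique on `[0,1]`. -/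
def jost (q : ℝ → ℝ) (k : ℂ) : (ℝ → ℂ) × (ℝ → ℂ) := Classical.epsilon (IsJostSolution q k)

/-- The Jost function `F(k) = -i [f'(k,0) - h f(k,0)]`. -/
def jostF (q : ℝ → ℝ) (h : ℝ) (k : ℂ) : ℂ :=
  -Complex.I * ((jost q k).2 0 - h * (jost q k).1 0)

/-- `D(k) = (1/(2i)) [F(k) + F(-k)] - (h/(2k)) [F(k) - F(-k)]`, for `k ≠ 0`. -/
def charDAux (q : ℝ → ℝ) (h : ℝ) (k : ℂ) : ℂ :=
  1 / (2 * Complex.I) * (jostF q h k + jostF q h (-k))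
    - h / (2 * k) * (jostF q h k - jostF q h (-k))

/-- The even entire function `D(k)`: the removable singularity at `k = 0` is filled by the limit. -/
def charD (q : ℝ → ℝ) (h : ℝ) : ℂ → ℂ :=
  Function.update (charDAux q h) 0 (limUnder (𝓝[≠] 0) (charDAux q h))

/-- The characteristic function `Δ(z) = D(k)`, `z = k²`; as `D` is even, the choice of the square
root does not matter. -/
def charFun (q : ℝ → ℝ) (h : ℝ) (z : ℂ) : ℂ := charD q h (Complex.sqrt z)

/-- The algebraic multiplicity of `z`: its order as a zero of the characteristic function. -/
def multiplicity (q : ℝ → ℝ) (h : ℝ) (z : ℂ) : ℕ∞ := analyticOrderAt (charFun q h) z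

/-- The family `ev` lists exactly the transmission eigenvalues of `R(q,h)`, each of them as many times
as its multiplicity. -/
def Enumerates (q : ℝ → ℝ) (h : ℝ) {ι : Type} (ev : ι → ℂ) : Prop :=
  range ev = {z | IsTransmissionEigenvalue q h z} ∧
    ∀ z, {i | ev i = z}.encard = multiplicity q h z

/-- `ω = ∫₀¹ q`. -/
def omega (q : ℝ → ℝ) : ℝ := ∫ x in (0 : ℝ)..1, q x

/-- `Q₂ = -q'(0) + ∫₀¹ q² + q(0) ω - ω³/6 + 4h [q(0) + ω h]`. -/
def Q₂ (q : ℝ → ℝ) (h : ℝ) : ℝ :=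
  -deriv01 q 0 + (∫ x in (0 : ℝ)..1, q x ^ 2) + q 0 * omega q - omega q ^ 3 / 6
    + 4 * h * (q 0 + omega q * h)

/-- The leading term `μ_n^1`, `n ≥ 1`, for `r = q'(1)/ω ≠ 0`. -/
def mu₁ (r : ℝ) (n : ℕ+) : ℂ :=
  if r < 0 then
    ((n : ℝ) * Real.pi : ℝ)
      + Complex.I * (Real.log (2 * (n : ℝ) * Real.pi) - 1 / 2 * Real.log (-(r / 2)) : ℝ)
  else
    (((n : ℝ) + 1 / 2) * Real.pi : ℝ)
      + Complex.I * (Real.log (2 * (n : ℝ) * Real.pi) - 1 / 2 * Real.log (r / 2) : ℝ)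

/-- The shift `s^±` for `c = -Q₂/q'(1)`, `|c| ≠ 1`; the sign is `σ = ±1`. -/
def shift (σ c : ℝ) : ℂ :=
  if |c| < 1 then (σ * (1 / 2) * Real.arccos c : ℝ)
  else -(Complex.I / 2) * Complex.log ((c + σ * Real.sqrt (c ^ 2 - 1) : ℝ) : ℂ)

/-- `√(ev n) = a n + ε n`, `n ≥ 1`, with `ε ∈ ℓ²`. -/
def SqrtAsymp (ev : ℕ+ → ℂ) (a : ℕ+ → ℂ) : Prop :=
  Summable fun n : ℕ+ => ‖Complex.sqrt (ev n) - a n‖ ^ 2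

/-- Two families are paired by complex conjugation; where both entries of a pair are real, they need
not be equal. -/
def ConjPaired (ev ev' : ℕ+ → ℂ) : Prop :=
  ∀ n, ev' n = (starRingEnd ℂ) (ev n) ∨ ((ev n).im = 0 ∧ (ev' n).im = 0)

end RobinTransmission

end

open RobinTransmission

/-!
The solutions `φ`, `φ₀` of the perturbed and of the unperturbed equation with `y(0) = 1`, `y'(0) = h`
have proportional Cauchy data at `1` exactly when their Wronskian `charW` vanishes there. This
Wronskian is the entire function `Δ` (`charFun_eq`, `isTransmissionEigenvalue_iff`), and by the
Lagrange identity it equals `∫₀¹ q φ φ₀` (`charW_eq_integral`). Inserting the large-`k` expansion of `φ` and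
integrating by parts twice, with `q(1) = 0`, one finds
`8 k² Δ(k²) = 4 ω k² + q'(1) cos 2k + const - ∫₀¹ q''(t) cos 2kt dt + O(e^{2|Im k|} / |k|)`
(`exists_bound_charW_sub`), where the constant is `Q₂` if `ω = 0` (`constTerm_eq_Q₂`).

*Counting.* On the circle `|k| = Lπ/2` the function `cos 2k` is either of size `e^{2|Im k|}` or, near
the real axis, close to `(-1)^L cosh (2 Im k)`. For the parity of `L` for which the polynomial part
`(4 ω k² + const) / q'(1)` does not cancel the latter, the symmetric Rouché theorem
(`circleIntegral_logDeriv_eq`) compares `8 z Δ(z) / q'(1)` with `cos 2√z`, which has `L` zeros in the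
disk `|z| < (Lπ/2)²`. As the factor `z` contributes one, `Δ` has `L - 1` zeros there
(`exists_card_zeros`). If `ω ≠ 0`, or if `ω = 0` and
`|Q₂ / q'(1)| > 1`, one parity is available, so consecutive disks differ by two zeros; if `ω = 0` and
`|Q₂ / q'(1)| < 1`, both are, and they differ by one. The parity decides whether an eigenvalue `λ₀` is
left over. As `Δ` is real on the real axis, its zeros come in conjugate pairs; large ones are not
real, except in the case `|Q₂ / q'(1)| < 1`, so each annulus contains one such pair. Since the disks
exhaust the plane, listing their zeros with multiplicity enumerates the eigenvalues
(`enumerates_of_exhaustion`).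

*Asymptotics for `ω ≠ 0`.* For a zero with `Im k > 0` the equation reads
`e^{-2ik} = -(8 ω / q'(1)) k² (1 + small)`, hence `k` is close to a point of a logarithmic curve in the
annulus, where `e^{-2ik}` has size `k²`. The relative error is `O(n^{-3/4})` plus a sample, taken at
`k`, of the Fourier–Laplace transform of the reflected `q''`. Such samples are square summable although
the curve leaves every horizontal strip (`summable_fourierLaplace_log`): damping by `e^{-2yt}` acts on
the Fourier coefficients as convolution with `poissonWeight`, the Fourier coefficients of a Poisson
kernel, and Schur's test bounds the resulting matrix on `ℓ²` even though `y` varies with the row. This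
gives `summable_sqrt_sub_logCurve`.

*Asymptotics for `ω = 0`.* Now `cos 2k → -Q₂ / q'(1)` along the zeros, with an error given by samples
of the cosine transform of `q''` in a strip, so `e^{2ik}` approaches one of the two roots `e^{±2is}` of
a quadratic equation with separate roots, again at a square summable rate (`summable_sqrt_sub_linear`).
Which of the roots occurs is decided by the annulus if `|Q₂ / q'(1)| < 1` and by the sign of `Im k` if
`|Q₂ / q'(1)| > 1`.
-/

noncomputable section

namespace RobinTransmission

/-! ### Solutions of the Cauchy problem and their dependence on the spectral parameter -/

/-- Complex continuous functions on `[0,1]`. -/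
abbrev C01 : Type := C(Icc (0 : ℝ) 1, ℂ)

/-- The primitive vanishing at `0`, as a bounded operator on `C[0,1]`. -/
def primitiveCLM : C01 →L[ℂ] C01 :=
  LinearMap.mkContinuous
    { toFun := fun f => ⟨fun x => ∫ t in (0 : ℝ)..x, f (projIcc 0 1 zero_le_one t),
        (intervalIntegral.continuous_primitive (fun a b =>
          (f.continuous.comp continuous_projIcc).intervalIntegrable a b) 0).comp
          continuous_subtype_val⟩
      map_add' := fun f g => by
        ext x
        exact intervalIntegral.integral_add
          ((f.continuous.comp continuous_projIcc).intervalIntegrable _ _)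
          ((g.continuous.comp continuous_projIcc).intervalIntegrable _ _)
      map_smul' := fun c f => by
        ext x
        exact intervalIntegral.integral_const_mul c _ } 1 (by
    intro f
    rw [ContinuousMap.norm_le _ (by positivity)]
    intro x
    have h := intervalIntegral.norm_integral_le_of_norm_le_const (a := (0 : ℝ)) (b := x)
      (f := fun t => f (projIcc 0 1 zero_le_one t)) (C := ‖f‖) (fun t _ => f.norm_coe_le_norm _)
    refine h.trans ?_
    rw [sub_zero, abs_of_nonneg x.2.1, one_mul]
    exact mul_le_of_le_one_right (norm_nonneg _) x.2.2)

lemma primitiveCLM_apply (f : C01) (x : Icc (0 : ℝ) 1) :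
    primitiveCLM f x = ∫ t in (0 : ℝ)..x, f (projIcc 0 1 zero_le_one t) := rfl

/-- The function `e^{Mx}` on `[0,1]`. -/
def expC (M : ℝ) : C01 := ⟨fun x => (Real.exp (M * x) : ℝ), by fun_prop⟩

/-- The primitive operator conjugated by the weight `e^{Mx}`; its norm is at most `1 / M`. -/
def weightedPrimitive (M : ℝ) : C01 →L[ℂ] C01 :=
  (ContinuousLinearMap.mul ℂ C01 (expC (-M))).comp
    (primitiveCLM.comp (ContinuousLinearMap.mul ℂ C01 (expC M)))

lemma weightedPrimitive_apply (M : ℝ) (f : C01) :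
    weightedPrimitive M f = expC (-M) * primitiveCLM (expC M * f) := rfl

lemma norm_weightedPrimitive_le {M : ℝ} (hM : 0 < M) : ‖weightedPrimitive M‖ ≤ 1 / M := by
  refine ContinuousLinearMap.opNorm_le_bound _ (by positivity) fun f => ?_
  rw [ContinuousMap.norm_le _ (by positivity)]
  intro x
  have h1 : ‖primitiveCLM (expC M * f) x‖ ≤ ∫ t in (0 : ℝ)..x, Real.exp (M * t) * ‖f‖ := by
    rw [primitiveCLM_apply]
    refine intervalIntegral.norm_integral_le_of_norm_le x.2.1 ?_
      (Continuous.intervalIntegrable (by fun_prop) _ _)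
    refine ae_of_all _ fun t ht => ?_
    have ht' : t ∈ Icc (0 : ℝ) 1 := ⟨ht.1.le, ht.2.trans x.2.2⟩
    rw [projIcc_of_mem zero_le_one ht', ContinuousMap.mul_apply, norm_mul]
    gcongr
    · simp only [expC, ContinuousMap.coe_mk, Complex.norm_real, Real.norm_eq_abs, Real.abs_exp]
      exact le_rfl
    · exact f.norm_coe_le_norm _
  have h2 : ∫ t in (0 : ℝ)..x, Real.exp (M * t) * ‖f‖
      = (Real.exp (M * x) - 1) / M * ‖f‖ := by
    rw [intervalIntegral.integral_mul_const]
    congr 1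
    have hd : ∀ t ∈ uIcc (0 : ℝ) x,
        HasDerivAt (fun t => Real.exp (M * t) / M) (Real.exp (M * t)) t := by
      intro t _
      have := (((hasDerivAt_id t).const_mul M).exp).div_const M
      simp only [id, mul_one] at this
      rwa [mul_div_assoc, div_self hM.ne', mul_one] at this
    rw [intervalIntegral.integral_eq_sub_of_hasDerivAt hd
      (Continuous.intervalIntegrable (by fun_prop) _ _)]
    simp [sub_div]
  rw [weightedPrimitive_apply, ContinuousMap.mul_apply, norm_mul]
  have h3 : ‖expC (-M) x‖ = Real.exp (-(M * x)) := by
    simp only [expC, ContinuousMap.coe_mk, Complex.norm_real, Real.norm_eq_abs, Real.abs_exp]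
    congr 1; ring
  rw [h3]
  calc Real.exp (-(M * x)) * ‖primitiveCLM (expC M * f) x‖
      ≤ Real.exp (-(M * x)) * ((Real.exp (M * x) - 1) / M * ‖f‖) := by
        gcongr; exact h1.trans h2.le
    _ = (1 - Real.exp (-(M * x))) / M * ‖f‖ := by
        have : Real.exp (-(M * x)) * Real.exp (M * x) = 1 := by rw [← Real.exp_add]; simp
        linear_combination (1 / M * ‖f‖) * this
    _ ≤ 1 / M * ‖f‖ := by
        gcongr; linarith [Real.exp_pos (-(M * x))]

lemma expC_mul_expC_neg (M : ℝ) : expC M * expC (-M) = 1 := by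
  ext x
  simp only [expC, ContinuousMap.mul_apply, ContinuousMap.coe_mk, ContinuousMap.one_apply]
  rw [← Complex.ofReal_mul, ← Real.exp_add]
  simp

lemma hasDerivWithinAt_primitiveCLM (f : C01) {x : ℝ} (hx : x ∈ Icc (0 : ℝ) 1) :
    HasDerivWithinAt (fun x => primitiveCLM f (projIcc 0 1 zero_le_one x))
      (f (projIcc 0 1 zero_le_one x)) (Icc 0 1) x := by
  have hc : Continuous fun t : ℝ => f (projIcc 0 1 zero_le_one t) :=
    f.continuous.comp continuous_projIcc
  have h := (intervalIntegral.integral_hasDerivAt_right (hc.intervalIntegrable 0 x)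
    hc.stronglyMeasurable.stronglyMeasurableAtFilter hc.continuousAt).hasDerivWithinAt
      (s := Icc 0 1)
  refine h.congr (fun y hy => ?_) ?_
  · rw [primitiveCLM_apply, projIcc_of_mem zero_le_one hy]
  · rw [primitiveCLM_apply, projIcc_of_mem zero_le_one hx]

/-- The potential `q` as an element of the Banach algebra `C[0,1]`. -/
def potentialC (q : ℝ → ℝ) (hq : ContinuousOn q (Icc 0 1)) : C01 :=
  ⟨fun x => (q x : ℂ), Complex.continuous_ofReal.comp hq.domRestrict⟩

/-- The equation `ψ = g + A ψ - z B ψ` in a Banach space has a solution depending holomorphically on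
`z`, as long as the operator `A - z B` is a strict contraction. -/
lemma exists_differentiable_fixedPoint {E : Type*} [NormedAddCommGroup E] [NormedSpace ℂ E]
    [CompleteSpace E] (A B : E →L[ℂ] E) (g : E) :
    ∃ ψ : ℂ → E, ∀ z : ℂ, ‖A‖ + ‖z‖ * ‖B‖ < 1 →
      ψ z = g + (A (ψ z) - z • B (ψ z)) ∧ DifferentiableAt ℂ ψ z := by
  refine ⟨fun z => Ring.inverse (1 - (A - z • B)) g, fun z hz => ?_⟩
  have hn : ‖A - z • B‖ < 1 := by
    refine (norm_sub_le _ _).trans_lt ?_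
    rwa [norm_smul]
  have hu : IsUnit (1 - (A - z • B)) := isUnit_one_sub_of_norm_lt_one hn
  constructor
  · have h1 : (1 - (A - z • B)) (Ring.inverse (1 - (A - z • B)) g) = g := by
      change ((1 - (A - z • B)) * Ring.inverse (1 - (A - z • B))) g = g
      rw [Ring.mul_inverse_cancel _ hu]; rfl
    set y := Ring.inverse (1 - (A - z • B)) g
    have h2 : y - (A y - z • B y) = g := h1
    exact sub_eq_iff_eq_add.mp h2
  · have h1 : DifferentiableAt ℂ (fun z : ℂ => 1 - (A - z • B)) z := by fun_prop
    have h2 := (differentiableAt_inverse (𝕜 := ℂ) hu).comp z h1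
    exact h2.clm_apply (differentiableAt_const g)

/-- Solutions with Cauchy data `(a, b)` at `0` exist, and their Cauchy data at `1` depend
holomorphically on the spectral parameter. In the weight `e^{Mx}` with large `M`, the Volterra
operator of the integral equation has norm below `1`, so that `1` minus it is invertible; inversion
in the Banach algebra of operators is analytic. -/
lemma exists_solution_family {q : ℝ → ℝ} (hq : ContinuousOn q (Icc 0 1)) (a b : ℂ) (R : ℝ) :
    ∃ u v : ℂ → ℝ → ℂ, ∀ z : ℂ, ‖z‖ < R →
      IsSolution q z (u z) (v z) ∧ u z 0 = a ∧ v z 0 = b ∧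
      DifferentiableAt ℂ (fun z => u z 1) z ∧ DifferentiableAt ℂ (fun z => v z 1) z := by
  set p : C01 := potentialC q hq with hp
  set M : ℝ := ‖p‖ + |R| + 1 with hM
  have hM1 : 1 ≤ M := by have := norm_nonneg p; have := abs_nonneg R; linarith
  have hM0 : 0 < M := by linarith
  set V := weightedPrimitive M with hV
  let g : C01 := expC (-M) * ⟨fun x => a + b * (x : ℝ), by fun_prop⟩
  obtain ⟨ψ, hψ⟩ := exists_differentiable_fixedPoint
    (V.comp (V.comp (ContinuousLinearMap.mul ℂ C01 p))) (V.comp V) g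
  let U : ℂ → C01 := fun z => expC M * ψ z
  let W : ℂ → C01 := fun z =>
    ContinuousMap.const _ b + primitiveCLM (p * U z - z • U z)
  have hTnorm : ∀ z : ℂ, ‖z‖ < R →
      ‖V.comp (V.comp (ContinuousLinearMap.mul ℂ C01 p))‖ + ‖z‖ * ‖V.comp V‖ < 1 := by
    intro z hz
    have hVn : ‖V‖ ≤ 1 / M := norm_weightedPrimitive_le hM0
    have h1 : ‖V.comp (V.comp (ContinuousLinearMap.mul ℂ C01 p))‖ ≤ 1 / M * (1 / M * ‖p‖) := by
      refine (ContinuousLinearMap.opNorm_comp_le _ _).trans ?_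
      gcongr
      refine (ContinuousLinearMap.opNorm_comp_le _ _).trans ?_
      gcongr
      exact ContinuousLinearMap.opNorm_mul_apply_le ℂ C01 p
    have h2 : ‖z‖ * ‖V.comp V‖ ≤ |R| * (1 / M * (1 / M)) := by
      gcongr
      · exact hz.le.trans (le_abs_self R)
      refine (ContinuousLinearMap.opNorm_comp_le _ _).trans ?_
      gcongr
    have h3 : 1 / M ≤ 1 := by rw [div_le_one hM0]; exact hM1
    calc _ ≤ 1 / M * (1 / M * ‖p‖) + |R| * (1 / M * (1 / M)) := add_le_add h1 h2
      _ = 1 / M * ((M - 1) / M) := by rw [hM]; ring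
      _ ≤ 1 * ((M - 1) / M) := by gcongr
      _ < 1 := by rw [one_mul, div_lt_one hM0]; linarith
  have hfix : ∀ z : ℂ, ‖z‖ < R → ψ z = g + V (V (p * ψ z - z • ψ z)) := by
    intro z hz
    refine (hψ z (hTnorm z hz)).1.trans ?_
    rw [map_sub, map_sub, map_smul, map_smul]
    rfl
  have hU : ∀ z : ℂ, ‖z‖ < R → U z = ContinuousMap.const _ a + primitiveCLM (W z) := by
    intro z hz
    have hee := expC_mul_expC_neg M
    have h1 : U z = ⟨fun x => a + b * (x : ℝ), by fun_prop⟩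
        + primitiveCLM (primitiveCLM (p * U z - z • U z)) := by
      have h2 : expC M * V (V (p * ψ z - z • ψ z))
          = primitiveCLM (primitiveCLM (p * U z - z • U z)) := by
        rw [hV, weightedPrimitive_apply, ← mul_assoc, hee, one_mul, weightedPrimitive_apply,
          ← mul_assoc, hee, one_mul]
        congr 2
        simp only [U]
        rw [mul_sub, mul_smul_comm]
        ring_nf
      calc U z = expC M * (g + V (V (p * ψ z - z • ψ z))) := congrArg (expC M * ·) (hfix z hz)
        _ = _ := by
          rw [mul_add, h2]
          congr 1
          simp only [g]
          rw [← mul_assoc, hee, one_mul]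
    rw [h1]
    simp only [W, map_add]
    rw [← add_assoc]
    congr 1
    ext x
    simp [primitiveCLM_apply, mul_comm]
  have hUd : ∀ z : ℂ, ‖z‖ < R → DifferentiableAt ℂ U z := by
    intro z hz
    exact (ContinuousLinearMap.mul ℂ C01 (expC M)).differentiableAt.comp z (hψ z (hTnorm z hz)).2
  have hWd : ∀ z : ℂ, ‖z‖ < R → DifferentiableAt ℂ W z := by
    intro z hz
    have h1 := hUd z hz
    have h2 : DifferentiableAt ℂ (fun z => p * U z - z • U z) z := by fun_prop
    exact (differentiableAt_const _).add (primitiveCLM.differentiableAt.comp z h2)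
  refine ⟨fun z x => U z (projIcc 0 1 zero_le_one x), fun z x => W z (projIcc 0 1 zero_le_one x),
    fun z hz => ⟨fun x hx => ⟨?_, ?_⟩, ?_, ?_, ?_, ?_⟩⟩
  · have h := (hasDerivWithinAt_primitiveCLM (W z) hx).const_add a
    refine h.congr_of_eventuallyEq (Eventually.of_forall fun y => ?_) ?_ <;>
    · dsimp only
      rw [hU z hz]; rfl
  · have h := (hasDerivWithinAt_primitiveCLM (p * U z - z • U z) hx).const_add b
    have h2 : (p * U z - z • U z) (projIcc 0 1 zero_le_one x)
        = ((q x : ℂ) - z) * U z (projIcc 0 1 zero_le_one x) := by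
      simp only [ContinuousMap.sub_apply, ContinuousMap.mul_apply, ContinuousMap.smul_apply,
        smul_eq_mul]
      rw [sub_mul, projIcc_of_mem zero_le_one hx]; rfl
    rw [h2] at h
    exact h
  · dsimp only
    rw [hU z hz]
    simp [primitiveCLM_apply]
  · simp [W, primitiveCLM_apply]
  · exact (ContinuousMap.evalCLM ℂ (projIcc 0 1 zero_le_one (1 : ℝ))).differentiableAt.comp z
      (hUd z hz)
  · exact (ContinuousMap.evalCLM ℂ (projIcc 0 1 zero_le_one (1 : ℝ))).differentiableAt.comp z
      (hWd z hz)

/-- Integral form of the fundamental theorem of calculus on `[0,x]` for one-sided derivatives. -/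
lemma integral_eq_sub_of_Icc {f f' : ℝ → ℂ}
    (hf : ∀ x ∈ Icc (0 : ℝ) 1, HasDerivWithinAt f (f' x) (Icc 0 1) x)
    (hc : ContinuousOn f' (Icc 0 1)) {x : ℝ} (hx : x ∈ Icc (0 : ℝ) 1) :
    ∫ t in (0 : ℝ)..x, f' t = f x - f 0 := by
  have hsub : Icc 0 x ⊆ Icc (0 : ℝ) 1 := Icc_subset_Icc_right hx.2
  refine intervalIntegral.integral_eq_sub_of_hasDerivAt_of_le hx.1
    (fun t ht => (hf t (hsub ht)).continuousWithinAt.mono hsub) (fun t ht => ?_) ?_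
  · have ht' : t ∈ Ioo (0 : ℝ) 1 := ⟨ht.1, ht.2.trans_le hx.2⟩
    exact (hf t (Ioo_subset_Icc_self ht')).hasDerivAt (Icc_mem_nhds ht'.1 ht'.2)
  · refine ContinuousOn.intervalIntegrable ?_
    rw [uIcc_of_le hx.1]
    exact hc.mono hsub

lemma IsSolution.continuousOn_fst {q : ℝ → ℝ} {z : ℂ} {ψ ψ' : ℝ → ℂ} (h : IsSolution q z ψ ψ') :
    ContinuousOn ψ (Icc 0 1) := fun x hx => (h x hx).1.continuousWithinAt

/-- Lagrange's identity: the Wronskian of solutions for two potentials and one spectral parameter. -/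
lemma wronskian_sub {q p : ℝ → ℝ} {z : ℂ} {ψ ψ' χ χ' : ℝ → ℂ} (hq : ContinuousOn q (Icc 0 1))
    (hp : ContinuousOn p (Icc 0 1)) (h1 : IsSolution q z ψ ψ')
    (h2 : IsSolution p z χ χ') {x : ℝ} (hx : x ∈ Icc (0 : ℝ) 1) :
    ∫ t in (0 : ℝ)..x, ((q t : ℂ) - p t) * ψ t * χ t
      = (ψ' x * χ x - ψ x * χ' x) - (ψ' 0 * χ 0 - ψ 0 * χ' 0) := by
  refine integral_eq_sub_of_Icc (f := fun x => ψ' x * χ x - ψ x * χ' x) (fun t ht => ?_) ?_ hx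
  · obtain ⟨a1, a2⟩ := h1 t ht
    obtain ⟨b1, b2⟩ := h2 t ht
    refine ((a2.mul b1).sub (a1.mul b2)).congr_deriv ?_
    ring
  · have hq' : ContinuousOn (fun t => (q t : ℂ)) (Icc 0 1) :=
      Complex.continuous_ofReal.comp_continuousOn hq
    have hp' : ContinuousOn (fun t => (p t : ℂ)) (Icc 0 1) :=
      Complex.continuous_ofReal.comp_continuousOn hp
    exact ((hq'.sub hp').mul h1.continuousOn_fst).mul h2.continuousOn_fst

lemma wronskian_const {q : ℝ → ℝ} {z : ℂ} {ψ ψ' χ χ' : ℝ → ℂ} (hq : ContinuousOn q (Icc 0 1))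
    (h1 : IsSolution q z ψ ψ') (h2 : IsSolution q z χ χ') {x : ℝ} (hx : x ∈ Icc (0 : ℝ) 1) :
    ψ' x * χ x - ψ x * χ' x = ψ' 0 * χ 0 - ψ 0 * χ' 0 := by
  have h := wronskian_sub hq hq h1 h2 hx
  simp only [sub_self, zero_mul, intervalIntegral.integral_zero] at h
  exact (sub_eq_zero.mp h.symm)

lemma exists_solution {q : ℝ → ℝ} (hq : ContinuousOn q (Icc 0 1)) (z a b : ℂ) :
    ∃ ψ ψ' : ℝ → ℂ, IsSolution q z ψ ψ' ∧ ψ 0 = a ∧ ψ' 0 = b := by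
  obtain ⟨u, v, h⟩ := exists_solution_family hq a b (‖z‖ + 1)
  obtain ⟨h1, h2, h3, -⟩ := h z (by linarith)
  exact ⟨u z, v z, h1, h2, h3⟩

lemma IsSolution.linear_comb {q : ℝ → ℝ} {z : ℂ} {ψ ψ' χ χ' : ℝ → ℂ} (h1 : IsSolution q z ψ ψ')
    (h2 : IsSolution q z χ χ') (a b : ℂ) :
    IsSolution q z (fun x => a * ψ x + b * χ x) (fun x => a * ψ' x + b * χ' x) := by
  intro x hx
  obtain ⟨a1, a2⟩ := h1 x hx
  obtain ⟨b1, b2⟩ := h2 x hx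
  refine ⟨(a1.const_mul a).add (b1.const_mul b), ?_⟩
  refine ((a2.const_mul a).add (b2.const_mul b)).congr_deriv ?_
  ring

lemma IsSolution.unique {q : ℝ → ℝ} {z : ℂ} {ψ ψ' χ χ' : ℝ → ℂ} (hq : ContinuousOn q (Icc 0 1))
    (h1 : IsSolution q z ψ ψ') (h2 : IsSolution q z χ χ') (e : ψ 0 = χ 0) (e' : ψ' 0 = χ' 0)
    {x : ℝ} (hx : x ∈ Icc (0 : ℝ) 1) : ψ x = χ x ∧ ψ' x = χ' x := by
  obtain ⟨α, α', hα, hα0, hα0'⟩ := exists_solution hq z 1 0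
  obtain ⟨β, β', hβ, hβ0, hβ0'⟩ := exists_solution hq z 0 1
  have w1 := wronskian_const hq hα hβ hx
  have w2 := wronskian_const hq h1 hα hx
  have w3 := wronskian_const hq h1 hβ hx
  have w4 := wronskian_const hq h2 hα hx
  have w5 := wronskian_const hq h2 hβ hx
  rw [hα0, hα0', hβ0, hβ0'] at w1
  rw [e, e', ← w4] at w2
  rw [e, e', ← w5] at w3
  constructor
  · linear_combination (ψ x - χ x) * w1 - α x * w3 + β x * w2
  · linear_combination (ψ' x - χ' x) * w1 - α' x * w3 + β' x * w2

/-- The solution with `φ(0) = 1`, `φ'(0) = h`, together with its derivative. -/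
def robinSol (q : ℝ → ℝ) (h : ℝ) (z : ℂ) : (ℝ → ℂ) × (ℝ → ℂ) :=
  Classical.epsilon fun p => IsSolution q z p.1 p.2 ∧ p.1 0 = 1 ∧ p.2 0 = h

lemma robinSol_spec {q : ℝ → ℝ} (hq : ContinuousOn q (Icc 0 1)) (h : ℝ) (z : ℂ) :
    IsSolution q z (robinSol q h z).1 (robinSol q h z).2 ∧ (robinSol q h z).1 0 = 1 ∧
      (robinSol q h z).2 0 = h := by
  obtain ⟨ψ, ψ', h1, h2, h3⟩ := exists_solution hq z 1 h
  exact Classical.epsilon_spec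
    (p := fun p : (ℝ → ℂ) × (ℝ → ℂ) => IsSolution q z p.1 p.2 ∧ p.1 0 = 1 ∧ p.2 0 = h)
    ⟨(ψ, ψ'), h1, h2, h3⟩

lemma robinSol_eq {q : ℝ → ℝ} (hq : ContinuousOn q (Icc 0 1)) {h : ℝ} {z : ℂ} {ψ ψ' : ℝ → ℂ}
    (h1 : IsSolution q z ψ ψ') (h2 : ψ 0 = 1) (h3 : ψ' 0 = h) {x : ℝ} (hx : x ∈ Icc (0 : ℝ) 1) :
    (robinSol q h z).1 x = ψ x ∧ (robinSol q h z).2 x = ψ' x := by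
  obtain ⟨a1, a2, a3⟩ := robinSol_spec hq h z
  exact a1.unique hq h1 (a2.trans h2.symm) (a3.trans h3.symm) hx

lemma differentiable_robinSol {q : ℝ → ℝ} (hq : ContinuousOn q (Icc 0 1)) (h : ℝ) :
    Differentiable ℂ (fun z => (robinSol q h z).1 1) ∧
      Differentiable ℂ (fun z => (robinSol q h z).2 1) := by
  have key : ∀ z₀ : ℂ, DifferentiableAt ℂ (fun z => (robinSol q h z).1 1) z₀ ∧
      DifferentiableAt ℂ (fun z => (robinSol q h z).2 1) z₀ := by
    intro z₀
    obtain ⟨u, v, hs⟩ := exists_solution_family hq 1 h (‖z₀‖ + 1)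
    have hev : ∀ᶠ z in 𝓝 z₀, ‖z‖ < ‖z₀‖ + 1 :=
      continuous_norm.continuousAt.eventually_lt continuousAt_const (by simp)
    obtain ⟨-, -, -, d1, d2⟩ := hs z₀ (by simp)
    refine ⟨d1.congr_of_eventuallyEq ?_, d2.congr_of_eventuallyEq ?_⟩ <;>
    · filter_upwards [hev] with z hz
      obtain ⟨b1, b2, b3, -⟩ := hs z hz
      have := robinSol_eq hq b1 b2 b3 (x := 1) (by simp)
      first | exact this.1 | exact this.2
  exact ⟨fun z => (key z).1, fun z => (key z).2⟩

/-- The Wronskian at `1` of the perturbed and the unperturbed solution that satisfy the boundary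
condition at `0`. -/
def charW (q : ℝ → ℝ) (h : ℝ) (z : ℂ) : ℂ :=
  (robinSol q h z).2 1 * (robinSol (fun _ => 0) h z).1 1
    - (robinSol q h z).1 1 * (robinSol (fun _ => 0) h z).2 1

lemma continuousOn_zero_potential : ContinuousOn (fun _ : ℝ => (0 : ℝ)) (Icc 0 1) :=
  continuousOn_const

lemma differentiable_charW {q : ℝ → ℝ} (hq : ContinuousOn q (Icc 0 1)) (h : ℝ) :
    Differentiable ℂ (charW q h) := by
  have h1 := differentiable_robinSol hq h
  have h2 := differentiable_robinSol continuousOn_zero_potential h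
  exact (h1.2.mul h2.1).sub (h1.1.mul h2.2)

lemma charW_eq_integral {q : ℝ → ℝ} (hq : ContinuousOn q (Icc 0 1)) (h : ℝ) (z : ℂ) :
    charW q h z = ∫ t in (0 : ℝ)..1,
      (q t : ℂ) * (robinSol q h z).1 t * (robinSol (fun _ => 0) h z).1 t := by
  obtain ⟨a1, a2, a3⟩ := robinSol_spec hq h z
  obtain ⟨b1, b2, b3⟩ := robinSol_spec continuousOn_zero_potential h z
  have h := wronskian_sub hq continuousOn_zero_potential a1 b1 (x := 1) (by simp)
  rw [a2, a3, b2, b3] at h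
  simp only [Complex.ofReal_zero, sub_zero, mul_one, one_mul, sub_self] at h
  exact h.symm

/-- The unperturbed solution is `cos kx + h sin(kx)/k`. -/
lemma robinSol_zero {h : ℝ} {k : ℂ} (hk : k ≠ 0) {x : ℝ} (hx : x ∈ Icc (0 : ℝ) 1) :
    (robinSol (fun _ => 0) h (k ^ 2)).1 x
        = Complex.cos (k * x) + h / k * Complex.sin (k * x) ∧
      (robinSol (fun _ => 0) h (k ^ 2)).2 x
        = -k * Complex.sin (k * x) + h * Complex.cos (k * x) := by
  refine robinSol_eq continuousOn_zero_potential
    (ψ := fun x => Complex.cos (k * x) + h / k * Complex.sin (k * x))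
    (ψ' := fun x => -k * Complex.sin (k * x) + h * Complex.cos (k * x))
    (fun t _ => ?_) (by simp) (by simp) hx
  have hd : HasDerivAt (fun t : ℝ => k * (t : ℂ)) k t := by
    simpa using (Complex.ofRealCLM.hasDerivAt (x := t)).const_mul k
  have hs := (Complex.hasDerivAt_sin (k * t)).comp t hd
  have hc := (Complex.hasDerivAt_cos (k * t)).comp t hd
  constructor
  · refine ((hc.add (hs.const_mul (h / k : ℂ))).congr_deriv ?_).hasDerivWithinAt
    field_simp
  · refine (((hs.const_mul (-k)).add (hc.const_mul (h : ℂ))).congr_deriv ?_).hasDerivWithinAt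
    field_simp
    push_cast
    ring

lemma exists_isJostSolution {q : ℝ → ℝ} (hq : ContinuousOn q (Icc 0 1)) (k : ℂ) :
    ∃ f, IsJostSolution q k f := by
  obtain ⟨α, α', hα, hα0, hα0'⟩ := exists_solution hq (k ^ 2) 1 0
  obtain ⟨β, β', hβ, hβ0, hβ0'⟩ := exists_solution hq (k ^ 2) 0 1
  have w := wronskian_const hq hα hβ (x := 1) (by simp)
  rw [hα0, hα0', hβ0, hβ0'] at w
  set A := Complex.exp (Complex.I * k)
  set B := Complex.I * k * A
  refine ⟨(fun x => (A * β' 1 - B * β 1) * α x + (B * α 1 - A * α' 1) * β x,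
    fun x => (A * β' 1 - B * β 1) * α' x + (B * α 1 - A * α' 1) * β' x),
    hα.linear_comb hβ _ _, ?_, ?_⟩
  · dsimp only
    linear_combination (-A) * w
  · dsimp only
    linear_combination (-B) * w

lemma jostF_eq {q : ℝ → ℝ} (hq : ContinuousOn q (Icc 0 1)) (h : ℝ) (k : ℂ) :
    jostF q h k = -Complex.I * ((robinSol q h (k ^ 2)).1 1 * (Complex.I * k)
      - (robinSol q h (k ^ 2)).2 1) * Complex.exp (Complex.I * k) := by
  obtain ⟨h1, h2, h3⟩ : IsJostSolution q k (jost q k) :=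
    Classical.epsilon_spec (exists_isJostSolution hq k)
  obtain ⟨a1, a2, a3⟩ := robinSol_spec hq h (k ^ 2)
  have w := wronskian_const hq a1 h1 (x := 1) (by simp)
  rw [a2, a3, h2, h3] at w
  rw [jostF]
  linear_combination (-Complex.I) * w

lemma charDAux_eq {q : ℝ → ℝ} (hq : ContinuousOn q (Icc 0 1)) (h : ℝ) {k : ℂ} (hk : k ≠ 0) :
    charDAux q h k = charW q h (k ^ 2) := by
  obtain ⟨e1, e2⟩ := robinSol_zero (h := h) hk (x := 1) (by simp)
  rw [charDAux, jostF_eq hq, jostF_eq hq, charW, e1, e2, neg_sq]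
  set a := (robinSol q h (k ^ 2)).1 1
  set b := (robinSol q h (k ^ 2)).2 1
  have c1 : Complex.exp (Complex.I * k) = Complex.cos k + Complex.sin k * Complex.I := by
    rw [mul_comm, Complex.exp_mul_I]
  have c2 : Complex.exp (Complex.I * -k) = Complex.cos k - Complex.sin k * Complex.I := by
    rw [mul_comm, Complex.exp_mul_I]; simp [sub_eq_add_neg]
  rw [c1, c2, Complex.ofReal_one, mul_one]
  field_simp
  ring_nf
  simp only [Complex.I_sq]
  ring

/-- The characteristic function is the Wronskian `charW`; in particular it is entire. -/
lemma charFun_eq {q : ℝ → ℝ} (hq : ContinuousOn q (Icc 0 1)) (h : ℝ) :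
    charFun q h = charW q h := by
  have hcont := (differentiable_charW hq h).continuous
  have hD : ∀ k : ℂ, charD q h k = charW q h (k ^ 2) := by
    intro k
    by_cases hk : k = 0
    · subst hk
      rw [charD, Function.update_self]
      refine Tendsto.limUnder_eq ?_
      have h1 : Tendsto (fun k : ℂ => charW q h (k ^ 2)) (𝓝[≠] 0) (𝓝 (charW q h (0 ^ 2))) :=
        ((hcont.comp (continuous_pow 2)).tendsto 0).mono_left nhdsWithin_le_nhds
      refine h1.congr' ?_
      filter_upwards [self_mem_nhdsWithin] with k hk
      exact (charDAux_eq hq h hk).symm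
    · rw [charD, Function.update_of_ne hk, charDAux_eq hq h hk]
  ext z
  rw [charFun, hD]
  congr 1
  exact Complex.cpow_nat_inv_pow z two_ne_zero

/-- The transmission eigenvalues are the zeros of the characteristic function. -/
lemma isTransmissionEigenvalue_iff {q : ℝ → ℝ} (hq : ContinuousOn q (Icc 0 1)) (h : ℝ) (z : ℂ) :
    IsTransmissionEigenvalue q h z ↔ charW q h z = 0 := by
  obtain ⟨a1, a2, a3⟩ := robinSol_spec hq h z
  obtain ⟨b1, b2, b3⟩ := robinSol_spec continuousOn_zero_potential h z
  have multiple : ∀ {p : ℝ → ℝ} (_ : ContinuousOn p (Icc 0 1)) {ψ ψ' : ℝ → ℂ},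
      IsSolution p z ψ ψ' → ψ' 0 - h * ψ 0 = 0 → ∀ x ∈ Icc (0 : ℝ) 1,
      ψ x = ψ 0 * (robinSol p h z).1 x ∧ ψ' x = ψ 0 * (robinSol p h z).2 x := by
    intro p hp ψ ψ' hψ h0 x hx
    obtain ⟨c1, c2, c3⟩ := robinSol_spec hp h z
    have := hψ.unique hp (c1.linear_comb c1 (ψ 0) 0) (by simp [c2])
      (by rw [c3]; linear_combination h0) hx
    simpa using this
  have nonzero : ∀ {p : ℝ → ℝ} (_ : ContinuousOn p (Icc 0 1)),
      (robinSol p h z).1 1 ≠ 0 ∨ (robinSol p h z).2 1 ≠ 0 := by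
    intro p hp
    obtain ⟨c1, c2, c3⟩ := robinSol_spec hp h z
    obtain ⟨β, β', hβ, hβ0, hβ0'⟩ := exists_solution hp z 0 1
    have w := wronskian_const hp c1 hβ (x := 1) (by simp)
    rw [c2, c3, hβ0, hβ0'] at w
    by_contra! hcon
    rw [hcon.1, hcon.2] at w
    simp at w
  constructor
  · rintro ⟨ψ, ψ', ψ₀, ψ₀', s1, s2, ⟨x, hx, n1⟩, ⟨y, hy, n2⟩, i1, i2, e1, e2⟩
    have m1 := multiple hq s1 i1
    have m2 := multiple continuousOn_zero_potential s2 i2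
    have hψ0 : ψ 0 ≠ 0 := fun h0 => n1 (by rw [(m1 x hx).1, h0, zero_mul])
    have hψ₀0 : ψ₀ 0 ≠ 0 := fun h0 => n2 (by rw [(m2 y hy).1, h0, zero_mul])
    obtain ⟨m3, m4⟩ := m1 1 (by simp)
    obtain ⟨m5, m6⟩ := m2 1 (by simp)
    have : ψ 0 * (ψ₀ 0 * charW q h z) = 0 := by
      rw [charW]
      calc _ = (ψ 0 * (robinSol q h z).2 1) * (ψ₀ 0 * (robinSol (fun _ => 0) h z).1 1)
          - (ψ 0 * (robinSol q h z).1 1) * (ψ₀ 0 * (robinSol (fun _ => 0) h z).2 1) := by ring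
        _ = 0 := by rw [← m3, ← m4, ← m5, ← m6, e1, e2]; ring
    simpa [hψ0, hψ₀0] using this
  · intro hW
    rw [charW] at hW
    -- two nonzero vectors with vanishing determinant are proportional
    obtain ⟨c, hc0, hc1, hc2⟩ : ∃ c : ℂ, c ≠ 0 ∧
        (robinSol (fun _ => 0) h z).1 1 = c * (robinSol q h z).1 1 ∧
        (robinSol (fun _ => 0) h z).2 1 = c * (robinSol q h z).2 1 := by
      have n1 := nonzero hq
      have n2 := nonzero continuousOn_zero_potential
      set A := (robinSol q h z).1 1
      set A' := (robinSol q h z).2 1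
      set B := (robinSol (fun _ => 0) h z).1 1
      set B' := (robinSol (fun _ => 0) h z).2 1
      by_cases hA : A = 0
      · have hA' : A' ≠ 0 := by simpa [hA] using n1
        have hB : B = 0 := by simpa [hA, hA'] using hW
        have hB' : B' ≠ 0 := by simpa [hB] using n2
        exact ⟨B' / A', div_ne_zero hB' hA', by simp [hA, hB], by field_simp⟩
      · have hB : B ≠ 0 := by
          intro hB
          have : B' = 0 := by simpa [hB, hA] using hW
          simp [hB, this] at n2
        refine ⟨B / A, div_ne_zero hB hA, by field_simp, ?_⟩
        field_simp
        linear_combination -hW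
    refine ⟨fun x => c * (robinSol q h z).1 x + 0 * (robinSol q h z).1 x,
      fun x => c * (robinSol q h z).2 x + 0 * (robinSol q h z).2 x,
      (robinSol (fun _ => 0) h z).1, (robinSol (fun _ => 0) h z).2,
      a1.linear_comb a1 c 0, b1, ⟨0, by simp, by simp [a2, hc0]⟩, ⟨0, by simp, by simp [b2]⟩,
      ?_, ?_, ?_, ?_⟩
    · simp [a2, a3, mul_comm]
    · simp [b2, b3]
    · simp [hc1]
    · simp [hc2]

lemma charW_conj {q : ℝ → ℝ} (hq : ContinuousOn q (Icc 0 1)) (h : ℝ) (z : ℂ) :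
    charW q h ((starRingEnd ℂ) z) = (starRingEnd ℂ) (charW q h z) := by
  have key : ∀ {p : ℝ → ℝ} (_ : ContinuousOn p (Icc 0 1)),
      (robinSol p h ((starRingEnd ℂ) z)).1 1 = (starRingEnd ℂ) ((robinSol p h z).1 1) ∧
      (robinSol p h ((starRingEnd ℂ) z)).2 1 = (starRingEnd ℂ) ((robinSol p h z).2 1) := by
    intro p hp
    obtain ⟨c1, c2, c3⟩ := robinSol_spec hp h z
    refine robinSol_eq hp (ψ := fun x => (starRingEnd ℂ) ((robinSol p h z).1 x))
      (ψ' := fun x => (starRingEnd ℂ) ((robinSol p h z).2 x)) (fun x hx => ?_)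
      (by simp [c2]) (by simp [c3]) (by simp)
    obtain ⟨d1, d2⟩ := c1 x hx
    refine ⟨Complex.conjCLE.toContinuousLinearMap.hasFDerivAt.comp_hasDerivWithinAt x d1, ?_⟩
    refine (Complex.conjCLE.toContinuousLinearMap.hasFDerivAt.comp_hasDerivWithinAt x
      d2).congr_deriv ?_
    simp
  obtain ⟨e1, e2⟩ := key hq
  obtain ⟨e3, e4⟩ := key continuousOn_zero_potential
  rw [charW, charW, e1, e2, e3, e4]
  simp

/-! ### Oscillatory integrals of absolutely continuous functions -/

/-- Integration by parts of an absolutely continuous function against a `C¹` function, complex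
version. -/
lemma integral_ac_mul_deriv {m : ℝ → ℝ} {x : ℝ} (hm : AbsolutelyContinuousOnInterval m 0 x)
    {E e : ℝ → ℂ} (hE : ∀ t, HasDerivAt E (e t) t) (he : Continuous e) :
    ∫ t in (0 : ℝ)..x, (m t : ℂ) * e t
      = m x * E x - m 0 * E 0 - ∫ t in (0 : ℝ)..x, ((deriv m t : ℝ) : ℂ) * E t := by
  have hEc : Continuous E := continuous_iff_continuousAt.mpr fun t => (hE t).continuousAt
  have hint : IntervalIntegrable (deriv m) volume 0 x := hm.intervalIntegrable_deriv
  have hre : ∀ t, HasDerivAt (fun t => (E t).re) (e t).re t := fun t =>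
    Complex.reCLM.hasFDerivAt.comp_hasDerivAt t (hE t)
  have him : ∀ t, HasDerivAt (fun t => (E t).im) (e t).im t := fun t =>
    Complex.imCLM.hasFDerivAt.comp_hasDerivAt t (hE t)
  have key : ∀ (F f : ℝ → ℝ), (∀ t, HasDerivAt F (f t) t) → Continuous f →
      ∫ t in (0 : ℝ)..x, m t * f t
        = m x * F x - m 0 * F 0 - ∫ t in (0 : ℝ)..x, deriv m t * F t := by
    intro F f hF hf
    have hd : deriv F = f := funext fun t => (hF t).deriv
    have hF1 : ContDiff ℝ 1 F := by
      rw [contDiff_one_iff_deriv]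
      exact ⟨fun t => (hF t).differentiableAt, by rwa [hd]⟩
    have := hm.integral_mul_deriv_eq_deriv_mul
      (hF1.contDiffOn (s := uIcc 0 x)).absolutelyContinuousOnInterval
    rwa [hd] at this
  have split : ∀ (u : ℝ → ℝ) (v : ℝ → ℂ), Continuous v → IntervalIntegrable u volume 0 x →
      ∫ t in (0 : ℝ)..x, (u t : ℂ) * v t
        = ((∫ t in (0 : ℝ)..x, u t * (v t).re : ℝ) : ℂ)
          + ((∫ t in (0 : ℝ)..x, u t * (v t).im : ℝ) : ℂ) * Complex.I := by
    intro u v hv hu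
    have i1 : IntervalIntegrable (fun t => u t * (v t).re) volume 0 x :=
      hu.mul_continuousOn (Complex.continuous_re.comp hv).continuousOn
    have i2 : IntervalIntegrable (fun t => u t * (v t).im) volume 0 x :=
      hu.mul_continuousOn (Complex.continuous_im.comp hv).continuousOn
    have i1c : IntervalIntegrable (fun t => ((u t * (v t).re : ℝ) : ℂ)) volume 0 x :=
      ⟨i1.1.ofReal, i1.2.ofReal⟩
    have i2c : IntervalIntegrable (fun t => ((u t * (v t).im : ℝ) : ℂ)) volume 0 x :=
      ⟨i2.1.ofReal, i2.2.ofReal⟩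
    rw [← intervalIntegral.integral_ofReal, ← intervalIntegral.integral_ofReal,
      ← intervalIntegral.integral_mul_const, ← intervalIntegral.integral_add i1c
      (i2c.mul_const _)]
    refine intervalIntegral.integral_congr fun t _ => ?_
    conv_lhs => rw [← Complex.re_add_im (v t)]
    push_cast
    ring
  rw [split m e he hm.continuousOn.intervalIntegrable, split (deriv m) E hEc hint,
    key _ _ hre (Complex.continuous_re.comp he), key _ _ him (Complex.continuous_im.comp he)]
  conv_rhs => rw [← Complex.re_add_im (E x), ← Complex.re_add_im (E 0)]
  push_cast
  ring

lemma absolutelyContinuous_of_hasDerivWithinAt {u u' : ℝ → ℝ}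
    (hu : ∀ x ∈ Icc (0 : ℝ) 1, HasDerivWithinAt u (u' x) (Icc 0 1) x)
    (hc : ContinuousOn u' (Icc 0 1)) : AbsolutelyContinuousOnInterval u 0 1 := by
  obtain ⟨C, hC⟩ := isCompact_Icc.exists_bound_of_continuousOn hc
  have h := (convex_Icc (0 : ℝ) 1).lipschitzOnWith_of_nnnorm_hasDerivWithin_le
    (C := C.toNNReal) hu (fun x hx => by
      rw [← NNReal.coe_le_coe, coe_nnnorm]
      exact (hC x hx).trans (Real.le_coe_toNNReal C))
  rw [← uIcc_of_le zero_le_one] at h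
  exact h.absolutelyContinuousOnInterval

lemma deriv_of_hasDerivWithinAt {u u' : ℝ → ℝ}
    (hu : ∀ x ∈ Icc (0 : ℝ) 1, HasDerivWithinAt u (u' x) (Icc 0 1) x) {x : ℝ}
    (hx : x ∈ Ioo (0 : ℝ) 1) : deriv u x = u' x :=
  ((hu x (Ioo_subset_Icc_self hx)).hasDerivAt (Icc_mem_nhds hx.1 hx.2)).deriv

lemma integral_congr_Ioo {f g : ℝ → ℂ} (h : ∀ x ∈ Ioo (0 : ℝ) 1, f x = g x) :
    ∫ t in (0 : ℝ)..1, f t = ∫ t in (0 : ℝ)..1, g t := by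
  rw [intervalIntegral.integral_of_le zero_le_one, intervalIntegral.integral_of_le zero_le_one,
    integral_Ioc_eq_integral_Ioo, integral_Ioc_eq_integral_Ioo]
  exact setIntegral_congr_fun measurableSet_Ioo h

lemma hasDerivAt_cmul (c : ℂ) (t : ℝ) : HasDerivAt (fun t : ℝ => c * (t : ℂ)) c t := by
  simpa using (Complex.ofRealCLM.hasDerivAt (x := t)).const_mul c

lemma hasDerivAt_sin_cmul (c : ℂ) (t : ℝ) :
    HasDerivAt (fun t : ℝ => Complex.sin (c * t)) (Complex.cos (c * t) * c) t :=
  HasDerivAt.comp (h₂ := Complex.sin) t (Complex.hasDerivAt_sin (c * t)) (hasDerivAt_cmul c t)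

lemma hasDerivAt_cos_cmul (c : ℂ) (t : ℝ) :
    HasDerivAt (fun t : ℝ => Complex.cos (c * t)) (-Complex.sin (c * t) * c) t :=
  HasDerivAt.comp (h₂ := Complex.cos) t (Complex.hasDerivAt_cos (c * t)) (hasDerivAt_cmul c t)

lemma integral_ac_mul_cos {m : ℝ → ℝ} (hm : AbsolutelyContinuousOnInterval m 0 1) {c : ℂ}
    (hc : c ≠ 0) :
    ∫ t in (0 : ℝ)..1, (m t : ℂ) * Complex.cos (c * t)
      = (m 1 * Complex.sin c - ∫ t in (0 : ℝ)..1, ((deriv m t : ℝ) : ℂ) * Complex.sin (c * t)) / c := by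
  have h := integral_ac_mul_deriv hm (E := fun t => Complex.sin (c * t) / c)
    (e := fun t => Complex.cos (c * t)) (fun t => by
      refine ((hasDerivAt_sin_cmul c t).div_const c).congr_deriv ?_
      field_simp) (by fun_prop)
  rw [h]
  simp only [← mul_div_assoc, intervalIntegral.integral_div]
  simp
  ring

lemma integral_ac_mul_sin {m : ℝ → ℝ} (hm : AbsolutelyContinuousOnInterval m 0 1) {c : ℂ}
    (hc : c ≠ 0) :
    ∫ t in (0 : ℝ)..1, (m t : ℂ) * Complex.sin (c * t)
      = (m 0 - m 1 * Complex.cos c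
        + ∫ t in (0 : ℝ)..1, ((deriv m t : ℝ) : ℂ) * Complex.cos (c * t)) / c := by
  have h := integral_ac_mul_deriv hm (E := fun t => -(Complex.cos (c * t) / c))
    (e := fun t => Complex.sin (c * t)) (fun t => by
      refine ((hasDerivAt_cos_cmul c t).div_const c).neg.congr_deriv ?_
      field_simp) (by fun_prop)
  rw [h]
  simp only [mul_neg, ← mul_div_assoc, intervalIntegral.integral_neg,
    intervalIntegral.integral_div]
  simp
  ring

lemma norm_cos_le (z : ℂ) : ‖Complex.cos z‖ ≤ Real.exp |z.im| := by
  rw [Complex.cos]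
  calc _ ≤ (‖Complex.exp (z * Complex.I)‖ + ‖Complex.exp (-z * Complex.I)‖) / 2 := by
        rw [norm_div, Complex.norm_ofNat]; gcongr; exact norm_add_le _ _
    _ ≤ (Real.exp |z.im| + Real.exp |z.im|) / 2 := by
        rw [Complex.norm_exp, Complex.norm_exp]
        gcongr <;> simp [neg_le_abs, le_abs_self]
    _ = _ := by ring

lemma norm_sin_le (z : ℂ) : ‖Complex.sin z‖ ≤ Real.exp |z.im| := by
  rw [Complex.sin]
  calc _ ≤ (‖Complex.exp (-z * Complex.I)‖ + ‖Complex.exp (z * Complex.I)‖) * 1 / 2 := by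
        rw [norm_div, norm_mul, Complex.norm_ofNat, Complex.norm_I]; gcongr; exact norm_sub_le _ _
    _ ≤ (Real.exp |z.im| + Real.exp |z.im|) * 1 / 2 := by
        rw [Complex.norm_exp, Complex.norm_exp]
        gcongr <;> simp [neg_le_abs, le_abs_self]
    _ = _ := by ring

lemma norm_cos_mul_le (k : ℂ) {s : ℝ} (hs : 0 ≤ s) :
    ‖Complex.cos (k * s)‖ ≤ Real.exp (|k.im| * s) := by
  refine (norm_cos_le _).trans ?_
  rw [Complex.im_mul_ofReal, abs_mul, abs_of_nonneg hs]

lemma norm_sin_mul_le (k : ℂ) {s : ℝ} (hs : 0 ≤ s) :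
    ‖Complex.sin (k * s)‖ ≤ Real.exp (|k.im| * s) := by
  refine (norm_sin_le _).trans ?_
  rw [Complex.im_mul_ofReal, abs_mul, abs_of_nonneg hs]

/-- An integral with a weight bounded by `A` on `[0,x]` is at most `A` times the `L¹` norm. -/
lemma norm_integral_mul_le {u : ℝ → ℝ} {x : ℝ} (hx : x ∈ Icc (0 : ℝ) 1)
    (hu : IntervalIntegrable u volume 0 1)
    {e : ℝ → ℂ} {A : ℝ} (hA : 0 ≤ A) (he : ∀ t ∈ Icc 0 x, ‖e t‖ ≤ A) :
    ‖∫ t in (0 : ℝ)..x, (u t : ℂ) * e t‖ ≤ A * ∫ t in (0 : ℝ)..1, |u t| := by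
  have hsub : uIoc (0 : ℝ) x ⊆ uIoc (0 : ℝ) 1 := by
    rw [uIoc_of_le hx.1, uIoc_of_le zero_le_one]
    exact Ioc_subset_Ioc_right hx.2
  have hux : IntervalIntegrable u volume 0 x := by
    rw [intervalIntegrable_iff] at hu ⊢
    exact hu.mono_set hsub
  calc _ ≤ ∫ t in (0 : ℝ)..x, A * |u t| := by
        refine intervalIntegral.norm_integral_le_of_norm_le hx.1 ?_ (hux.abs.const_mul A)
        refine ae_of_all _ fun t ht => ?_
        rw [norm_mul, Complex.norm_real, Real.norm_eq_abs, mul_comm]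
        gcongr
        exact he t ⟨ht.1.le, ht.2⟩
    _ = A * ∫ t in (0 : ℝ)..x, |u t| := intervalIntegral.integral_const_mul _ _
    _ ≤ _ := by
        gcongr
        rw [intervalIntegral.integral_of_le hx.1, intervalIntegral.integral_of_le zero_le_one]
        refine setIntegral_mono_set ?_ (ae_of_all _ fun t => abs_nonneg _)
          (Ioc_subset_Ioc_right hx.2).eventuallyLE
        have := hu.abs
        rwa [intervalIntegrable_iff_integrableOn_Ioc_of_le zero_le_one] at this

/-- Against `cos 2kt` and `sin 2kt`, an absolutely continuous function has integrals of order
`e^{2|Im k|}/|k|`. -/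
lemma exists_bound_integral_ac_mul_trig {m : ℝ → ℝ}
    (hm : AbsolutelyContinuousOnInterval m 0 1) :
    ∃ C : ℝ, 0 ≤ C ∧ ∀ k : ℂ, k ≠ 0 →
      ‖∫ t in (0 : ℝ)..1, (m t : ℂ) * Complex.cos (2 * k * t)‖
          ≤ C * (Real.exp (2 * |k.im|) / ‖k‖) ∧
      ‖∫ t in (0 : ℝ)..1, (m t : ℂ) * Complex.sin (2 * k * t)‖
          ≤ C * (Real.exp (2 * |k.im|) / ‖k‖) := by
  have hint := hm.intervalIntegrable_deriv
  have hI : 0 ≤ ∫ t in (0 : ℝ)..1, |deriv m t| :=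
    intervalIntegral.integral_nonneg zero_le_one fun t _ => abs_nonneg _
  refine ⟨(|m 0| + |m 1| + ∫ t in (0 : ℝ)..1, |deriv m t|) / 2, by positivity, fun k hk => ?_⟩
  have h2k : (2 * k) ≠ 0 := mul_ne_zero two_ne_zero hk
  have hk0 : 0 < ‖k‖ := norm_pos_iff.mpr hk
  set A := Real.exp (2 * |k.im|) with hA
  have hA1 : 1 ≤ A := Real.one_le_exp (by positivity)
  have him : |(2 * k).im| = 2 * |k.im| := by simp [abs_mul]
  have hle : ∀ t ∈ Icc (0 : ℝ) 1, Real.exp (|(2 * k).im| * t) ≤ A := by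
    intro t ht
    rw [hA, him, Real.exp_le_exp]
    exact mul_le_of_le_one_right (by positivity) ht.2
  have b1 := norm_integral_mul_le (x := 1) (by simp) hint (e := fun t => Complex.sin (2 * k * t))
    (A := A) (by positivity) (fun t ht => (norm_sin_mul_le _ ht.1).trans (hle t ht))
  have b2 := norm_integral_mul_le (x := 1) (by simp) hint (e := fun t => Complex.cos (2 * k * t))
    (A := A) (by positivity) (fun t ht => (norm_cos_mul_le _ ht.1).trans (hle t ht))
  have s1 : ‖Complex.sin (2 * k)‖ ≤ A := (norm_sin_le _).trans (by rw [him])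
  have s2 : ‖Complex.cos (2 * k)‖ ≤ A := (norm_cos_le _).trans (by rw [him])
  have hn : ‖(2 * k)‖ = 2 * ‖k‖ := by simp
  set I1 := ∫ t in (0 : ℝ)..1, |deriv m t|
  constructor
  · rw [integral_ac_mul_cos hm h2k, norm_div, hn]
    rw [show (|m 0| + |m 1| + I1) / 2 * (A / ‖k‖) = (|m 0| + |m 1| + I1) * A / (2 * ‖k‖) by
      field_simp]
    gcongr
    refine (norm_sub_le _ _).trans ?_
    rw [norm_mul, Complex.norm_real, Real.norm_eq_abs]
    have := mul_le_mul_of_nonneg_left s1 (abs_nonneg (m 1))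
    nlinarith [abs_nonneg (m 0)]
  · rw [integral_ac_mul_sin hm h2k, norm_div, hn]
    rw [show (|m 0| + |m 1| + I1) / 2 * (A / ‖k‖) = (|m 0| + |m 1| + I1) * A / (2 * ‖k‖) by
      field_simp]
    gcongr
    refine (norm_add_le _ _).trans ((add_le_add_left (norm_sub_le _ _) _).trans ?_)
    rw [norm_mul, Complex.norm_real, Complex.norm_real, Real.norm_eq_abs, Real.norm_eq_abs]
    have := mul_le_mul_of_nonneg_left s2 (abs_nonneg (m 1))
    nlinarith [abs_nonneg (m 0)]

/-- The convolution-type integral `∫₀ˣ cos k(x-2t) m(t) dt` of an absolutely continuous `m` is of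
order `e^{|Im k|x}/|k|`. -/
lemma exists_bound_integral_ac_mul_cos_sub {m : ℝ → ℝ}
    (hm : AbsolutelyContinuousOnInterval m 0 1) :
    ∃ C : ℝ, 0 ≤ C ∧ ∀ k : ℂ, k ≠ 0 → ∀ x ∈ Icc (0 : ℝ) 1,
      ‖∫ t in (0 : ℝ)..x, (m t : ℂ) * Complex.cos (k * (x - 2 * t))‖
          ≤ C * (Real.exp (|k.im| * x) / ‖k‖) := by
  have hint := hm.intervalIntegrable_deriv
  have hI : 0 ≤ ∫ t in (0 : ℝ)..1, |deriv m t| :=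
    intervalIntegral.integral_nonneg zero_le_one fun t _ => abs_nonneg _
  obtain ⟨B, hB⟩ := hm.exists_bound
  rw [uIcc_of_le zero_le_one] at hB
  have hB0 : 0 ≤ B := (norm_nonneg _).trans (hB 0 (by simp))
  refine ⟨(2 * B + ∫ t in (0 : ℝ)..1, |deriv m t|) / 2, by positivity, fun k hk x hx => ?_⟩
  have h2k : (2 * k) ≠ 0 := mul_ne_zero two_ne_zero hk
  have hk0 : 0 < ‖k‖ := norm_pos_iff.mpr hk
  set A := Real.exp (|k.im| * x) with hA
  have hmx : AbsolutelyContinuousOnInterval m 0 x := hm.mono (by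
    rw [uIcc_of_le hx.1, uIcc_of_le zero_le_one]; exact Icc_subset_Icc_right hx.2)
  have hsin : ∀ t ∈ Icc 0 x, ‖Complex.sin (k * (x - 2 * t))‖ ≤ A := by
    intro t ht
    refine (norm_sin_le _).trans ?_
    rw [hA, Real.exp_le_exp, show (k * ((x : ℂ) - 2 * t)) = k * ((x - 2 * t : ℝ) : ℂ) by push_cast; ring,
      Complex.im_mul_ofReal, abs_mul]
    gcongr
    rw [abs_le]; constructor <;> linarith [ht.1, ht.2]
  have hd : ∀ t : ℝ, HasDerivAt (fun t : ℝ => -(Complex.sin (k * (x - 2 * t)) / (2 * k)))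
      (Complex.cos (k * (x - 2 * t))) t := by
    intro t
    have h1 : HasDerivAt (fun t : ℝ => k * ((x : ℂ) - 2 * t)) (k * (-2)) t := by
      have := ((hasDerivAt_cmul 2 t).const_sub (x : ℂ)).const_mul k
      simpa using this
    refine (((Complex.hasDerivAt_sin _).comp t h1).div_const (2 * k)).neg.congr_deriv ?_
    field_simp
  rw [integral_ac_mul_deriv hmx hd (by fun_prop)]
  have e1 : ∫ t in (0 : ℝ)..x, ((deriv m t : ℝ) : ℂ) * -(Complex.sin (k * (x - 2 * t)) / (2 * k))
      = -((∫ t in (0 : ℝ)..x, ((deriv m t : ℝ) : ℂ) * Complex.sin (k * (x - 2 * t))) / (2 * k)) := by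
    rw [← intervalIntegral.integral_div, ← intervalIntegral.integral_neg]
    congr 1; ext t; ring
  have b1 := norm_integral_mul_le hx hint (e := fun t => Complex.sin (k * (x - 2 * t)))
    (A := A) (by positivity) hsin
  have s1 := hsin x ⟨hx.1, le_rfl⟩
  have s0 := hsin 0 ⟨le_rfl, hx.1⟩
  rw [e1]
  set S := ∫ t in (0 : ℝ)..x, ((deriv m t : ℝ) : ℂ) * Complex.sin (k * (x - 2 * t))
  set I1 := ∫ t in (0 : ℝ)..1, |deriv m t|
  rw [show (m x : ℂ) * -(Complex.sin (k * (x - 2 * x)) / (2 * k))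
      - m 0 * -(Complex.sin (k * (x - 2 * (0 : ℝ))) / (2 * k)) - -(S / (2 * k))
      = (-(m x * Complex.sin (k * (x - 2 * x))) + m 0 * Complex.sin (k * (x - 2 * (0 : ℝ))) + S)
        / (2 * k) by ring, norm_div,
    show (2 * B + I1) / 2 * (A / ‖k‖) = (B * A + B * A + A * I1) / ‖2 * k‖ by
      rw [norm_mul, Complex.norm_ofNat]; field_simp; ring]
  gcongr
  refine (norm_add_le _ _).trans (add_le_add ((norm_add_le _ _).trans (add_le_add ?_ ?_)) b1)
  · rw [norm_neg, norm_mul, Complex.norm_real]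
    exact mul_le_mul (hB x hx) s1 (norm_nonneg _) hB0
  · rw [norm_mul, Complex.norm_real]
    exact mul_le_mul (hB 0 (by simp)) s0 (norm_nonneg _) hB0

/-! ### Asymptotics of the characteristic function -/

lemma MemW22.hasDerivWithinAt {q : ℝ → ℝ} (hq : MemW22 q) :
    ∀ x ∈ Icc (0 : ℝ) 1, HasDerivWithinAt q (deriv01 q x) (Icc 0 1) x := fun x hx =>
  (hq.differentiableOn x hx).hasDerivWithinAt

lemma MemW22.continuousOn {q : ℝ → ℝ} (hq : MemW22 q) : ContinuousOn q (Icc 0 1) :=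
  hq.differentiableOn.continuousOn

lemma MemW22.continuousOn_deriv01 {q : ℝ → ℝ} (hq : MemW22 q) :
    ContinuousOn (deriv01 q) (Icc 0 1) := by
  have := hq.absolutelyContinuous.continuousOn
  rwa [uIcc_of_le zero_le_one] at this

/-- The primitive `Q(x) = ∫₀ˣ q` of the potential. -/
def potentialPrim (q : ℝ → ℝ) (x : ℝ) : ℝ := ∫ t in (0 : ℝ)..x, q t

lemma potentialPrim_zero (q : ℝ → ℝ) : potentialPrim q 0 = 0 := intervalIntegral.integral_same

lemma hasDerivWithinAt_potentialPrim {q : ℝ → ℝ} (hq : ContinuousOn q (Icc 0 1)) :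
    ∀ x ∈ Icc (0 : ℝ) 1, HasDerivWithinAt (potentialPrim q) (q x) (Icc 0 1) x := by
  intro x hx
  set p : ℝ → ℝ := IccExtend zero_le_one ((Icc (0 : ℝ) 1).domRestrict q) with hp
  have hc : Continuous p := hq.domRestrict.Icc_extend'
  have hpq : ∀ t ∈ Icc (0 : ℝ) 1, p t = q t := fun t ht => by
    rw [hp, IccExtend_of_mem _ _ ht]; rfl
  have h := (intervalIntegral.integral_hasDerivAt_right (hc.intervalIntegrable 0 x)
    hc.stronglyMeasurable.stronglyMeasurableAtFilter hc.continuousAt).hasDerivWithinAt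
      (s := Icc 0 1)
  rw [hpq x hx] at h
  have he : ∀ y ∈ Icc (0 : ℝ) 1, potentialPrim q y = ∫ t in (0 : ℝ)..y, p t := by
    intro y hy
    refine intervalIntegral.integral_congr fun t ht => ?_
    rw [uIcc_of_le hy.1] at ht
    exact (hpq t ⟨ht.1, ht.2.trans hy.2⟩).symm
  exact h.congr he (he x hx)

/-- The coefficient `b(x) = h + ½ ∫₀ˣ q` of `sin(kx)/k` in the expansion of the solution. -/
def coefB (q : ℝ → ℝ) (h x : ℝ) : ℝ := h + potentialPrim q x / 2

/-- The coefficient `M(x) = (q(x) - q(0))/2 - h Q(x) - Q(x)²/4` of `cos(kx)/(2k²)` in the expansion of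
the solution. -/
def coefM (q : ℝ → ℝ) (h x : ℝ) : ℝ :=
  (q x - q 0) / 2 - h * potentialPrim q x - potentialPrim q x ^ 2 / 4

/-- The derivative `m = q'/2 - q b` of `coefM`. -/
def coefM' (q : ℝ → ℝ) (h x : ℝ) : ℝ := deriv01 q x / 2 - q x * coefB q h x

lemma hasDerivWithinAt_coefB {q : ℝ → ℝ} (hq : ContinuousOn q (Icc 0 1)) (h : ℝ) :
    ∀ x ∈ Icc (0 : ℝ) 1, HasDerivWithinAt (coefB q h) (q x / 2) (Icc 0 1) x := fun x hx =>
  ((hasDerivWithinAt_potentialPrim hq x hx).div_const 2).const_add h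

lemma continuousOn_coefB {q : ℝ → ℝ} (hq : ContinuousOn q (Icc 0 1)) (h : ℝ) :
    ContinuousOn (coefB q h) (Icc 0 1) := fun x hx =>
  (hasDerivWithinAt_coefB hq h x hx).continuousWithinAt

lemma hasDerivWithinAt_coefM {q : ℝ → ℝ} (hq : MemW22 q) (h : ℝ) :
    ∀ x ∈ Icc (0 : ℝ) 1, HasDerivWithinAt (coefM q h) (coefM' q h x) (Icc 0 1) x := by
  intro x hx
  have h1 := hasDerivWithinAt_potentialPrim hq.continuousOn x hx
  have h2 := hq.hasDerivWithinAt x hx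
  refine ((((h2.sub_const (q 0)).div_const 2).sub (h1.const_mul h)).sub
    ((h1.pow 2).div_const 4)).congr_deriv ?_
  rw [coefM', coefB]
  push_cast
  ring

lemma continuousOn_coefM {q : ℝ → ℝ} (hq : MemW22 q) (h : ℝ) :
    ContinuousOn (coefM q h) (Icc 0 1) := fun x hx =>
  (hasDerivWithinAt_coefM hq h x hx).continuousWithinAt

lemma coefM_zero (q : ℝ → ℝ) (h : ℝ) : coefM q h 0 = 0 := by
  simp [coefM, potentialPrim_zero]

lemma MemW22.absolutelyContinuous_self {q : ℝ → ℝ} (hq : MemW22 q) :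
    AbsolutelyContinuousOnInterval q 0 1 :=
  absolutelyContinuous_of_hasDerivWithinAt hq.hasDerivWithinAt hq.continuousOn_deriv01

lemma absolutelyContinuous_coefB {q : ℝ → ℝ} (hq : ContinuousOn q (Icc 0 1)) (h : ℝ) :
    AbsolutelyContinuousOnInterval (coefB q h) 0 1 :=
  absolutelyContinuous_of_hasDerivWithinAt (hasDerivWithinAt_coefB hq h) (hq.div_const 2)

lemma absolutelyContinuous_coefM' {q : ℝ → ℝ} (hq : MemW22 q) (h : ℝ) :
    AbsolutelyContinuousOnInterval (coefM' q h) 0 1 := by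
  have h1 := (hq.absolutelyContinuous.const_mul (1 / 2)).sub
    (hq.absolutelyContinuous_self.fun_mul (absolutelyContinuous_coefB hq.continuousOn h))
  have h2 : coefM' q h
      = (fun x => 1 / 2 * deriv01 q x) - fun x => q x * coefB q h x := by
    ext x; simp [coefM']; ring
  rw [h2]; exact h1

lemma continuousOn_coefM' {q : ℝ → ℝ} (hq : MemW22 q) (h : ℝ) :
    ContinuousOn (coefM' q h) (Icc 0 1) := by
  have := (absolutelyContinuous_coefM' hq h).continuousOn
  rwa [uIcc_of_le zero_le_one] at this

lemma absolutelyContinuous_coefM {q : ℝ → ℝ} (hq : MemW22 q) (h : ℝ) :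
    AbsolutelyContinuousOnInterval (coefM q h) 0 1 :=
  absolutelyContinuous_of_hasDerivWithinAt (hasDerivWithinAt_coefM hq h) (continuousOn_coefM' hq h)

/-- Duhamel's formula for `w'' + k² w = r` with zero Cauchy data. -/
lemma duhamel {k : ℂ} (hk : k ≠ 0) {w w' r : ℝ → ℂ}
    (h1 : ∀ x ∈ Icc (0 : ℝ) 1, HasDerivWithinAt w (w' x) (Icc 0 1) x)
    (h2 : ∀ x ∈ Icc (0 : ℝ) 1, HasDerivWithinAt w' (r x - k ^ 2 * w x) (Icc 0 1) x)
    (hr : ContinuousOn r (Icc 0 1)) (hw : w 0 = 0) (hw' : w' 0 = 0) {x : ℝ}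
    (hx : x ∈ Icc (0 : ℝ) 1) :
    w x = ∫ t in (0 : ℝ)..x, Complex.sin (k * ((x - t : ℝ) : ℂ)) / k * r t := by
  have hd : ∀ t : ℝ, HasDerivAt (fun t : ℝ => k * ((x - t : ℝ) : ℂ)) (-k) t := by
    intro t
    have := ((hasDerivAt_cmul 1 t).const_sub (x : ℂ)).const_mul k
    simpa using this
  have hs : ∀ t : ℝ, HasDerivAt (fun t : ℝ => Complex.sin (k * ((x - t : ℝ) : ℂ)))
      (Complex.cos (k * ((x - t : ℝ) : ℂ)) * (-k)) t := fun t =>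
    HasDerivAt.comp (h₂ := Complex.sin) t (Complex.hasDerivAt_sin _) (hd t)
  have hc : ∀ t : ℝ, HasDerivAt (fun t : ℝ => Complex.cos (k * ((x - t : ℝ) : ℂ)))
      (-Complex.sin (k * ((x - t : ℝ) : ℂ)) * (-k)) t := fun t =>
    HasDerivAt.comp (h₂ := Complex.cos) t (Complex.hasDerivAt_cos _) (hd t)
  have h := integral_eq_sub_of_Icc (f := fun t => Complex.sin (k * ((x - t : ℝ) : ℂ)) / k * w' t
      + Complex.cos (k * ((x - t : ℝ) : ℂ)) * w t)
    (f' := fun t => Complex.sin (k * ((x - t : ℝ) : ℂ)) / k * r t) (fun t ht => ?_) ?_ hx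
  · rw [h]
    simp [hw, hw']
  · refine ((((hs t).div_const k).hasDerivWithinAt.mul (h2 t ht)).add
      ((hc t).hasDerivWithinAt.mul (h1 t ht))).congr_deriv ?_
    field_simp
    ring
  · exact (Continuous.continuousOn (by fun_prop)).mul hr

/-- The solution `φ` with `φ(0) = 1`, `φ'(0) = h` up to an error of order `e^{|Im k|x}/|k|³`. -/
lemma exists_bound_robinSol_sub {q : ℝ → ℝ} (hq : MemW22 q) (h : ℝ) :
    ∃ C K : ℝ, 0 ≤ C ∧ 0 < K ∧ ∀ k : ℂ, K ≤ ‖k‖ → ∀ x ∈ Icc (0 : ℝ) 1,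
      ‖(robinSol q h (k ^ 2)).1 x - (Complex.cos (k * x) + coefB q h x / k * Complex.sin (k * x)
        + coefM q h x / (2 * k ^ 2) * Complex.cos (k * x))‖
        ≤ C * (Real.exp (|k.im| * x) / ‖k‖ ^ 3) := by
  have hqc := hq.continuousOn
  obtain ⟨Cq, hCq⟩ := isCompact_Icc.exists_bound_of_continuousOn hqc
  obtain ⟨Cm, hCm⟩ := isCompact_Icc.exists_bound_of_continuousOn (continuousOn_coefM' hq h)
  have hCq0 : 0 ≤ Cq := (norm_nonneg _).trans (hCq 0 (by simp))
  have hCm0 : 0 ≤ Cm := (norm_nonneg _).trans (hCm 0 (by simp))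
  obtain ⟨C₁, hC₁0, hC₁⟩ := exists_bound_integral_ac_mul_cos_sub (absolutelyContinuous_coefM' hq h)
  refine ⟨2 * Cq * Cm + C₁ / 2, 2 * Cq + 1, by positivity, by positivity, fun k hkK => ?_⟩
  have hk0 : 0 < ‖k‖ := lt_of_lt_of_le (by positivity) hkK
  have hk : k ≠ 0 := norm_pos_iff.mp hk0
  obtain ⟨a1, a2, a3⟩ := robinSol_spec hqc h (k ^ 2)
  set φ := (robinSol q h (k ^ 2)).1
  set φ' := (robinSol q h (k ^ 2)).2
  set τ := |k.im| with hτ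
  -- `w` is the remainder after the terms of order up to `1/k`; it solves `w'' + k² w = q w - ρ`
  let w : ℝ → ℂ := fun x =>
    φ x - (Complex.cos (k * x) + coefB q h x / k * Complex.sin (k * x))
  let w' : ℝ → ℂ := fun x =>
    φ' x - (-k * Complex.sin (k * x) + q x / (2 * k) * Complex.sin (k * x)
      + coefB q h x * Complex.cos (k * x))
  let ρ : ℝ → ℂ := fun x => coefM' q h x / k * Complex.sin (k * x)
  have hB : ∀ x ∈ Icc (0 : ℝ) 1,
      HasDerivWithinAt (fun x => (coefB q h x : ℂ)) ((q x / 2 : ℝ) : ℂ) (Icc 0 1) x := fun x hx =>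
    (hasDerivWithinAt_coefB hqc h x hx).ofReal_comp
  have hQ : ∀ x ∈ Icc (0 : ℝ) 1,
      HasDerivWithinAt (fun x => (q x : ℂ)) (deriv01 q x : ℂ) (Icc 0 1) x := fun x hx =>
    (hq.hasDerivWithinAt x hx).ofReal_comp
  have hs := fun x : ℝ => (hasDerivAt_sin_cmul k x).hasDerivWithinAt (s := Icc 0 1)
  have hc := fun x : ℝ => (hasDerivAt_cos_cmul k x).hasDerivWithinAt (s := Icc 0 1)
  have hw1 : ∀ x ∈ Icc (0 : ℝ) 1, HasDerivWithinAt w (w' x) (Icc 0 1) x := by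
    intro x hx
    refine ((a1 x hx).1.sub ((hc x).add (((hB x hx).div_const k).mul (hs x)))).congr_deriv ?_
    simp only [w']
    push_cast
    field_simp
    ring
  have hw2 : ∀ x ∈ Icc (0 : ℝ) 1,
      HasDerivWithinAt w' ((q x * w x - ρ x) - k ^ 2 * w x) (Icc 0 1) x := by
    intro x hx
    refine ((a1 x hx).2.sub ((((hs x).const_mul (-k)).add
      (((hQ x hx).div_const (2 * k)).mul (hs x))).add ((hB x hx).mul (hc x)))).congr_deriv ?_
    simp only [w, ρ, coefM']
    push_cast
    field_simp
    ring
  have hwc : ContinuousOn w (Icc 0 1) := fun x hx => (hw1 x hx).continuousWithinAt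
  have hqcc : ContinuousOn (fun t => (q t : ℂ)) (Icc 0 1) :=
    Complex.continuous_ofReal.comp_continuousOn hqc
  have hmcc : ContinuousOn (fun t => (coefM' q h t : ℂ)) (Icc 0 1) :=
    Complex.continuous_ofReal.comp_continuousOn (continuousOn_coefM' hq h)
  have hρc : ContinuousOn ρ (Icc 0 1) :=
    (hmcc.div_const k).mul (Continuous.continuousOn (by fun_prop))
  have hrc : ContinuousOn (fun x => q x * w x - ρ x) (Icc 0 1) := (hqcc.mul hwc).sub hρc
  have hduh : ∀ x ∈ Icc (0 : ℝ) 1, w x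
      = ∫ t in (0 : ℝ)..x, Complex.sin (k * ((x - t : ℝ) : ℂ)) / k * (q t * w t - ρ t) :=
    fun x hx => duhamel hk hw1 hw2 hrc
      (by simp [w, a2]) (by simp [w', a3, coefB, potentialPrim_zero]) hx
  -- the maximum `N` of `|w| e^{-τx}` is estimated by Duhamel's formula: for large `k` the
  -- contribution of `q w` is at most `N / 2` and can be absorbed
  obtain ⟨y, hy, hmax⟩ := isCompact_Icc.exists_isMaxOn (nonempty_Icc.mpr zero_le_one)
    (f := fun x => ‖w x‖ * Real.exp (-(τ * x)))
    (hwc.norm.mul (Continuous.continuousOn (by fun_prop)))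
  set N := ‖w y‖ * Real.exp (-(τ * y)) with hN
  have hN0 : 0 ≤ N := by positivity
  have hwN : ∀ x ∈ Icc (0 : ℝ) 1, ‖w x‖ ≤ N * Real.exp (τ * x) := by
    intro x hx
    have : ‖w x‖ * Real.exp (-(τ * x)) ≤ N := hmax hx
    calc ‖w x‖ = ‖w x‖ * Real.exp (-(τ * x)) * Real.exp (τ * x) := by
          rw [mul_assoc, ← Real.exp_add]; simp
      _ ≤ _ := by gcongr
  have hsin : ∀ x t : ℝ, t ≤ x → ‖Complex.sin (k * ((x - t : ℝ) : ℂ)) / k‖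
      ≤ Real.exp (τ * (x - t)) / ‖k‖ := by
    intro x t htx
    rw [norm_div]
    gcongr
    exact norm_sin_mul_le k (by linarith)
  have hqw : ∀ x ∈ Icc (0 : ℝ) 1,
      ‖∫ t in (0 : ℝ)..x, Complex.sin (k * ((x - t : ℝ) : ℂ)) / k * (q t * w t)‖
        ≤ Real.exp (τ * x) / ‖k‖ * (Cq * N) := by
    intro x hx
    have := intervalIntegral.norm_integral_le_of_norm_le_const (a := (0 : ℝ)) (b := x)
      (f := fun t => Complex.sin (k * ((x - t : ℝ) : ℂ)) / k * (q t * w t))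
      (C := Real.exp (τ * x) / ‖k‖ * (Cq * N)) (fun t ht => by
        rw [uIoc_of_le hx.1] at ht
        have ht' : t ∈ Icc (0 : ℝ) 1 := ⟨ht.1.le, ht.2.trans hx.2⟩
        rw [norm_mul, norm_mul, Complex.norm_real]
        calc _ ≤ Real.exp (τ * (x - t)) / ‖k‖ * (Cq * (N * Real.exp (τ * t))) := by
              gcongr
              · exact hsin x t ht.2
              · exact hCq t ht'
              · exact hwN t ht'
          _ = Real.exp (τ * (x - t)) * Real.exp (τ * t) / ‖k‖ * (Cq * N) := by ring
          _ = _ := by rw [← Real.exp_add]; ring_nf)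
    refine this.trans ?_
    rw [sub_zero, abs_of_nonneg hx.1]
    exact mul_le_of_le_one_right (by positivity) hx.2
  have hρ : ∀ x ∈ Icc (0 : ℝ) 1,
      ‖∫ t in (0 : ℝ)..x, Complex.sin (k * ((x - t : ℝ) : ℂ)) / k * ρ t‖
        ≤ Real.exp (τ * x) / ‖k‖ * (Cm / ‖k‖) := by
    intro x hx
    have := intervalIntegral.norm_integral_le_of_norm_le_const (a := (0 : ℝ)) (b := x)
      (f := fun t => Complex.sin (k * ((x - t : ℝ) : ℂ)) / k * ρ t)
      (C := Real.exp (τ * x) / ‖k‖ * (Cm / ‖k‖)) (fun t ht => by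
        rw [uIoc_of_le hx.1] at ht
        have ht' : t ∈ Icc (0 : ℝ) 1 := ⟨ht.1.le, ht.2.trans hx.2⟩
        simp only [ρ]
        rw [norm_mul, norm_mul, norm_div (coefM' q h t : ℂ), Complex.norm_real]
        calc _ ≤ Real.exp (τ * (x - t)) / ‖k‖ * (Cm / ‖k‖ * Real.exp (τ * t)) := by
              gcongr
              · exact hsin x t ht.2
              · exact hCm t ht'
              · exact norm_sin_mul_le k ht'.1
          _ = Real.exp (τ * (x - t)) * Real.exp (τ * t) / ‖k‖ * (Cm / ‖k‖) := by ring
          _ = _ := by rw [← Real.exp_add]; ring_nf)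
    refine this.trans ?_
    rw [sub_zero, abs_of_nonneg hx.1]
    exact mul_le_of_le_one_right (by positivity) hx.2
  have hsplit : ∀ x ∈ Icc (0 : ℝ) 1, w x
      = (∫ t in (0 : ℝ)..x, Complex.sin (k * ((x - t : ℝ) : ℂ)) / k * (q t * w t))
        - ∫ t in (0 : ℝ)..x, Complex.sin (k * ((x - t : ℝ) : ℂ)) / k * ρ t := by
    intro x hx
    have hsub : uIcc 0 x ⊆ Icc (0 : ℝ) 1 := by
      rw [uIcc_of_le hx.1]; exact Icc_subset_Icc_right hx.2
    have hcs : Continuous fun t : ℝ => Complex.sin (k * ((x - t : ℝ) : ℂ)) / k := by fun_prop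
    rw [hduh x hx, ← intervalIntegral.integral_sub]
    · congr 1; ext t; ring
    · exact (hcs.continuousOn.mul ((hqcc.mul hwc).mono hsub)).intervalIntegrable
    · exact (hcs.continuousOn.mul (hρc.mono hsub)).intervalIntegrable
  have hNle : N ≤ 2 * Cm / ‖k‖ ^ 2 := by
    have h1 : ‖w y‖ ≤ Real.exp (τ * y) / ‖k‖ * (Cq * N) + Real.exp (τ * y) / ‖k‖ * (Cm / ‖k‖) := by
      rw [hsplit y hy]
      exact (norm_sub_le _ _).trans (add_le_add (hqw y hy) (hρ y hy))
    have h2 : N ≤ Cq * N / ‖k‖ + Cm / ‖k‖ ^ 2 := by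
      calc N ≤ (Real.exp (τ * y) / ‖k‖ * (Cq * N) + Real.exp (τ * y) / ‖k‖ * (Cm / ‖k‖))
            * Real.exp (-(τ * y)) := by rw [hN]; gcongr
        _ = (Real.exp (τ * y) * Real.exp (-(τ * y))) * (Cq * N / ‖k‖ + Cm / ‖k‖ ^ 2) := by
            field_simp
        _ = _ := by rw [← Real.exp_add]; simp
    have h3 : Cq * N / ‖k‖ ≤ N / 2 := by
      rw [div_le_div_iff₀ hk0 two_pos]
      nlinarith
    have h4 : 2 * Cm / ‖k‖ ^ 2 = 2 * (Cm / ‖k‖ ^ 2) := by ring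
    linarith
  intro x hx
  have hsub : uIcc 0 x ⊆ Icc (0 : ℝ) 1 := by
    rw [uIcc_of_le hx.1]; exact Icc_subset_Icc_right hx.2
  -- `2 sin k(x-t) sin kt = cos k(x-2t) - cos kx`, and the constant `cos kx` yields the term with
  -- `coefM`
  set S := ∫ t in (0 : ℝ)..x, (coefM' q h t : ℂ) * Complex.cos (k * (x - 2 * t)) with hS
  have hM : ∫ t in (0 : ℝ)..x, (coefM' q h t : ℂ) = coefM q h x := by
    rw [integral_eq_sub_of_Icc (f := fun x => (coefM q h x : ℂ))
      (fun t ht => (hasDerivWithinAt_coefM hq h t ht).ofReal_comp) hmcc hx, coefM_zero]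
    simp
  have hρint : ∫ t in (0 : ℝ)..x, Complex.sin (k * ((x - t : ℝ) : ℂ)) / k * ρ t
      = (S - Complex.cos (k * x) * coefM q h x) / (2 * k ^ 2) := by
    rw [← hM, hS, ← intervalIntegral.integral_const_mul, ← intervalIntegral.integral_sub,
      ← intervalIntegral.integral_div]
    · refine intervalIntegral.integral_congr fun t _ => ?_
      simp only [ρ]
      have e1 : Complex.cos (k * (x - 2 * t)) = Complex.cos (k * ((x - t : ℝ) : ℂ) - k * t) := by
        congr 1; push_cast; ring
      have e2 : Complex.cos (k * x) = Complex.cos (k * ((x - t : ℝ) : ℂ) + k * t) := by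
        congr 1; push_cast; ring
      rw [e1, e2, Complex.cos_sub, Complex.cos_add]
      field_simp
      ring
    · exact ((hmcc.mono hsub).mul (Continuous.continuousOn (by fun_prop))).intervalIntegrable
    · exact (continuousOn_const.mul (hmcc.mono hsub)).intervalIntegrable
  have hfin : φ x - (Complex.cos (k * x) + coefB q h x / k * Complex.sin (k * x)
        + coefM q h x / (2 * k ^ 2) * Complex.cos (k * x))
      = (∫ t in (0 : ℝ)..x, Complex.sin (k * ((x - t : ℝ) : ℂ)) / k * (q t * w t))
        - S / (2 * k ^ 2) := by
    have := hsplit x hx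
    rw [hρint] at this
    simp only [w] at this
    linear_combination this
  rw [hfin]
  have hSle := hC₁ k hk x hx
  calc _ ≤ Real.exp (τ * x) / ‖k‖ * (Cq * (2 * Cm / ‖k‖ ^ 2))
        + C₁ * (Real.exp (τ * x) / ‖k‖) / (2 * ‖k‖ ^ 2) := by
        refine (norm_sub_le _ _).trans (add_le_add ((hqw x hx).trans ?_) ?_)
        · gcongr
        · rw [norm_div]
          simp only [norm_mul, norm_pow, Complex.norm_ofNat]
          gcongr
    _ = _ := by field_simp

/-- The constant term of `8 k² Δ(k²)`; it agrees with `Q₂` when `ω = 0`. -/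
def constTerm (q : ℝ → ℝ) (h : ℝ) : ℝ :=
  -deriv01 q 0 + 4 * h * q 0 + 4 * h * (∫ x in (0 : ℝ)..1, q x * coefB q h x)
    + 2 * ∫ x in (0 : ℝ)..1, q x * coefM q h x

/-- The integrals `∫ q Qⁿ = Q(1)ⁿ⁺¹ / (n + 1)` vanish when `ω = Q(1) = 0`. -/
lemma constTerm_eq_Q₂ {q : ℝ → ℝ} (hq : MemW22 q) (h : ℝ) (hω : omega q = 0) :
    constTerm q h = Q₂ q h := by
  have hqc := hq.continuousOn
  have hqi : ContinuousOn q (uIcc 0 1) := by rwa [uIcc_of_le zero_le_one]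
  have hPc : ContinuousOn (potentialPrim q) (uIcc 0 1) := by
    rw [uIcc_of_le zero_le_one]
    exact fun x hx => (hasDerivWithinAt_potentialPrim hqc x hx).continuousWithinAt
  have key : ∀ n : ℕ, ∫ x in (0 : ℝ)..1, q x * potentialPrim q x ^ (n + 1) = 0 := by
    intro n
    have h1 : ∀ x ∈ Ioo (0 : ℝ) 1, HasDerivAt
        (fun x => potentialPrim q x ^ (n + 2) / ((n : ℝ) + 2))
        (q x * potentialPrim q x ^ (n + 1)) x := by
      intro x hx
      have h2 := (hasDerivWithinAt_potentialPrim hqc x (Ioo_subset_Icc_self hx)).hasDerivAt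
        (Icc_mem_nhds hx.1 hx.2)
      refine ((h2.pow (n + 2)).div_const ((n : ℝ) + 2)).congr_deriv ?_
      have : ((n : ℝ) + 2) ≠ 0 := by positivity
      push_cast
      field_simp
    rw [intervalIntegral.integral_eq_sub_of_hasDerivAt_of_le zero_le_one
      (f := fun x => potentialPrim q x ^ (n + 2) / ((n : ℝ) + 2)) ?_ h1 ?_]
    · simp [potentialPrim_zero, show potentialPrim q 1 = 0 from hω]
    · rw [← uIcc_of_le (zero_le_one' ℝ)]; exact (hPc.pow _).div_const _
    · exact (hqi.mul (hPc.pow _)).intervalIntegrable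
  have k0 := key 0
  have k1 := key 1
  simp only [zero_add, pow_one] at k0
  have i1 : ∫ x in (0 : ℝ)..1, q x * coefB q h x = 0 := by
    have : ∀ x, q x * coefB q h x = h * q x + 1 / 2 * (q x * potentialPrim q x) := fun x => by
      rw [coefB]; ring
    simp_rw [this]
    rw [intervalIntegral.integral_add, intervalIntegral.integral_const_mul,
      intervalIntegral.integral_const_mul, k0, show ∫ x in (0 : ℝ)..1, q x = 0 from hω]
    · simp
    · exact (continuousOn_const.mul hqi).intervalIntegrable
    · exact (continuousOn_const.mul (hqi.mul hPc)).intervalIntegrable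
  have i2 : ∫ x in (0 : ℝ)..1, q x * coefM q h x = (∫ x in (0 : ℝ)..1, q x ^ 2) / 2 := by
    have : ∀ x, q x * coefM q h x = (1 / 2 * q x ^ 2 + -(q 0 / 2) * q x)
        + (-h * (q x * potentialPrim q x) + -(1 / 4) * (q x * potentialPrim q x ^ 2)) := fun x => by
      rw [coefM]; ring
    simp_rw [this]
    rw [intervalIntegral.integral_add, intervalIntegral.integral_add,
      intervalIntegral.integral_add, intervalIntegral.integral_const_mul,
      intervalIntegral.integral_const_mul, intervalIntegral.integral_const_mul,
      intervalIntegral.integral_const_mul, k0, k1, show ∫ x in (0 : ℝ)..1, q x = 0 from hω]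
    · ring
    all_goals exact ContinuousOn.intervalIntegrable (by fun_prop)
  rw [constTerm, i1, i2, Q₂, hω]
  ring

/-- The trigonometric integrals that make up `8 k² ∫ q A φ₀`, where `A` is the three-term expansion of
the perturbed solution. -/
lemma integral_main_eq {q : ℝ → ℝ} (hq : MemW22 q) (h : ℝ) {k : ℂ} (hk : k ≠ 0) :
    8 * k ^ 2 * ∫ t in (0 : ℝ)..1, (q t : ℂ)
        * (Complex.cos (k * t) + coefB q h t / k * Complex.sin (k * t)
          + coefM q h t / (2 * k ^ 2) * Complex.cos (k * t))
        * (Complex.cos (k * t) + h / k * Complex.sin (k * t))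
      = 4 * omega q * k ^ 2
        + 4 * k ^ 2 * (∫ t in (0 : ℝ)..1, (q t : ℂ) * Complex.cos (2 * k * t))
        + 4 * k * (∫ t in (0 : ℝ)..1,
            ((q t * (coefB q h t + h) : ℝ) : ℂ) * Complex.sin (2 * k * t))
        + 4 * h * ((∫ x in (0 : ℝ)..1, q x * coefB q h x : ℝ) : ℂ)
        - 4 * h * (∫ t in (0 : ℝ)..1, ((q t * coefB q h t : ℝ) : ℂ) * Complex.cos (2 * k * t))
        + 2 * ((∫ x in (0 : ℝ)..1, q x * coefM q h x : ℝ) : ℂ)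
        + 2 * (∫ t in (0 : ℝ)..1, ((q t * coefM q h t : ℝ) : ℂ) * Complex.cos (2 * k * t))
        + 2 * h / k
          * (∫ t in (0 : ℝ)..1, ((q t * coefM q h t : ℝ) : ℂ) * Complex.sin (2 * k * t)) := by
  have c1 : ContinuousOn (fun t => (q t : ℂ)) (uIcc 0 1) := by
    rw [uIcc_of_le zero_le_one]
    exact Complex.continuous_ofReal.comp_continuousOn hq.continuousOn
  have c2 : ContinuousOn (fun t => (coefB q h t : ℂ)) (uIcc 0 1) := by
    rw [uIcc_of_le zero_le_one]
    exact Complex.continuous_ofReal.comp_continuousOn (continuousOn_coefB hq.continuousOn h)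
  have c3 : ContinuousOn (fun t => (coefM q h t : ℂ)) (uIcc 0 1) := by
    rw [uIcc_of_le zero_le_one]
    exact Complex.continuous_ofReal.comp_continuousOn (continuousOn_coefM hq h)
  rw [show omega q = ∫ t in (0 : ℝ)..1, q t from rfl]
  simp only [← intervalIntegral.integral_ofReal, ← intervalIntegral.integral_const_mul,
    Complex.ofReal_mul, Complex.ofReal_add]
  have mc : ∀ (f : ℝ → ℂ) (c : ℂ), (∫ t in (0 : ℝ)..1, f t) * c = ∫ t in (0 : ℝ)..1, f t * c :=
    fun f c => (intervalIntegral.integral_mul_const c f).symm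
  rw [mc]
  rw [← intervalIntegral.integral_add, ← intervalIntegral.integral_add,
    ← intervalIntegral.integral_add, ← intervalIntegral.integral_sub,
    ← intervalIntegral.integral_add, ← intervalIntegral.integral_add,
    ← intervalIntegral.integral_add]
  · refine intervalIntegral.integral_congr fun t _ => ?_
    have e1 : Complex.cos (2 * k * t)
        = Complex.cos (k * t) * Complex.cos (k * t) - Complex.sin (k * t) * Complex.sin (k * t) := by
      rw [← Complex.cos_add]; congr 1; ring
    have e2 : Complex.sin (2 * k * t)
        = Complex.sin (k * t) * Complex.cos (k * t) + Complex.cos (k * t) * Complex.sin (k * t) := by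
      rw [← Complex.sin_add]; congr 1; ring
    have e3 := Complex.sin_sq_add_cos_sq (k * t)
    simp only [e1, e2]
    set s := Complex.sin (k * t)
    set c := Complex.cos (k * t)
    field_simp
    -- both sides agree modulo `s² + c² = 1`
    linear_combination (8 * k ^ 3 * (q t : ℂ) + 8 * k * q t * coefB q h t * h
      + 4 * k * q t * coefM q h t) * e3
  all_goals exact ContinuousOn.intervalIntegrable (by fun_prop)

/-- The asymptotics of the characteristic function: `8 k² Δ(k²)` is
`4 ω k² + q'(1) cos 2k + const - ∫₀¹ q'' cos 2kx dx` up to an error of order `e^{2|Im k|}/|k|`. -/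
lemma exists_bound_charW_sub {q : ℝ → ℝ} (hq : MemW22 q) (hq1 : q 1 = 0) (h : ℝ) :
    ∃ C K : ℝ, 0 ≤ C ∧ 0 < K ∧ ∀ k : ℂ, K ≤ ‖k‖ →
      ‖8 * k ^ 2 * charW q h (k ^ 2) - (4 * omega q * k ^ 2 + deriv01 q 1 * Complex.cos (2 * k)
        + constTerm q h
        - ∫ t in (0 : ℝ)..1, ((deriv (deriv01 q) t : ℝ) : ℂ) * Complex.cos (2 * k * t))‖
      ≤ C * (Real.exp (2 * |k.im|) / ‖k‖) := by
  have hqc := hq.continuousOn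
  have acq := hq.absolutelyContinuous_self
  have acB := absolutelyContinuous_coefB hqc h
  have acM := absolutelyContinuous_coefM hq h
  have acu3 := acq.fun_mul acB
  have acu4 := acq.fun_mul acM
  let v : ℝ → ℝ := fun x => deriv01 q x * (coefB q h x + h) + q x * (q x / 2)
  have hBh : ∀ x ∈ Icc (0 : ℝ) 1,
      HasDerivWithinAt (fun x => coefB q h x + h) (q x / 2) (Icc 0 1) x :=
    fun x hx => (hasDerivWithinAt_coefB hqc h x hx).add_const h
  have acBh : AbsolutelyContinuousOnInterval (fun x => coefB q h x + h) 0 1 :=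
    absolutelyContinuous_of_hasDerivWithinAt hBh (hqc.div_const 2)
  have acv : AbsolutelyContinuousOnInterval v 0 1 := by
    have h1 : AbsolutelyContinuousOnInterval (fun x => q x / 2) 0 1 := by
      have := acq.const_mul (1 / 2)
      convert this using 1
      ext x
      simp
      ring
    exact (hq.absolutelyContinuous.fun_mul acBh).add (acq.fun_mul h1)
  have hu2 : ∀ x ∈ Icc (0 : ℝ) 1,
      HasDerivWithinAt (fun x => q x * (coefB q h x + h)) (v x) (Icc 0 1) x :=
    fun x hx => (hq.hasDerivWithinAt x hx).mul (hBh x hx)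
  have acu2 := acq.fun_mul acBh
  obtain ⟨C₀, K₀, hC₀0, hK₀0, hC₀⟩ := exists_bound_robinSol_sub hq h
  obtain ⟨C₁, hC₁0, hC₁⟩ := exists_bound_integral_ac_mul_trig acv
  obtain ⟨C₃, hC₃0, hC₃⟩ := exists_bound_integral_ac_mul_trig acu3
  obtain ⟨C₄, hC₄0, hC₄⟩ := exists_bound_integral_ac_mul_trig acu4
  obtain ⟨Cq, hCq⟩ := isCompact_Icc.exists_bound_of_continuousOn hqc
  have hCq0 : 0 ≤ Cq := (norm_nonneg _).trans (hCq 0 (by simp))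
  refine ⟨2 * C₁ + 4 * |h| * C₃ + 2 * C₄ + 2 * |h| * C₄ + 8 * (Cq * C₀ * (1 + |h|)),
    max K₀ 1, by positivity, by positivity, fun k hkK => ?_⟩
  have hk1 : 1 ≤ ‖k‖ := (le_max_right _ _).trans hkK
  have hk0 : 0 < ‖k‖ := by linarith
  have hk : k ≠ 0 := norm_pos_iff.mp hk0
  have h2k : 2 * k ≠ 0 := mul_ne_zero two_ne_zero hk
  set A := Real.exp (2 * |k.im|) with hA
  let P : ℝ → ℂ := fun t => Complex.cos (k * t) + coefB q h t / k * Complex.sin (k * t)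
          + coefM q h t / (2 * k ^ 2) * Complex.cos (k * t)
  let φ₀ : ℝ → ℂ := fun t => Complex.cos (k * t) + h / k * Complex.sin (k * t)
  have c1 : ContinuousOn (fun t => (q t : ℂ)) (Icc 0 1) :=
    Complex.continuous_ofReal.comp_continuousOn hqc
  have c2 : ContinuousOn (fun t => (coefB q h t : ℂ)) (Icc 0 1) :=
    Complex.continuous_ofReal.comp_continuousOn (continuousOn_coefB hqc h)
  have c3 : ContinuousOn (fun t => (coefM q h t : ℂ)) (Icc 0 1) :=
    Complex.continuous_ofReal.comp_continuousOn (continuousOn_coefM hq h)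
  have cφ := (robinSol_spec hqc h (k ^ 2)).1.continuousOn_fst
  set φ := (robinSol q h (k ^ 2)).1
  -- the remainder of the perturbed solution contributes to the error only
  have hsplit : charW q h (k ^ 2) = (∫ t in (0 : ℝ)..1, (q t : ℂ) * P t * φ₀ t)
      + ∫ t in (0 : ℝ)..1, (q t : ℂ) * (φ t - P t) * φ₀ t := by
    rw [charW_eq_integral hqc, ← intervalIntegral.integral_add]
    · refine intervalIntegral.integral_congr fun t ht => ?_
      rw [uIcc_of_le zero_le_one] at ht
      rw [(robinSol_zero (h := h) hk ht).1]
      ring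
    · rw [← uIcc_of_le (zero_le_one' ℝ)] at c1 c2 c3
      exact ContinuousOn.intervalIntegrable (by fun_prop)
    · rw [← uIcc_of_le (zero_le_one' ℝ)] at c1 c2 c3 cφ
      exact ContinuousOn.intervalIntegrable (by fun_prop)
  have herr : ‖∫ t in (0 : ℝ)..1, (q t : ℂ) * (φ t - P t) * φ₀ t‖
      ≤ Cq * C₀ * (1 + |h|) * (A / ‖k‖ ^ 3) := by
    have := intervalIntegral.norm_integral_le_of_norm_le_const (a := (0 : ℝ)) (b := 1)
      (f := fun t => (q t : ℂ) * (φ t - P t) * φ₀ t)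
      (C := Cq * C₀ * (1 + |h|) * (A / ‖k‖ ^ 3)) (fun t ht => by
        rw [uIoc_of_le zero_le_one] at ht
        have ht' : t ∈ Icc (0 : ℝ) 1 := ⟨ht.1.le, ht.2⟩
        set e := Real.exp (|k.im| * t) with he
        have b1 : ‖φ₀ t‖ ≤ e + |h| * e := by
          refine (norm_add_le _ _).trans (add_le_add (norm_cos_mul_le k ht'.1) ?_)
          rw [norm_mul, norm_div, Complex.norm_real, Real.norm_eq_abs]
          gcongr
          · exact div_le_self (abs_nonneg h) hk1
          · exact norm_sin_mul_le k ht'.1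
        have hee : e * e ≤ A := by
          rw [he, hA, ← Real.exp_add, Real.exp_le_exp]
          nlinarith [abs_nonneg k.im, ht.2, mul_nonneg (abs_nonneg k.im) (sub_nonneg.mpr ht.2)]
        rw [norm_mul, norm_mul, Complex.norm_real]
        calc _ ≤ Cq * (C₀ * (e / ‖k‖ ^ 3)) * (e + |h| * e) := by
              gcongr
              · exact hCq t ht'
              · exact hC₀ k ((le_max_left _ _).trans hkK) t ht'
          _ = Cq * C₀ * (1 + |h|) * ((e * e) / ‖k‖ ^ 3) := by ring
          _ ≤ _ := by gcongr)
    simpa using this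
  -- two integrations by parts in the leading oscillatory integral; `q(1) = 0` removes the term of
  -- order `k`
  have hC1 : 4 * k ^ 2 * (∫ t in (0 : ℝ)..1, (q t : ℂ) * Complex.cos (2 * k * t))
      = deriv01 q 1 * Complex.cos (2 * k) - deriv01 q 0
        - ∫ t in (0 : ℝ)..1, ((deriv (deriv01 q) t : ℝ) : ℂ) * Complex.cos (2 * k * t) := by
    rw [integral_ac_mul_cos acq h2k, hq1,
      integral_congr_Ioo (f := fun t => ((deriv q t : ℝ) : ℂ) * Complex.sin (2 * k * t))
        (g := fun t => (deriv01 q t : ℂ) * Complex.sin (2 * k * t))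
        (fun x hx => by rw [deriv_of_hasDerivWithinAt hq.hasDerivWithinAt hx]),
      integral_ac_mul_sin hq.absolutelyContinuous h2k]
    push_cast
    field_simp
    ring
  have hS2 : 4 * k * (∫ t in (0 : ℝ)..1,
        ((q t * (coefB q h t + h) : ℝ) : ℂ) * Complex.sin (2 * k * t))
      = 4 * h * q 0 + 2 * ∫ t in (0 : ℝ)..1, (v t : ℂ) * Complex.cos (2 * k * t) := by
    rw [integral_ac_mul_sin acu2 h2k,
      integral_congr_Ioo
        (f := fun t => ((deriv (fun x => q x * (coefB q h x + h)) t : ℝ) : ℂ)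
          * Complex.cos (2 * k * t))
        (g := fun t => (v t : ℂ) * Complex.cos (2 * k * t))
        (fun x hx => by rw [deriv_of_hasDerivWithinAt hu2 hx]),
      hq1, coefB, potentialPrim_zero]
    push_cast
    field_simp
    ring
  have hmain := integral_main_eq hq h hk
  rw [hC1, hS2] at hmain
  set I1 := ∫ t in (0 : ℝ)..1, (v t : ℂ) * Complex.cos (2 * k * t)
  set I3 := ∫ t in (0 : ℝ)..1, ((q t * coefB q h t : ℝ) : ℂ) * Complex.cos (2 * k * t)
  set I4 := ∫ t in (0 : ℝ)..1, ((q t * coefM q h t : ℝ) : ℂ) * Complex.cos (2 * k * t)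
  set I5 := ∫ t in (0 : ℝ)..1, ((q t * coefM q h t : ℝ) : ℂ) * Complex.sin (2 * k * t)
  set E := ∫ t in (0 : ℝ)..1, (q t : ℂ) * (φ t - P t) * φ₀ t
  have htot : 8 * k ^ 2 * charW q h (k ^ 2) - (4 * omega q * k ^ 2
        + deriv01 q 1 * Complex.cos (2 * k) + constTerm q h
        - ∫ t in (0 : ℝ)..1, ((deriv (deriv01 q) t : ℝ) : ℂ) * Complex.cos (2 * k * t))
      = 2 * I1 - 4 * h * I3 + 2 * I4 + 2 * h / k * I5 + 8 * k ^ 2 * E := by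
    rw [hsplit, mul_add, hmain, constTerm]
    push_cast
    ring
  rw [htot]
  have n1 := (hC₁ k hk).1
  have n3 := (hC₃ k hk).1
  have n4 := (hC₄ k hk).1
  have n5 := (hC₄ k hk).2
  calc _ ≤ ‖2 * I1‖ + ‖4 * h * I3‖ + ‖2 * I4‖ + ‖2 * h / k * I5‖ + ‖8 * k ^ 2 * E‖ := by
        refine (norm_add_le _ _).trans (add_le_add_left ?_ _)
        refine (norm_add_le _ _).trans (add_le_add_left ?_ _)
        refine (norm_add_le _ _).trans (add_le_add_left ?_ _)
        exact norm_sub_le _ _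
    _ ≤ 2 * (C₁ * (A / ‖k‖)) + 4 * |h| * (C₃ * (A / ‖k‖)) + 2 * (C₄ * (A / ‖k‖))
        + 2 * |h| * (C₄ * (A / ‖k‖)) + 8 * ‖k‖ ^ 2 * (Cq * C₀ * (1 + |h|) * (A / ‖k‖ ^ 3)) := by
        simp only [norm_mul, norm_div, norm_pow, Complex.norm_ofNat, Complex.norm_real,
          Real.norm_eq_abs]
        gcongr
        exact div_le_self (by positivity) hk1
    _ = _ := by field_simp

/-! ### Counting the zeros of entire functions in disks -/

/-- A zero of order `n` of an entire function splits off as `(z - a) ^ n`. -/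
lemma exists_entire_factor {f : ℂ → ℂ} (hf : Differentiable ℂ f) (a : ℂ) (n : ℕ)
    (hn : analyticOrderAt f a = n) :
    ∃ g : ℂ → ℂ, Differentiable ℂ g ∧ (∀ z, f z = (z - a) ^ n * g z) ∧ g a ≠ 0 := by
  induction n generalizing f with
  | zero =>
    refine ⟨f, hf, by simp, ?_⟩
    rw [Nat.cast_zero, (hf.analyticAt a).analyticOrderAt_eq_zero] at hn
    exact hn
  | succ n ih =>
    have h0 : f a = 0 := by
      have : analyticOrderAt f a ≠ 0 := by rw [hn]; simp
      exact apply_eq_zero_of_analyticOrderAt_ne_zero this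
    have hd : Differentiable ℂ (dslope f a) := by
      rw [← differentiableOn_univ] at hf ⊢
      exact (Complex.differentiableOn_dslope univ_mem).mpr hf
    have hmul : f = (fun z => z - a) * dslope f a := by
      ext z
      have := sub_smul_dslope f a z
      rw [h0, sub_zero, smul_eq_mul] at this
      exact this.symm
    have hid : analyticOrderAt (fun z : ℂ => z - a) a = 1 :=
      (show AnalyticAt ℂ (fun z : ℂ => z - a) a by fun_prop).analyticOrderAt_eq_one_of_zero_deriv_ne_zero
        (sub_self a) (by simp)
    have hord : analyticOrderAt (dslope f a) a = n := by
      have h1 := hn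
      rw [hmul, analyticOrderAt_mul (by fun_prop) (hd.analyticAt a), hid, Nat.cast_succ,
        add_comm] at h1
      exact ENat.add_left_injective_of_ne_top (by simp : (1 : ℕ∞) ≠ ⊤) h1
    obtain ⟨g, hg, hfg, hga⟩ := ih hd hord
    refine ⟨g, hg, fun z => ?_, hga⟩
    rw [congrFun hmul z, Pi.mul_apply, hfg z]
    ring

lemma analyticOrderAt_ne_top_of_entire {f : ℂ → ℂ} (hf : Differentiable ℂ f) {w : ℂ} (hw : f w ≠ 0)
    (a : ℂ) : analyticOrderAt f a ≠ ⊤ := by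
  rw [Ne, AnalyticOnNhd.analyticOrderAt_eq_top_iff_eq_zero a fun z => hf.analyticAt z]
  exact fun h => hw (by rw [h]; rfl)

lemma multiset_prod_sub_ne_zero {s : Multiset ℂ} {z : ℂ} (hz : z ∉ s) :
    (s.map fun a => z - a).prod ≠ 0 := by
  refine Multiset.prod_ne_zero fun h => ?_
  obtain ⟨a, ha, h0⟩ := Multiset.mem_map.mp h
  exact hz (by rwa [sub_eq_zero.mp h0])

lemma differentiable_multiset_prod_sub (s : Multiset ℂ) :
    Differentiable ℂ fun z => (s.map fun a => z - a).prod := by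
  induction s using Multiset.induction with
  | empty => simp
  | cons a s ih =>
    simp only [Multiset.map_cons, Multiset.prod_cons]
    exact (differentiable_id.sub_const a).mul ih

/-- The zeros of an entire function in a finite set, with their multiplicities, split off as a
polynomial factor. -/
lemma exists_multiset_factor {f : ℂ → ℂ} (hf : Differentiable ℂ f) {w : ℂ} (hw : f w ≠ 0)
    (T : Finset ℂ) :
    ∃ (s : Multiset ℂ) (g : ℂ → ℂ), Differentiable ℂ g ∧
      (∀ z, f z = (s.map fun a => z - a).prod * g z) ∧
      (∀ a, s.count a = if a ∈ T then analyticOrderNatAt f a else 0) ∧ ∀ a ∈ T, g a ≠ 0 := by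
  classical
  induction T using Finset.induction with
  | empty => exact ⟨0, f, hf, by simp, by simp, by simp⟩
  | insert b T hb ih =>
    obtain ⟨s, g, hg, hfg, hs, hgT⟩ := ih
    have hbs : b ∉ s := by
      rw [← Multiset.count_eq_zero, hs, if_neg hb]
    have hP := differentiable_multiset_prod_sub s
    have hfe : f = (fun z => (s.map fun a => z - a).prod) * g := funext hfg
    have hord : analyticOrderAt f b = analyticOrderAt g b := by
      have h0 : analyticOrderAt (fun z => (s.map fun a => z - a).prod) b = 0 := by
        rw [(hP.analyticAt b).analyticOrderAt_eq_zero]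
        exact multiset_prod_sub_ne_zero hbs
      conv_lhs => rw [hfe]
      rw [analyticOrderAt_mul (hP.analyticAt b) (hg.analyticAt b), h0, zero_add]
    have hcast : analyticOrderAt g b = (analyticOrderNatAt f b : ℕ) := by
      rw [← hord, Nat.cast_analyticOrderNatAt (analyticOrderAt_ne_top_of_entire hf hw b)]
    obtain ⟨g', hg', hgg', hg'b⟩ := exists_entire_factor hg b _ hcast
    refine ⟨Multiset.replicate (analyticOrderNatAt f b) b + s, g', hg', fun z => ?_, fun a => ?_,
      fun a ha => ?_⟩
    · rw [hfg, hgg' z]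
      simp
      ring
    · rw [Multiset.count_add, hs, Multiset.count_replicate]
      by_cases hab : b = a
      · subst hab; simp [hb]
      · simp [hab, Ne.symm hab]
    · rcases Finset.mem_insert.mp ha with rfl | haT
      · exact hg'b
      · intro h0
        exact hgT a haT (by rw [hgg', h0, mul_zero])

/-- The argument principle for a polynomial times a zero-free function. -/
lemma circleIntegral_logDeriv_prod {R : ℝ} (hR : 0 < R) {g : ℂ → ℂ} (hg : Differentiable ℂ g)
    (hg0 : ∀ z ∈ Metric.closedBall (0 : ℂ) R, g z ≠ 0) (s : Multiset ℂ)
    (hs : ∀ a ∈ s, a ∈ Metric.ball (0 : ℂ) R) :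
    (∮ z in C(0, R), logDeriv (fun z => (s.map fun a => z - a).prod * g z) z)
      = 2 * Real.pi * Complex.I * Multiset.card s := by
  induction s using Multiset.induction with
  | empty =>
    simp only [Multiset.map_zero, Multiset.prod_zero, one_mul, Multiset.card_zero, Nat.cast_zero,
      mul_zero]
    have hdg : Differentiable ℂ (deriv g) := fun z =>
      ((hg.analyticAt z).deriv).differentiableAt
    have hd : ∀ z ∈ Metric.closedBall (0 : ℂ) R, DifferentiableAt ℂ (logDeriv g) z := fun z hz =>
      (hdg z).div (hg z) (hg0 z hz)
    exact Complex.circleIntegral_eq_zero_of_differentiable_on_off_countable hR.le countable_empty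
      (fun z hz => (hd z hz).continuousAt.continuousWithinAt)
      (fun z hz => hd z (Metric.ball_subset_closedBall hz.1))
  | cons a s ih =>
    have ha : a ∈ Metric.ball (0 : ℂ) R := hs a (Multiset.mem_cons_self a s)
    have hs' : ∀ b ∈ s, b ∈ Metric.ball (0 : ℂ) R := fun b hb => hs b (Multiset.mem_cons_of_mem hb)
    have hsph : ∀ z ∈ Metric.sphere (0 : ℂ) R, ∀ b ∈ Metric.ball (0 : ℂ) R, z ≠ b := by
      rintro z hz b hb rfl
      rw [mem_sphere_zero_iff_norm] at hz
      rw [mem_ball_zero_iff] at hb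
      linarith
    set F : ℂ → ℂ := fun z => (s.map fun a => z - a).prod * g z with hF
    have hFd : Differentiable ℂ F := (differentiable_multiset_prod_sub s).mul hg
    have hF0 : ∀ z ∈ Metric.sphere (0 : ℂ) R, F z ≠ 0 := fun z hz =>
      mul_ne_zero (multiset_prod_sub_ne_zero fun hzs => hsph z hz z (hs' z hzs) rfl)
        (hg0 z (Metric.sphere_subset_closedBall hz))
    have heq : ∀ z ∈ Metric.sphere (0 : ℂ) R,
        logDeriv (fun z => ((a ::ₘ s).map fun a => z - a).prod * g z) z
          = (z - a)⁻¹ + logDeriv F z := by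
      intro z hz
      have e1 : (fun z => ((a ::ₘ s).map fun a => z - a).prod * g z)
          = fun z => (z - a) * F z := by
        ext z; simp [hF, mul_assoc]
      rw [e1, logDeriv_mul (f := fun z => z - a) (g := F) z (sub_ne_zero.mpr (hsph z hz a ha))
        (hF0 z hz) (by fun_prop) (hFd z)]
      congr 1
      rw [logDeriv_apply]
      simp
    rw [circleIntegral.integral_congr hR.le heq, circleIntegral.integral_add, ih hs',
      circleIntegral.integral_sub_inv_of_mem_ball ha, Multiset.card_cons]
    · push_cast; ring
    · refine ContinuousOn.circleIntegrable hR.le fun z hz => ?_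
      exact (ContinuousAt.inv₀ (f := fun z => z - a) (by fun_prop)
        (sub_ne_zero.mpr (hsph z hz a ha))).continuousWithinAt
    · refine ContinuousOn.circleIntegrable hR.le fun z hz => ?_
      have hdF : Differentiable ℂ (deriv F) := fun z =>
        ((hFd.analyticAt z).deriv).differentiableAt
      exact ((hdF z).div (hFd z) (hF0 z hz)).continuousAt.continuousWithinAt

/-- The multiset of zeros of an entire function in a disk on whose boundary it does not vanish, and
the argument principle for it. -/
lemma exists_zeros_multiset {f : ℂ → ℂ} (hf : Differentiable ℂ f) {R : ℝ} (hR : 0 < R)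
    (h0 : ∀ z ∈ Metric.sphere (0 : ℂ) R, f z ≠ 0) :
    ∃ s : Multiset ℂ,
      (∀ a, s.count a = if ‖a‖ < R then analyticOrderNatAt f a else 0) ∧
      (∮ z in C(0, R), logDeriv f z) = 2 * Real.pi * Complex.I * Multiset.card s := by
  classical
  have hRs : (R : ℂ) ∈ Metric.sphere (0 : ℂ) R := by
    simp [abs_of_pos hR]
  have hw := h0 _ hRs
  have hfin : (Metric.closedBall (0 : ℂ) R ∩ f ⁻¹' {0}).Finite := by
    have h1 : f ⁻¹' {0}ᶜ ∈ codiscrete ℂ :=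
      AnalyticOnNhd.preimage_zero_mem_codiscrete (fun z _ => hf.analyticAt z) hw
    have h2 : f ⁻¹' {0}ᶜ ∈ codiscreteWithin (Metric.closedBall (0 : ℂ) R) :=
      Filter.codiscreteWithin_mono (subset_univ _) h1
    have h3 := (isCompact_closedBall (0 : ℂ) R).finite_sdiff_of_mem_codiscreteWithin h2
    refine h3.subset fun z hz => ⟨hz.1, ?_⟩
    simpa using hz.2
  obtain ⟨s, g, hg, hfg, hs, hgT⟩ := exists_multiset_factor hf hw hfin.toFinset
  have hzero : ∀ a ∈ s, ‖a‖ < R := by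
    intro a ha
    have h1 : a ∈ hfin.toFinset := by
      by_contra hcon
      rw [← Multiset.one_le_count_iff_mem, hs, if_neg hcon] at ha
      simp at ha
    rw [Set.Finite.mem_toFinset] at h1
    have h2 : ‖a‖ ≤ R := by simpa using h1.1
    refine lt_of_le_of_ne h2 fun h3 => h0 a (by simpa using h3) (by simpa using h1.2)
  have hg0 : ∀ z ∈ Metric.closedBall (0 : ℂ) R, g z ≠ 0 := by
    intro z hz hgz
    have hz0 : f z = 0 := by rw [hfg, hgz, mul_zero]
    exact hgT z ((Set.Finite.mem_toFinset hfin).mpr ⟨hz, by simpa using hz0⟩) hgz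
  refine ⟨s, fun a => ?_, ?_⟩
  · by_cases haR : ‖a‖ < R
    · rw [if_pos haR, hs]
      split_ifs with hT
      · rfl
      · have : f a ≠ 0 := fun h => hT ((Set.Finite.mem_toFinset hfin).mpr
          ⟨by simpa using haR.le, by simpa using h⟩)
        have h1 : analyticOrderAt f a = 0 := (hf.analyticAt a).analyticOrderAt_eq_zero.mpr this
        rw [analyticOrderNatAt, h1]; rfl
    · rw [if_neg haR, Multiset.count_eq_zero]
      exact fun ha => haR (hzero a ha)
  · rw [← circleIntegral_logDeriv_prod hR hg hg0 s (fun a ha => by simpa using hzero a ha)]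
    rw [← funext hfg]

/-- The symmetric form of Rouché's theorem: if `f / g` avoids the negative real axis on the circle,
then `f` and `g` have the same logarithmic integral, since `log (f / g)` is a primitive of the
difference of the logarithmic derivatives. -/
lemma circleIntegral_logDeriv_eq {f g : ℂ → ℂ} (hf : Differentiable ℂ f) (hg : Differentiable ℂ g)
    {R : ℝ} (hR : 0 < R) (hg0 : ∀ z ∈ Metric.sphere (0 : ℂ) R, g z ≠ 0)
    (h : ∀ z ∈ Metric.sphere (0 : ℂ) R, ∀ t : ℝ, 0 ≤ t → f z ≠ -t * g z) :
    (∮ z in C(0, R), logDeriv f z) = ∮ z in C(0, R), logDeriv g z := by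
  have hf0 : ∀ z ∈ Metric.sphere (0 : ℂ) R, f z ≠ 0 := fun z hz => by
    simpa using h z hz 0 le_rfl
  have hslit : ∀ z ∈ Metric.sphere (0 : ℂ) R, f z / g z ∈ Complex.slitPlane := by
    intro z hz
    rw [Complex.mem_slitPlane_iff]
    by_contra! hcon
    refine h z hz (-(f z / g z).re) (by linarith [hcon.1]) ?_
    have : f z / g z = ((f z / g z).re : ℂ) := by
      apply Complex.ext <;> simp [hcon.2]
    calc f z = f z / g z * g z := (div_mul_cancel₀ _ (hg0 z hz)).symm
      _ = ((f z / g z).re : ℂ) * g z := by rw [← this]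
      _ = _ := by push_cast; ring
  have hint : ∀ {F : ℂ → ℂ}, Differentiable ℂ F → (∀ z ∈ Metric.sphere (0 : ℂ) R, F z ≠ 0) →
      CircleIntegrable (logDeriv F) 0 R := by
    intro F hF hF0
    refine ContinuousOn.circleIntegrable hR.le fun z hz => ?_
    have hdF : Differentiable ℂ (deriv F) := fun z => ((hF.analyticAt z).deriv).differentiableAt
    exact ((hdF z).div (hF z) (hF0 z hz)).continuousAt.continuousWithinAt
  rw [← sub_eq_zero, ← circleIntegral.integral_sub (hint hf hf0) (hint hg hg0)]
  refine circleIntegral.integral_eq_zero_of_hasDerivWithinAt (f := fun z => Complex.log (f z / g z))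
    hR.le fun z hz => ?_
  have h1 := (((hf z).hasDerivAt.div (hg z).hasDerivAt (hg0 z hz)).clog (hslit z hz))
  refine (h1.congr_deriv ?_).hasDerivWithinAt
  have := hf0 z hz
  have := hg0 z hz
  simp only [logDeriv_apply, Pi.div_apply]
  field_simp

/-- The entire function `z ↦ cos (2 √z)`. -/
def cosTwoSqrt (z : ℂ) : ℂ := 2 * (robinSol (fun _ => 0) 0 z).1 1 ^ 2 - 1

lemma differentiable_cosTwoSqrt : Differentiable ℂ cosTwoSqrt :=
  (((differentiable_robinSol continuousOn_zero_potential 0).1.pow 2).const_mul 2).sub_const 1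

lemma cosTwoSqrt_sq (k : ℂ) : cosTwoSqrt (k ^ 2) = Complex.cos (2 * k) := by
  rw [cosTwoSqrt]
  by_cases hk : k = 0
  · have := robinSol_eq continuousOn_zero_potential (h := 0) (z := 0) (ψ := fun _ => 1)
      (ψ' := fun _ => 0) (fun x _ => ⟨hasDerivWithinAt_const _ _ _, by
        simpa using hasDerivWithinAt_const x (Icc (0 : ℝ) 1) (0 : ℂ)⟩) rfl (by simp)
      (x := 1) (by simp)
    rw [hk, zero_pow two_ne_zero, this.1]
    norm_num
  · rw [(robinSol_zero (h := 0) hk (x := 1) (by simp)).1]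
    simp [Complex.cos_two_mul]

/-- The function `cos (2 √z)` has exactly `L` zeros in the disk of radius `(Lπ/2)²`, namely
`((2m+1)π/4)²` with `0 ≤ m < L`. -/
lemma circleIntegral_logDeriv_cosTwoSqrt {L : ℕ} (hL : 0 < L)
    (h0 : ∀ z ∈ Metric.sphere (0 : ℂ) ((L * Real.pi / 2) ^ 2), cosTwoSqrt z ≠ 0) :
    (∮ z in C(0, (L * Real.pi / 2) ^ 2), logDeriv cosTwoSqrt z)
      = 2 * Real.pi * Complex.I * L := by
  have hLpos : (0 : ℝ) < L := Nat.cast_pos.mpr hL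
  have hpi := Real.pi_pos
  obtain ⟨s, hs, hint⟩ := exists_zeros_multiset differentiable_cosTwoSqrt
    (R := (L * Real.pi / 2) ^ 2) (by positivity) h0
  rw [hint]
  have hzero : ∀ z, cosTwoSqrt z = 0 ↔ ∃ m : ℕ, z = (((2 * m + 1) * Real.pi / 4) ^ 2 : ℝ) := by
    intro z
    obtain ⟨k, rfl⟩ : ∃ k : ℂ, z = k ^ 2 := by
      obtain ⟨k, hk⟩ := IsAlgClosed.exists_pow_nat_eq z (n := 2) two_pos
      exact ⟨k, hk.symm⟩
    rw [cosTwoSqrt_sq, Complex.cos_eq_zero_iff]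
    constructor
    · rintro ⟨m, hm⟩
      have hk : k = (2 * m + 1) * Real.pi / 4 := by linear_combination hm / 2
      rcases le_or_gt 0 m with h | h
      · refine ⟨m.toNat, ?_⟩
        have : ((m.toNat : ℕ) : ℂ) = (m : ℂ) := by
          rw [← Int.cast_natCast, Int.toNat_of_nonneg h]
        rw [hk]; push_cast; rw [this]
      · refine ⟨(-m - 1).toNat, ?_⟩
        have : (((-m - 1).toNat : ℕ) : ℂ) = -(m : ℂ) - 1 := by
          rw [← Int.cast_natCast, Int.toNat_of_nonneg (by omega)]; push_cast; ring
        rw [hk]; push_cast; rw [this]; ring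
    · rintro ⟨m, hm⟩
      have : (k - (2 * m + 1) * Real.pi / 4) * (k + (2 * m + 1) * Real.pi / 4) = 0 := by
        push_cast at hm
        linear_combination hm
      rcases mul_eq_zero.mp this with h | h
      · exact ⟨m, by push_cast; linear_combination 2 * h⟩
      · exact ⟨-m - 1, by push_cast; linear_combination 2 * h⟩
  -- the zeros are simple, because sine and cosine have no common zeros
  have hord : ∀ z, cosTwoSqrt z = 0 → analyticOrderNatAt cosTwoSqrt z = 1 := by
    intro z hz
    obtain ⟨k, rfl⟩ : ∃ k : ℂ, z = k ^ 2 := by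
      obtain ⟨k, hk⟩ := IsAlgClosed.exists_pow_nat_eq z (n := 2) two_pos
      exact ⟨k, hk.symm⟩
    have hder : deriv cosTwoSqrt (k ^ 2) ≠ 0 := by
      intro hd
      have h1 : HasDerivAt (fun k : ℂ => cosTwoSqrt (k ^ 2)) (deriv cosTwoSqrt (k ^ 2) * _) k :=
        HasDerivAt.comp (h₂ := cosTwoSqrt) k (differentiable_cosTwoSqrt (k ^ 2)).hasDerivAt
          (hasDerivAt_pow 2 k)
      have h2 : HasDerivAt (fun k : ℂ => Complex.cos (2 * k)) (-Complex.sin (2 * k) * 2) k := by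
        have h3 : HasDerivAt (fun k : ℂ => 2 * k) 2 k := by
          simpa using (hasDerivAt_id k).const_mul 2
        exact HasDerivAt.comp (h₂ := Complex.cos) k (Complex.hasDerivAt_cos (2 * k)) h3
      rw [funext cosTwoSqrt_sq] at h1
      have h3 := h1.unique h2
      rw [hd, zero_mul] at h3
      rw [cosTwoSqrt_sq] at hz
      have h4 := Complex.sin_sq_add_cos_sq (2 * k)
      have h5 : Complex.sin (2 * k) = 0 := by simpa using h3.symm
      rw [hz, h5] at h4
      norm_num at h4
    have := (differentiable_cosTwoSqrt.analyticAt (k ^ 2)).analyticOrderAt_eq_one_of_zero_deriv_ne_zero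
      hz hder
    rw [analyticOrderNatAt, this]
    rfl
  have hmem : ∀ a, a ∈ s ↔ ‖a‖ < (L * Real.pi / 2) ^ 2 ∧ cosTwoSqrt a = 0 := by
    intro a
    rw [← Multiset.one_le_count_iff_mem, hs]
    split_ifs with h
    · simp only [h, true_and]
      constructor
      · intro h1
        exact apply_eq_zero_of_analyticOrderNatAt_ne_zero (by omega)
      · intro h1
        rw [hord a h1]
    · simp [h]
  have hnodup : s.Nodup := by
    rw [Multiset.nodup_iff_count_le_one]
    intro a
    rw [hs]
    split_ifs with h
    · by_cases h1 : cosTwoSqrt a = 0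
      · rw [hord a h1]
      · have : analyticOrderAt cosTwoSqrt a = 0 :=
          (differentiable_cosTwoSqrt.analyticAt a).analyticOrderAt_eq_zero.mpr h1
        rw [analyticOrderNatAt, this]; simp
    · simp
  have hinj : Function.Injective fun m : ℕ => ((((2 * m + 1) * Real.pi / 4) ^ 2 : ℝ) : ℂ) := by
    intro m n hmn
    have h1 : ((2 * m + 1) * Real.pi / 4) ^ 2 = ((2 * n + 1) * Real.pi / 4) ^ 2 :=
      Complex.ofReal_injective hmn
    have h2 := (pow_left_inj₀ (by positivity) (by positivity) two_ne_zero).mp h1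
    have h3 : (2 * m + 1) * Real.pi = (2 * n + 1) * Real.pi := by linarith
    have h4 := mul_right_cancel₀ hpi.ne' h3
    exact_mod_cast (by linarith : (m : ℝ) = n)
  have hsm : s = (Multiset.range L).map fun m : ℕ => ((((2 * m + 1) * Real.pi / 4) ^ 2 : ℝ) : ℂ) := by
    refine (Multiset.Nodup.ext hnodup ((Multiset.nodup_range L).map hinj)).mpr fun a => ?_
    rw [hmem, hzero, Multiset.mem_map]
    have hlt : ∀ m : ℕ, ‖((((2 * m + 1) * Real.pi / 4) ^ 2 : ℝ) : ℂ)‖ < (L * Real.pi / 2) ^ 2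
        ↔ m < L := by
      intro m
      rw [Complex.norm_real, Real.norm_eq_abs, abs_of_nonneg (by positivity),
        pow_lt_pow_iff_left₀ (by positivity) (by positivity) two_ne_zero]
      constructor
      · intro h
        have : (2 * m + 1) * Real.pi < (2 * L) * Real.pi := by linarith
        have := lt_of_mul_lt_mul_right this hpi.le
        have : (2 * m + 1 : ℕ) < 2 * L := by exact_mod_cast this
        omega
      · intro h
        have : (2 * m + 1 : ℕ) < 2 * L := by omega
        have : (2 * m + 1 : ℝ) < 2 * L := by exact_mod_cast this
        have := mul_lt_mul_of_pos_right this hpi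
        linarith
    constructor
    · rintro ⟨h1, m, rfl⟩
      exact ⟨m, Multiset.mem_range.mpr ((hlt m).mp h1), rfl⟩
    · rintro ⟨m, hm, rfl⟩
      exact ⟨(hlt m).mpr (Multiset.mem_range.mp hm), m, rfl⟩
  rw [hsm]
  simp

/-- Comparison of `z f(z)` with `cos (2 √z)` on the circle of radius `(Lπ/2)²`: the entire function
`f` has `L - 1` zeros inside. -/
lemma exists_zeros_multiset_card {f : ℂ → ℂ} (hf : Differentiable ℂ f) {L : ℕ} (hL : 0 < L)
    {a b : ℂ} (ha : a ≠ 0) (hb : b ≠ 0)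
    (hC : ∀ z ∈ Metric.sphere (0 : ℂ) ((L * Real.pi / 2) ^ 2), cosTwoSqrt z ≠ 0)
    (h : ∀ z ∈ Metric.sphere (0 : ℂ) ((L * Real.pi / 2) ^ 2), ∀ t : ℝ, 0 ≤ t →
      a * z * f z ≠ -t * (b * cosTwoSqrt z)) :
    ∃ s : Multiset ℂ,
      (∀ z, s.count z = if ‖z‖ < (L * Real.pi / 2) ^ 2 then analyticOrderNatAt f z else 0) ∧
      Multiset.card s + 1 = L := by
  have hLpos : (0 : ℝ) < L := Nat.cast_pos.mpr hL
  have hpi := Real.pi_pos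
  set R : ℝ := (L * Real.pi / 2) ^ 2 with hRdef
  have hR : 0 < R := by positivity
  have hf0 : ∀ z ∈ Metric.sphere (0 : ℂ) R, f z ≠ 0 := fun z hz h0 => by
    have := h z hz 0 le_rfl
    simp [h0] at this
  have hz0 : ∀ z ∈ Metric.sphere (0 : ℂ) R, z ≠ 0 := fun z hz h0 => by
    rw [mem_sphere_zero_iff_norm, h0, norm_zero] at hz
    exact hR.ne hz
  obtain ⟨s, hs, hint⟩ := exists_zeros_multiset hf hR hf0
  refine ⟨s, hs, ?_⟩
  have h1 := circleIntegral_logDeriv_eq (f := fun z => a * z * f z)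
    (g := fun z => b * cosTwoSqrt z) ((differentiable_id.const_mul a).mul hf)
    (differentiable_cosTwoSqrt.const_mul b) hR (fun z hz => mul_ne_zero hb (hC z hz)) h
  have h2 : (∮ z in C(0, R), logDeriv (fun z => b * cosTwoSqrt z) z)
      = 2 * Real.pi * Complex.I * L := by
    rw [← circleIntegral_logDeriv_cosTwoSqrt hL hC]
    exact circleIntegral.integral_congr hR.le fun z _ => logDeriv_const_mul z b hb
  have h3 : (∮ z in C(0, R), logDeriv (fun z => a * z * f z) z)
      = 2 * Real.pi * Complex.I + 2 * Real.pi * Complex.I * Multiset.card s := by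
    rw [← hint, ← circleIntegral.integral_sub_inv_of_mem_ball (c := 0) (w := 0) (R := R)
      (by simpa using hR), ← circleIntegral.integral_add]
    · refine circleIntegral.integral_congr hR.le fun z hz => ?_
      rw [logDeriv_mul (f := fun z => a * z) z (mul_ne_zero ha (hz0 z hz)) (hf0 z hz)
        (by fun_prop) (hf z), logDeriv_const_mul z a ha]
      simp
    · refine ContinuousOn.circleIntegrable hR.le fun z hz => ?_
      exact (ContinuousAt.inv₀ (by fun_prop) (by simpa using hz0 z hz)).continuousWithinAt
    · refine ContinuousOn.circleIntegrable hR.le fun z hz => ?_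
      have hdF : Differentiable ℂ (deriv f) := fun z => ((hf.analyticAt z).deriv).differentiableAt
      exact ((hdF z).div (hf z) (hf0 z hz)).continuousAt.continuousWithinAt
  rw [h2, h3] at h1
  have h4 : (2 * Real.pi * Complex.I : ℂ) ≠ 0 := Complex.two_pi_I_ne_zero
  have h5 : (2 * Real.pi * Complex.I : ℂ) * ((Multiset.card s : ℂ) + 1)
      = 2 * Real.pi * Complex.I * L := by rw [← h1]; ring
  have h6 := mul_left_cancel₀ h4 h5
  exact_mod_cast h6

/-! ### One-sided Fourier integrals: uniform decay -/

/-- The Fourier–Laplace transform `∫₀¹ u(t) e^{2ikt} dt`. -/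
def fourierLaplace (u : ℝ → ℂ) (k : ℂ) : ℂ :=
  ∫ t in (0 : ℝ)..1, u t * Complex.exp (2 * Complex.I * k * t)

lemma norm_exp_two_I_mul (k : ℂ) (t : ℝ) :
    ‖Complex.exp (2 * Complex.I * k * t)‖ = Real.exp (-(2 * k.im * t)) := by
  rw [Complex.norm_exp]
  congr 1
  simp

lemma norm_exp_two_I_mul_le {k : ℂ} (hk : 0 ≤ k.im) {t : ℝ} (ht : 0 ≤ t) :
    ‖Complex.exp (2 * Complex.I * k * t)‖ ≤ 1 := by
  rw [norm_exp_two_I_mul, Real.exp_le_one_iff]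
  have := mul_nonneg hk ht
  linarith

/-- An integrable function on `[0,1]` is close in `L¹` to a polynomial. -/
lemma exists_polynomial_integral_abs_sub_le {u : ℝ → ℝ} (hu : IntervalIntegrable u volume 0 1)
    {η : ℝ} (hη : 0 < η) :
    ∃ p : Polynomial ℝ, ∫ t in (0 : ℝ)..1, |u t - p.eval t| ≤ η := by
  have hu' : Integrable u (volume.restrict (Ioc 0 1)) := by
    have := hu.1
    exact this
  obtain ⟨φ, -, hφ, hφc, hφi⟩ := hu'.exists_hasCompactSupport_integral_sub_le (half_pos hη)
  obtain ⟨p, hp⟩ := exists_polynomial_near_of_continuousOn 0 1 φ hφc.continuousOn _ (half_pos hη)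
  refine ⟨p, ?_⟩
  have i1 : IntervalIntegrable (fun t => |u t - φ t|) volume 0 1 :=
    (hu.sub (hφc.intervalIntegrable _ _)).abs
  have h1 : ∫ t in (0 : ℝ)..1, |u t - φ t| ≤ η / 2 := by
    rw [intervalIntegral.integral_of_le zero_le_one]
    exact hφ
  calc _ ≤ ∫ t in (0 : ℝ)..1, (|u t - φ t| + η / 2) := by
        refine intervalIntegral.integral_mono_on zero_le_one
          (hu.sub (p.continuous.intervalIntegrable _ _)).abs
          (i1.add intervalIntegrable_const) fun t ht => ?_
        have h2 := (hp t ht).le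
        rw [abs_sub_comm] at h2
        have h3 := abs_add_le (u t - φ t) (φ t - p.eval t)
        rw [sub_add_sub_cancel] at h3
        linarith
    _ ≤ η := by
        rw [intervalIntegral.integral_add i1 intervalIntegrable_const]
        simp
        linarith

lemma absolutelyContinuous_polynomial (p : Polynomial ℝ) :
    AbsolutelyContinuousOnInterval (fun t => p.eval t) 0 1 :=
  absolutelyContinuous_of_hasDerivWithinAt (u' := fun t => p.derivative.eval t)
    (fun x _ => (p.hasDerivAt x).hasDerivWithinAt) p.derivative.continuous.continuousOn

/-- The Riemann–Lebesgue lemma, uniformly in the closed upper half-plane. -/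
lemma exists_norm_fourierLaplace_le {u : ℝ → ℝ} (hu : IntervalIntegrable u volume 0 1)
    {η : ℝ} (hη : 0 < η) :
    ∃ R : ℝ, 0 < R ∧ ∀ k : ℂ, R ≤ ‖k‖ → 0 ≤ k.im →
      ‖fourierLaplace (fun t => (u t : ℂ)) k‖ ≤ η := by
  obtain ⟨p, hp⟩ := exists_polynomial_integral_abs_sub_le hu (half_pos hη)
  set A : ℝ := |p.eval 1| + |p.eval 0| + ∫ t in (0 : ℝ)..1, |deriv (fun t => p.eval t) t| with hA
  have hpi : IntervalIntegrable (deriv fun t => p.eval t) volume 0 1 :=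
    (absolutelyContinuous_polynomial p).intervalIntegrable_deriv
  have hA0 : 0 ≤ A := by
    have : 0 ≤ ∫ t in (0 : ℝ)..1, |deriv (fun t => p.eval t) t| :=
      intervalIntegral.integral_nonneg zero_le_one fun t _ => abs_nonneg _
    positivity
  refine ⟨A / η + 1, by positivity, fun k hk him => ?_⟩
  have hkpos : 0 < ‖k‖ := lt_of_lt_of_le (by positivity) hk
  have hk0 : k ≠ 0 := norm_pos_iff.mp hkpos
  set c : ℂ := 2 * Complex.I * k with hc
  have hc0 : c ≠ 0 := by simp [hc, hk0]
  have hcn : ‖c‖ = 2 * ‖k‖ := by simp [hc]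
  have hE : ∀ t : ℝ, HasDerivAt (fun t : ℝ => Complex.exp (c * t) / c) (Complex.exp (c * t)) t := by
    intro t
    refine ((HasDerivAt.comp (h₂ := Complex.exp) t (Complex.hasDerivAt_exp (c * t))
      (hasDerivAt_cmul c t)).div_const c).congr_deriv ?_
    field_simp
  have hEn : ∀ t : ℝ, 0 ≤ t → ‖Complex.exp (c * t) / c‖ ≤ 1 / (2 * ‖k‖) := by
    intro t ht
    rw [norm_div, hcn]
    gcongr
    exact norm_exp_two_I_mul_le him ht
  have h1 := integral_ac_mul_deriv (absolutelyContinuous_polynomial p) hE (by fun_prop)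
  have h2 : ‖∫ t in (0 : ℝ)..1, ((p.eval t : ℝ) : ℂ) * Complex.exp (c * t)‖ ≤ A / (2 * ‖k‖) := by
    rw [h1]
    have b1 := hEn 1 zero_le_one
    have b0 := hEn 0 le_rfl
    have b2 := norm_integral_mul_le (x := 1) (by simp) hpi (e := fun t : ℝ => Complex.exp (c * t) / c)
      (A := 1 / (2 * ‖k‖)) (by positivity) (fun t ht => hEn t ht.1)
    have a1 : ‖((p.eval 1 : ℝ) : ℂ) * (Complex.exp (c * (1 : ℝ)) / c)‖
        ≤ |p.eval 1| * (1 / (2 * ‖k‖)) := by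
      rw [norm_mul, Complex.norm_real, Real.norm_eq_abs]
      gcongr
    have a0 : ‖((p.eval 0 : ℝ) : ℂ) * (Complex.exp (c * (0 : ℝ)) / c)‖
        ≤ |p.eval 0| * (1 / (2 * ‖k‖)) := by
      rw [norm_mul, Complex.norm_real, Real.norm_eq_abs]
      gcongr
    have hAe : A / (2 * ‖k‖) = |p.eval 1| * (1 / (2 * ‖k‖)) + |p.eval 0| * (1 / (2 * ‖k‖))
        + 1 / (2 * ‖k‖) * ∫ t in (0 : ℝ)..1, |deriv (fun t => p.eval t) t| := by
      rw [hA]; ring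
    rw [hAe]
    exact (norm_sub_le _ _).trans (add_le_add ((norm_sub_le _ _).trans (add_le_add a1 a0)) b2)
  have hup : IntervalIntegrable (fun t => u t - p.eval t) volume 0 1 :=
    hu.sub (p.continuous.intervalIntegrable _ _)
  have h3 := norm_integral_mul_le (x := 1) (by simp) hup (e := fun t : ℝ => Complex.exp (c * t))
    (A := 1) zero_le_one (fun t ht => norm_exp_two_I_mul_le him ht.1)
  rw [one_mul] at h3
  have hce : ContinuousOn (fun t : ℝ => Complex.exp (c * t)) (uIcc 0 1) := by fun_prop
  have hsplit : fourierLaplace (fun t => (u t : ℂ)) k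
      = (∫ t in (0 : ℝ)..1, ((u t - p.eval t : ℝ) : ℂ) * Complex.exp (c * t))
        + ∫ t in (0 : ℝ)..1, ((p.eval t : ℝ) : ℂ) * Complex.exp (c * t) := by
    rw [← intervalIntegral.integral_add, fourierLaplace]
    · refine intervalIntegral.integral_congr fun t _ => ?_
      push_cast
      ring
    · exact IntervalIntegrable.mul_continuousOn ⟨hup.1.ofReal, hup.2.ofReal⟩ hce
    · exact Continuous.intervalIntegrable (by fun_prop) _ _
  rw [hsplit]
  refine (norm_add_le _ _).trans ?_
  have h4 : A / (2 * ‖k‖) ≤ η / 2 := by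
    rw [div_le_div_iff₀ (by positivity) two_pos]
    have : A ≤ η * ‖k‖ := by
      have := mul_le_mul_of_nonneg_left (le_of_add_le_of_nonneg_left hk zero_le_one) hη.le
      rwa [mul_div_cancel₀ _ hη.ne'] at this
    linarith
  linarith

lemma hasDerivAt_fourierLaplace {u : ℝ → ℂ} (hu : IntervalIntegrable u volume 0 1) (k : ℂ) :
    HasDerivAt (fourierLaplace u)
      (2 * Complex.I * fourierLaplace (fun t => (t : ℂ) * u t) k) k := by
  have hce : ∀ k : ℂ, ContinuousOn (fun t : ℝ => Complex.exp (2 * Complex.I * k * t))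
      (uIcc 0 1) := fun k => by fun_prop
  have hF : ∀ k : ℂ, IntervalIntegrable (fun t => u t * Complex.exp (2 * Complex.I * k * t))
      volume 0 1 := fun k => hu.mul_continuousOn (hce k)
  have hF' : IntervalIntegrable
      (fun t => u t * (Complex.exp (2 * Complex.I * k * t) * (2 * Complex.I * t))) volume 0 1 :=
    hu.mul_continuousOn (by fun_prop)
  have h := (intervalIntegral.hasDerivAt_integral_of_dominated_loc_of_deriv_le (𝕜 := ℂ)
    (F := fun k t => u t * Complex.exp (2 * Complex.I * k * t))
    (F' := fun k t => u t * (Complex.exp (2 * Complex.I * k * t) * (2 * Complex.I * t)))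
    (x₀ := k) (s := Metric.ball k 1) (bound := fun t => ‖u t‖ * (Real.exp (2 * (‖k‖ + 1)) * 2))
    (a := 0) (b := 1) (μ := volume) (Metric.ball_mem_nhds k one_pos)
    (Eventually.of_forall fun k => (intervalIntegrable_iff.mp (hF k)).aestronglyMeasurable)
    (hF k) (intervalIntegrable_iff.mp hF').aestronglyMeasurable
    (ae_of_all _ fun t ht x hx => ?_) (hu.norm.mul_const _)
    (ae_of_all _ fun t ht x hx => ?_)).2
  · refine h.congr_deriv ?_
    rw [fourierLaplace, ← intervalIntegral.integral_const_mul]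
    refine intervalIntegral.integral_congr fun t _ => ?_
    ring
  · rw [uIoc_of_le zero_le_one] at ht
    have hx' : ‖x‖ ≤ ‖k‖ + 1 := by
      have h1 : ‖x - k‖ < 1 := by simpa [dist_eq_norm] using hx
      have h2 := norm_add_le (x - k) k
      rw [sub_add_cancel] at h2
      linarith
    rw [norm_mul, norm_mul, norm_exp_two_I_mul]
    have h3 : ‖2 * Complex.I * (t : ℂ)‖ ≤ 2 := by
      simp [abs_of_pos ht.1, ht.2]
    have h4 : -(2 * x.im * t) ≤ 2 * (‖k‖ + 1) := by
      have h5 := (abs_le.mp (Complex.abs_im_le_norm x)).1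
      nlinarith [ht.1, ht.2, norm_nonneg k]
    gcongr
  · have h1 : HasDerivAt (fun x : ℂ => 2 * Complex.I * x * t) (2 * Complex.I * t) x := by
      simpa using ((hasDerivAt_id x).const_mul (2 * Complex.I)).mul_const (t : ℂ)
    exact (HasDerivAt.comp (h₂ := Complex.exp) x (Complex.hasDerivAt_exp _) h1).const_mul (u t)

/-- Fourier–Laplace transforms vary slowly far out in the upper half-plane, by the
Riemann–Lebesgue lemma for the derivative. -/
lemma exists_norm_fourierLaplace_sub_le {u : ℝ → ℝ} (hu : IntervalIntegrable u volume 0 1)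
    {η : ℝ} (hη : 0 < η) :
    ∃ R : ℝ, 0 < R ∧ ∀ k l : ℂ, R + ‖k - l‖ ≤ ‖k‖ → 0 ≤ k.im → 0 ≤ l.im →
      ‖fourierLaplace (fun t => (u t : ℂ)) k - fourierLaplace (fun t => (u t : ℂ)) l‖
        ≤ η * ‖k - l‖ := by
  obtain ⟨R, hR, hRk⟩ := exists_norm_fourierLaplace_le
    (u := fun t => t * u t) (hu.continuousOn_mul continuousOn_id) (half_pos hη)
  refine ⟨R, hR, fun k l hkl hk hl => ?_⟩
  refine (convex_segment l k).norm_image_sub_le_of_norm_hasDerivWithin_le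
    (f := fourierLaplace fun t => (u t : ℂ))
    (fun z _ => (hasDerivAt_fourierLaplace ⟨hu.1.ofReal, hu.2.ofReal⟩ z).hasDerivWithinAt)
    (fun z hz => ?_) (left_mem_segment ℝ l k) (right_mem_segment ℝ l k)
  have him : 0 ≤ z.im := by
    have hconv : Convex ℝ {z : ℂ | 0 ≤ z.im} := convex_halfSpace_im_ge 0
    exact hconv.segment_subset hl hk hz
  have hzn : R ≤ ‖z‖ := by
    have h1 : ‖z - k‖ ≤ ‖l - k‖ := by
      have := norm_sub_le_of_mem_segment (y := z) (x := k) (z := l) (segment_symm ℝ l k ▸ hz)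
      simpa using this
    have h2 := norm_add_le z (k - z)
    rw [add_sub_cancel] at h2
    rw [norm_sub_rev l k, norm_sub_rev z k] at h1
    linarith
  have h3 := hRk z hzn him
  push_cast at h3
  rw [norm_mul, norm_mul, Complex.norm_I, Complex.norm_ofNat, mul_one]
  calc _ ≤ 2 * (η / 2) := mul_le_mul_of_nonneg_left h3 two_pos.le
    _ = η := by ring

/-! ### Square summability of samples of Fourier–Laplace transforms -/

lemma memLp_two_intervalIntegrable {u : ℝ → ℂ} (hu : MemLp u 2 (volume.restrict (Ioc 0 1))) :
    IntervalIntegrable u volume 0 1 := by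
  rw [intervalIntegrable_iff, uIoc_of_le zero_le_one]
  exact hu.integrable (by norm_num)

/-- Bessel's inequality for the samples at the points `π m / 2`, i.e. for the Fourier coefficients
of the extension by zero to an interval of length two. -/
lemma summable_fourierLaplace_int {u : ℝ → ℂ} (hu : MemLp u 2 (volume.restrict (Ioc 0 1))) :
    Summable fun m : ℤ => ‖fourierLaplace u (Real.pi * m / 2)‖ ^ 2 := by
  have hv : MemLp ((Ioc (0 : ℝ) 1).indicator u) 2 (volume.restrict (Ioc 0 2)) := by
    rw [memLp_indicator_iff_restrict measurableSet_Ioc,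
      Measure.restrict_restrict measurableSet_Ioc,
      inter_eq_left.mpr (Ioc_subset_Ioc_right one_le_two)]
    exact hu
  have h := (hasSum_sq_fourierCoeffOn two_pos hv).summable
  have h2 := ((Equiv.neg ℤ).summable_iff.mpr h).mul_left 4
  refine h2.congr fun m => ?_
  have hc : fourierCoeffOn two_pos ((Ioc (0 : ℝ) 1).indicator u) (-m)
      = 1 / 2 * fourierLaplace u (Real.pi * m / 2) := by
    rw [fourierCoeffOn_eq_integral, fourierLaplace, Complex.real_smul]
    congr 1
    · norm_num
    · rw [intervalIntegral.integral_of_le two_pos.le, intervalIntegral.integral_of_le zero_le_one,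
        ← integral_indicator measurableSet_Ioc, ← integral_indicator measurableSet_Ioc]
      refine integral_congr_ae (ae_of_all _ fun t => ?_)
      by_cases ht : t ∈ Ioc (0 : ℝ) 1
      · have ht2 : t ∈ Ioc (0 : ℝ) 2 := ⟨ht.1, ht.2.trans one_le_two⟩
        simp only [indicator_of_mem ht, indicator_of_mem ht2, neg_neg, fourier_coe_apply,
          smul_eq_mul]
        rw [mul_comm]
        congr 2
        push_cast
        ring
      · by_cases ht2 : t ∈ Ioc (0 : ℝ) 2
        · simp [indicator_of_mem ht2, indicator_of_notMem ht]
        · simp [indicator_of_notMem ht2, indicator_of_notMem ht]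
  simp only [Function.comp, Equiv.neg_apply, hc, norm_mul]
  norm_num
  ring

/-- The Fourier coefficients of the `2`-periodic extension of `e^{-2y|t|}`, `|t| ≤ 1`. -/
def poissonWeight (y : ℝ) (j : ℤ) : ℝ :=
  2 * y * (1 - (-1) ^ j * Real.exp (-2 * y)) / (4 * y ^ 2 + Real.pi ^ 2 * (j : ℝ) ^ 2)

lemma abs_neg_one_zpow (j : ℤ) : |(-1 : ℝ) ^ j| = 1 := by
  rw [abs_zpow]; simp

lemma poissonWeight_nonneg {y : ℝ} (hy : 0 < y) (j : ℤ) : 0 ≤ poissonWeight y j := by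
  have h1 : Real.exp (-2 * y) ≤ 1 := by rw [Real.exp_le_one_iff]; linarith
  have h2 : (-1 : ℝ) ^ j * Real.exp (-2 * y) ≤ 1 := by
    calc _ ≤ |(-1 : ℝ) ^ j * Real.exp (-2 * y)| := le_abs_self _
      _ ≤ 1 := by rwa [abs_mul, abs_neg_one_zpow, one_mul, abs_of_pos (Real.exp_pos _)]
  have h3 : 0 ≤ 1 - (-1 : ℝ) ^ j * Real.exp (-2 * y) := by linarith
  unfold poissonWeight
  positivity

lemma poissonWeight_le {y : ℝ} (hy : 0 < y) (j : ℤ) :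
    poissonWeight y j ≤ y / (y ^ 2 + (j : ℝ) ^ 2) := by
  have h1 : Real.exp (-2 * y) ≤ 1 := by rw [Real.exp_le_one_iff]; linarith
  have h2 : -1 ≤ (-1 : ℝ) ^ j * Real.exp (-2 * y) := by
    have h3 : |(-1 : ℝ) ^ j * Real.exp (-2 * y)| ≤ 1 := by
      rwa [abs_mul, abs_neg_one_zpow, one_mul, abs_of_pos (Real.exp_pos _)]
    exact (abs_le.mp h3).1
  have hpi : 4 ≤ Real.pi ^ 2 := by nlinarith [Real.pi_gt_three]
  calc poissonWeight y j ≤ 2 * y * 2 / (4 * y ^ 2 + 4 * (j : ℝ) ^ 2) := by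
        unfold poissonWeight
        gcongr
        linarith
    _ = _ := by
        have : y ^ 2 + (j : ℝ) ^ 2 ≠ 0 := by positivity
        field_simp
        ring

/-- A Cauchy kernel at height `y` is dominated by the Poisson weights at height `πy/2`; in particular its
sum over the integers is bounded uniformly in `y`. -/
lemma le_poissonWeight {y : ℝ} (hy : 1 ≤ y) (j : ℤ) :
    y / (y ^ 2 + (j : ℝ) ^ 2) ≤ 2 * Real.pi * poissonWeight (Real.pi * y / 2) j := by
  have hpi := Real.pi_gt_three
  have h1 : Real.exp (-2 * (Real.pi * y / 2)) ≤ 1 / 2 := by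
    have h3 : (2 : ℝ) ≤ Real.exp 1 := by linarith [Real.exp_one_gt_d9]
    calc _ ≤ Real.exp (-1) := by
          rw [Real.exp_le_exp]; nlinarith
      _ ≤ 1 / 2 := by
          rw [Real.exp_neg, ← one_div]
          exact one_div_le_one_div_of_le two_pos h3
  have h2 : (-1 : ℝ) ^ j * Real.exp (-2 * (Real.pi * y / 2)) ≤ 1 / 2 := by
    calc _ ≤ |(-1 : ℝ) ^ j * Real.exp (-2 * (Real.pi * y / 2))| := le_abs_self _
      _ ≤ 1 / 2 := by rwa [abs_mul, abs_neg_one_zpow, one_mul, abs_of_pos (Real.exp_pos _)]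
  have h0 : 0 < y ^ 2 + (j : ℝ) ^ 2 := by positivity
  have he : 2 * Real.pi * poissonWeight (Real.pi * y / 2) j
      = y / (y ^ 2 + (j : ℝ) ^ 2)
        * (2 * (1 - (-1 : ℝ) ^ j * Real.exp (-2 * (Real.pi * y / 2)))) := by
    unfold poissonWeight
    have : 4 * (Real.pi * y / 2) ^ 2 + Real.pi ^ 2 * (j : ℝ) ^ 2
        = Real.pi ^ 2 * (y ^ 2 + (j : ℝ) ^ 2) := by ring
    rw [this]
    field_simp
    try ring
  rw [he]
  refine le_mul_of_one_le_right (by positivity) (by linarith)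

lemma summable_poissonWeight {y : ℝ} (hy : 0 < y) : Summable (poissonWeight y) := by
  have h := (Real.summable_one_div_int_pow (p := 2)).mpr one_lt_two
  refine Summable.of_norm_bounded_eventually (h.mul_left y) ?_
  have : ∀ᶠ j : ℤ in cofinite, j ≠ 0 := by
    simpa using (Set.finite_singleton (0 : ℤ)).compl_mem_cofinite
  filter_upwards [this] with j hj
  rw [Real.norm_of_nonneg (poissonWeight_nonneg hy j)]
  refine (poissonWeight_le hy j).trans ?_
  have hj' : (0 : ℝ) < (j : ℝ) ^ 2 := by positivity
  rw [mul_one_div]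
  gcongr
  nlinarith [sq_nonneg y]

lemma integral_fourier_mul_exp {y : ℝ} (hy : 0 < y) (n : ℤ) :
    ∫ x in (-1 : ℝ)..1, Complex.exp (-(Complex.I * Real.pi * n) * x) * Real.exp (-2 * y * |x|)
      = 2 * poissonWeight y n := by
  have hpi := Real.pi_pos
  have hc1 : (2 * y - Complex.I * Real.pi * n : ℂ) ≠ 0 := fun h => by
    have := congrArg Complex.re h
    simp at this
    exact hy.ne' this
  have hc2 : (-(2 * y) - Complex.I * Real.pi * n : ℂ) ≠ 0 := fun h => by
    have := congrArg Complex.re h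
    simp at this
    exact hy.ne' this
  have hcont : Continuous fun x : ℝ =>
      Complex.exp (-(Complex.I * Real.pi * n) * x) * (Real.exp (-2 * y * |x|) : ℂ) := by fun_prop
  have e1 : ∫ x in (-1 : ℝ)..0,
      Complex.exp (-(Complex.I * Real.pi * n) * x) * (Real.exp (-2 * y * |x|) : ℂ)
      = ∫ x in (-1 : ℝ)..0, Complex.exp ((2 * y - Complex.I * Real.pi * n) * x) := by
    refine intervalIntegral.integral_congr fun x hx => ?_
    rw [uIcc_of_le (by norm_num)] at hx
    simp only [abs_of_nonpos hx.2]
    push_cast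
    rw [← Complex.exp_add]
    congr 1
    ring
  have e2 : ∫ x in (0 : ℝ)..1,
      Complex.exp (-(Complex.I * Real.pi * n) * x) * (Real.exp (-2 * y * |x|) : ℂ)
      = ∫ x in (0 : ℝ)..1, Complex.exp ((-(2 * y) - Complex.I * Real.pi * n) * x) := by
    refine intervalIntegral.integral_congr fun x hx => ?_
    rw [uIcc_of_le (by norm_num)] at hx
    simp only [abs_of_nonneg hx.1]
    push_cast
    rw [← Complex.exp_add]
    congr 1
    ring
  have hI : Complex.exp (Complex.I * Real.pi * n) = (-1) ^ n := by
    rw [← Complex.exp_pi_mul_I, ← Complex.exp_int_mul]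
    congr 1
    ring
  have hI' : Complex.exp (-(Complex.I * Real.pi * n)) = (-1) ^ n := by
    rw [Complex.exp_neg, hI, ← inv_zpow]
    norm_num
  rw [← intervalIntegral.integral_add_adjacent_intervals (b := 0)
    (hcont.intervalIntegrable _ _) (hcont.intervalIntegrable _ _), e1, e2,
    integral_exp_mul_complex hc1, integral_exp_mul_complex hc2]
  have x1 : Complex.exp ((2 * y - Complex.I * Real.pi * n) * (-1 : ℝ))
      = Complex.exp (-2 * y) * (-1) ^ n := by
    rw [← hI, ← Complex.exp_add]; congr 1; push_cast; ring
  have x2 : Complex.exp ((-(2 * y) - Complex.I * Real.pi * n) * (1 : ℝ))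
      = Complex.exp (-2 * y) * (-1) ^ n := by
    rw [← hI', ← Complex.exp_add]; congr 1; push_cast; ring
  rw [x1, x2]
  simp only [Complex.ofReal_zero, mul_zero, Complex.exp_zero]
  unfold poissonWeight
  push_cast
  have h4 : (4 * (y : ℂ) ^ 2 + Real.pi ^ 2 * (n : ℂ) ^ 2) ≠ 0 := by
    have : (0 : ℝ) < 4 * y ^ 2 + Real.pi ^ 2 * (n : ℝ) ^ 2 := by positivity
    exact_mod_cast this.ne'
  rw [div_add_div _ _ hc1 hc2, mul_div_assoc', div_eq_div_iff (mul_ne_zero hc1 hc2) h4]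
  have hI2 := Complex.I_sq
  linear_combination (-4 * (y : ℂ) * (1 - (-1) ^ n * Complex.exp (-2 * y)) * Real.pi ^ 2 * n ^ 2) * hI2

/-- The Fourier expansion of `e^{-2yt}`, `0 ≤ t ≤ 1`, with nonnegative coefficients. -/
lemma hasSum_poissonWeight {y : ℝ} (hy : 0 < y) {t : ℝ} (ht : t ∈ Icc (0 : ℝ) 1) :
    HasSum (fun j : ℤ => (poissonWeight y j : ℂ) * Complex.exp (Complex.I * Real.pi * j * t))
      (Complex.exp (-2 * y * t)) := by
  have : Fact ((0 : ℝ) < 2) := ⟨two_pos⟩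
  set f : ℝ → ℂ := fun x => (Real.exp (-2 * y * |x|) : ℂ) with hf
  have hfc : Continuous f := by fun_prop
  have hper : f (-1) = f (-1 + 2) := by
    simp only [hf]; norm_num
  let F : C(AddCircle (2 : ℝ), ℂ) :=
    ⟨AddCircle.liftIco 2 (-1) f, AddCircle.liftIco_continuous hper hfc.continuousOn⟩
  have hcoef : ∀ n : ℤ, fourierCoeff F n = poissonWeight y n := by
    intro n
    change fourierCoeff (AddCircle.liftIco 2 (-1) f) n = _
    rw [fourierCoeff_liftIco_eq, fourierCoeffOn_eq_integral]
    have h1 : ∫ x in (-1 : ℝ)..(-1 + 2), (fourier (-n)) (x : AddCircle ((-1 : ℝ) + 2 - -1)) • f x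
        = 2 * poissonWeight y n := by
      rw [← integral_fourier_mul_exp hy n, show (-1 : ℝ) + 2 = 1 by norm_num]
      refine intervalIntegral.integral_congr fun x _ => ?_
      simp only [fourier_coe_apply, smul_eq_mul, hf]
      congr 2
      push_cast
      ring
    rw [h1, Complex.real_smul]
    push_cast
    norm_num
    ring
  have hsum : Summable (fourierCoeff F) := by
    rw [funext hcoef]
    exact_mod_cast Complex.hasSum_ofReal.mpr (summable_poissonWeight hy).hasSum |>.summable
  have hF : F (t : AddCircle (2 : ℝ)) = Complex.exp (-2 * y * t) := by
    rcases ht.2.lt_or_eq with h1 | h1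
    · change AddCircle.liftIco 2 (-1) f t = _
      rw [AddCircle.liftIco_coe_apply ⟨by linarith [ht.1], by linarith⟩]
      simp [hf, abs_of_nonneg ht.1]
    · have : (t : AddCircle (2 : ℝ)) = ((-1 : ℝ) : AddCircle (2 : ℝ)) := by
        rw [h1, ← AddCircle.coe_add_period 2 (-1 : ℝ)]
        norm_num
      rw [this]
      change AddCircle.liftIco 2 (-1) f ((-1 : ℝ) : AddCircle (2 : ℝ)) = _
      rw [AddCircle.liftIco_coe_apply ⟨le_rfl, by norm_num⟩]
      simp [hf, h1]
  have h := has_pointwise_sum_fourier_series_of_summable hsum (t : AddCircle (2 : ℝ))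
  rw [hF] at h
  convert h using 1
  funext j
  rw [hcoef, fourier_coe_apply, smul_eq_mul]
  congr 2
  push_cast
  ring

lemma hasSum_poissonWeight_one {y : ℝ} (hy : 0 < y) : HasSum (poissonWeight y) 1 := by
  have := hasSum_poissonWeight hy (t := 0) (by simp)
  simp only [Complex.ofReal_zero, mul_zero, Complex.exp_zero, mul_one] at this
  rw [← Complex.ofReal_one] at this
  exact Complex.hasSum_ofReal.mp this

/-- Jensen's inequality for the square with countably many weights. -/
lemma sq_tsum_mul_le {w x : ℤ → ℝ} (hw : ∀ j, 0 ≤ w j) (hw1 : HasSum w 1)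
    (h1 : Summable fun j => w j * x j) (h2 : Summable fun j => w j * x j ^ 2) :
    (∑' j, w j * x j) ^ 2 ≤ ∑' j, w j * x j ^ 2 := by
  set m := ∑' j, w j * x j with hm
  have h3 : HasSum (fun j => w j * (x j - m) ^ 2)
      ((∑' j, w j * x j ^ 2) - 2 * m * m + m ^ 2 * 1) := by
    have := (h2.hasSum.sub (h1.hasSum.mul_left (2 * m))).add (hw1.mul_left (m ^ 2))
    have e : (fun j => w j * (x j - m) ^ 2)
        = fun j => w j * x j ^ 2 - 2 * m * (w j * x j) + m ^ 2 * w j := by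
      funext j
      ring
    rw [e]
    exact this
  have h4 := h3.nonneg fun j => mul_nonneg (hw j) (sq_nonneg (x j - m))
  nlinarith

/-- A sample at height `y` is a weighted mean of samples on the real axis. -/
lemma hasSum_fourierLaplace_sample {u : ℝ → ℂ} (hu : IntervalIntegrable u volume 0 1) {y : ℝ}
    (hy : 0 < y) (m : ℤ) :
    HasSum (fun j : ℤ => (poissonWeight y j : ℂ) * fourierLaplace u (Real.pi * (m + j : ℤ) / 2))
      (fourierLaplace u (Real.pi * m / 2 + Complex.I * y)) := by
  set F : ℤ → ℝ → ℂ := fun j t => (poissonWeight y j : ℂ)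
    * (u t * Complex.exp (2 * Complex.I * (Real.pi * (m + j : ℤ) / 2) * t)) with hF
  have hFi : ∀ j, IntervalIntegrable (F j) volume 0 1 := fun j =>
    (hu.mul_continuousOn (by fun_prop)).const_mul _
  have hFn : ∀ j t, ‖F j t‖ = poissonWeight y j * ‖u t‖ := by
    intro j t
    have : (2 * Complex.I * (Real.pi * (m + j : ℤ) / 2) * t : ℂ)
        = ((Real.pi * (m + j : ℤ) * t : ℝ) : ℂ) * Complex.I := by push_cast; ring
    rw [hF]
    simp only [this, norm_mul, Complex.norm_exp_ofReal_mul_I, mul_one, Complex.norm_real,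
      Real.norm_of_nonneg (poissonWeight_nonneg hy j)]
  have h := hasSum_integral_of_summable_integral_norm (μ := volume.restrict (Ioc (0 : ℝ) 1))
    (F := F) (fun j => (hFi j).1) (by
      simp only [hFn, integral_const_mul]
      exact (summable_poissonWeight hy).mul_right _)
  have e1 : ∀ j, ∫ t in Ioc (0 : ℝ) 1, F j t
      = (poissonWeight y j : ℂ) * fourierLaplace u (Real.pi * (m + j : ℤ) / 2) := by
    intro j
    rw [fourierLaplace, intervalIntegral.integral_of_le zero_le_one, ← integral_const_mul]
  have e2 : ∫ t in Ioc (0 : ℝ) 1, ∑' j, F j t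
      = fourierLaplace u (Real.pi * m / 2 + Complex.I * y) := by
    rw [fourierLaplace, intervalIntegral.integral_of_le zero_le_one]
    refine setIntegral_congr_fun measurableSet_Ioc fun t ht => ?_
    have h1 := (hasSum_poissonWeight hy (Ioc_subset_Icc_self ht)).mul_left
      (u t * Complex.exp (2 * Complex.I * (Real.pi * m / 2) * t))
    have h2 : (fun j : ℤ => u t * Complex.exp (2 * Complex.I * (Real.pi * m / 2) * t)
        * ((poissonWeight y j : ℂ) * Complex.exp (Complex.I * Real.pi * j * t)))
        = fun j => F j t := by
      funext j
      simp only [hF]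
      have : (2 * Complex.I * (Real.pi * (m + j : ℤ) / 2) * t : ℂ)
        = 2 * Complex.I * (Real.pi * m / 2) * t + Complex.I * Real.pi * j * t := by push_cast; ring
      rw [this, Complex.exp_add]
      ring
    rw [h2] at h1
    simp only [h1.tsum_eq]
    rw [mul_assoc, ← Complex.exp_add]
    congr 2
    have := Complex.I_sq
    linear_combination (2 * (y : ℂ) * t) * (-this)
  rwa [funext e1, e2] at h

/-- Jensen's inequality for the weighted mean that represents a sample at height `y`. -/
lemma norm_sq_fourierLaplace_sample_le {u : ℝ → ℂ}
    (hu : MemLp u 2 (volume.restrict (Ioc 0 1))) {y : ℝ} (hy : 0 < y) (m : ℤ) :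
    Summable (fun l : ℤ => poissonWeight y (l - m) * ‖fourierLaplace u (Real.pi * l / 2)‖ ^ 2) ∧
    ‖fourierLaplace u (Real.pi * m / 2 + Complex.I * y)‖ ^ 2
      ≤ ∑' l : ℤ, poissonWeight y (l - m) * ‖fourierLaplace u (Real.pi * l / 2)‖ ^ 2 := by
  set x : ℤ → ℝ := fun l => ‖fourierLaplace u (Real.pi * l / 2)‖ with hx
  have hxs : Summable fun l => x l ^ 2 := summable_fourierLaplace_int hu
  have hw := poissonWeight_nonneg hy
  have hw1 := hasSum_poissonWeight_one hy
  obtain ⟨B, hB⟩ : ∃ B, ∀ l, x l ^ 2 ≤ B :=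
    ⟨∑' l, x l ^ 2, fun l => hxs.le_tsum l fun _ _ => sq_nonneg _⟩
  have hx2 : Summable fun j => poissonWeight y j * x (m + j) ^ 2 :=
    Summable.of_nonneg_of_le (fun j => mul_nonneg (hw j) (sq_nonneg _))
      (fun j => mul_le_mul_of_nonneg_left (hB (m + j)) (hw j)) (hw1.summable.mul_right B)
  have hx1 : Summable fun j => poissonWeight y j * x (m + j) :=
    Summable.of_nonneg_of_le (fun j => mul_nonneg (hw j) (norm_nonneg _))
      (fun j => mul_le_mul_of_nonneg_left
        (show x (m + j) ≤ 1 + B by nlinarith [hB (m + j), sq_nonneg (x (m + j) - 1)]) (hw j))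
      (hw1.summable.mul_right (1 + B))
  have hS := hasSum_fourierLaplace_sample (memLp_two_intervalIntegrable hu) hy m
  have hn : ∀ j : ℤ, ‖(poissonWeight y j : ℂ) * fourierLaplace u (Real.pi * (m + j : ℤ) / 2)‖
      = poissonWeight y j * x (m + j) := by
    intro j
    rw [norm_mul, Complex.norm_real, Real.norm_of_nonneg (hw j)]
  have h1 : ‖fourierLaplace u (Real.pi * m / 2 + Complex.I * y)‖
      ≤ ∑' j, poissonWeight y j * x (m + j) := by
    rw [← hS.tsum_eq, ← tsum_congr hn]
    exact norm_tsum_le_tsum_norm (by rwa [funext hn])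
  have h2 := sq_tsum_mul_le hw hw1 hx1 hx2
  have he : (fun l => poissonWeight y (l - m) * x l ^ 2) ∘ (Equiv.addLeft m)
      = fun j => poissonWeight y j * x (m + j) ^ 2 := by
    funext j
    simp [Function.comp]
  constructor
  · rw [← (Equiv.addLeft m).summable_iff, he]
    exact hx2
  · rw [← (Equiv.addLeft m).tsum_eq]
    calc _ ≤ (∑' j, poissonWeight y j * x (m + j)) ^ 2 := by gcongr
      _ ≤ _ := h2
      _ = _ := tsum_congr fun j => by simp [hx]

/-- The summable majorant of the weights far from the diagonal. -/
lemma summable_sqrt_div : Summable fun j : ℤ => Real.sqrt |(j : ℝ)| / (1 + (j : ℝ) ^ 2) := by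
  refine Summable.of_nonneg_of_le (fun j => by positivity) (fun j => ?_)
    (Real.summable_abs_int_rpow (b := 3 / 2) (by norm_num))
  by_cases hj : j = 0
  · simp [hj]
  have h0 : (0 : ℝ) < |(j : ℝ)| := by positivity
  have h1 : |(j : ℝ)| ^ (-(3 / 2) : ℝ) = Real.sqrt |(j : ℝ)| / |(j : ℝ)| ^ 2 := by
    rw [Real.sqrt_eq_rpow, ← Real.rpow_natCast, ← Real.rpow_sub h0]
    norm_num
  rw [h1, sq_abs]
  gcongr
  linarith

lemma abs_log_sub_log_le {a b : ℝ} (ha : 1 ≤ a) (hb : 1 ≤ b) :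
    |Real.log a - Real.log b| ≤ 2 * Real.sqrt |a - b| := by
  wlog hab : a ≤ b generalizing a b
  · rw [abs_sub_comm, abs_sub_comm a]
    exact this hb ha (le_of_not_ge hab)
  have ha0 : 0 < a := by linarith
  have hb0 : 0 < b := by linarith
  have h1 : Real.log a ≤ Real.log b := Real.log_le_log ha0 hab
  rw [abs_sub_comm, abs_sub_comm a, abs_of_nonneg (sub_nonneg.mpr h1),
    abs_of_nonneg (sub_nonneg.mpr hab)]
  set s := Real.sqrt (b - a) with hs
  have hs0 : 0 ≤ s := Real.sqrt_nonneg _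
  have hss : s ^ 2 = b - a := Real.sq_sqrt (sub_nonneg.mpr hab)
  have h2 : b ≤ a * (1 + s) ^ 2 := by nlinarith
  calc Real.log b - Real.log a ≤ Real.log (a * (1 + s) ^ 2) - Real.log a := by
        gcongr
    _ = 2 * Real.log (1 + s) := by
        rw [Real.log_mul ha0.ne' (by positivity), Real.log_pow]; push_cast; ring
    _ ≤ 2 * s := by
        have := Real.log_le_sub_one_of_pos (show 0 < 1 + s by linarith)
        linarith

/-- Comparison of the weights at the slowly varying height `log n + c` with those at the height
belonging to the position of the column. -/
lemma poissonWeight_log_le {c : ℝ} {N : ℕ} (hN : 1 ≤ N) (hc : 1 ≤ Real.log N + c) (l s : ℤ) :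
    ∃ Y : ℝ, 1 ≤ Y ∧ ∀ n : ℕ, N ≤ n →
      poissonWeight (Real.log n + c) (l - (2 * n + s))
        ≤ 6 * (Y / (Y ^ 2 + ((l - (2 * n + s) : ℤ) : ℝ) ^ 2))
          + 6 * (Real.sqrt |((l - (2 * n + s) : ℤ) : ℝ)|
            / (1 + ((l - (2 * n + s) : ℤ) : ℝ) ^ 2)) := by
  have hN1 : (1 : ℝ) ≤ N := by exact_mod_cast hN
  -- `m` is the position of the column `l`, that is `2m + s = l`, cut off at `N`
  set m : ℝ := max (((l : ℝ) - s) / 2) N with hm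
  have hmN : (N : ℝ) ≤ m := le_max_right _ _
  have hm1 : 1 ≤ m := hN1.trans hmN
  have hY1 : 1 ≤ Real.log m + c := by
    have := Real.log_le_log (by linarith) hmN
    linarith
  refine ⟨Real.log m + c, hY1, fun n hn => ?_⟩
  have hnN : (N : ℝ) ≤ n := by exact_mod_cast hn
  have hy1 : 1 ≤ Real.log n + c := by
    have := Real.log_le_log (by linarith) hnN
    linarith
  set Y := Real.log m + c with hY
  set y := Real.log n + c with hy
  set j : ℝ := ((l - (2 * n + s) : ℤ) : ℝ) with hj
  have hnm : |(n : ℝ) - m| ≤ |j| / 2 := by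
    have hj2 : j / 2 = ((l : ℝ) - s) / 2 - n := by rw [hj]; push_cast; ring
    have hj3 : |j| / 2 = |((l : ℝ) - s) / 2 - n| := by
      rw [← hj2, abs_div, abs_two]
    rw [hj3, hm]
    rcases le_total (((l : ℝ) - s) / 2) N with h | h
    · rw [max_eq_right h, abs_of_nonneg (by linarith), abs_of_nonpos (by linarith)]
      linarith
    · rw [max_eq_left h, abs_sub_comm]
  set d := Real.sqrt |j| with hd
  have hd0 : 0 ≤ d := Real.sqrt_nonneg _
  have hyY : |y - Y| ≤ 3 / 2 * d := by
    have h1 := abs_log_sub_log_le (hN1.trans hnN) hm1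
    have h2 : y - Y = Real.log n - Real.log m := by rw [hy, hY]; ring
    rw [h2]
    refine h1.trans ?_
    have h3 : Real.sqrt |(n : ℝ) - m| ≤ 3 / 4 * d := by
      rw [Real.sqrt_le_left (by positivity), mul_pow, hd, Real.sq_sqrt (abs_nonneg _)]
      linarith [abs_nonneg j]
    linarith
  refine (poissonWeight_le (by linarith) _).trans ?_
  rw [← hj]
  have hyY' := abs_le.mp hyY
  have hj0 := sq_nonneg j
  have t1 : 0 ≤ 6 * (Y / (Y ^ 2 + j ^ 2)) := by positivity
  have t2 : 0 ≤ 6 * (d / (1 + j ^ 2)) := by positivity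
  -- either the two heights are comparable, or both are dominated by the root of the distance
  rcases le_or_gt (3 / 2 * d) (Y / 2) with h | h
  · have : y / (y ^ 2 + j ^ 2) ≤ 6 * (Y / (Y ^ 2 + j ^ 2)) := by
      calc y / (y ^ 2 + j ^ 2) ≤ (3 / 2 * Y) / ((Y ^ 2 + j ^ 2) / 4) := by
            gcongr
            · linarith
            · nlinarith
        _ = _ := by
            have : Y ^ 2 + j ^ 2 ≠ 0 := by positivity
            field_simp
            norm_num
    linarith
  · have : y / (y ^ 2 + j ^ 2) ≤ 6 * (d / (1 + j ^ 2)) := by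
      calc y / (y ^ 2 + j ^ 2) ≤ (6 * d) / (1 + j ^ 2) := by
            gcongr
            · linarith
            · nlinarith
        _ = _ := by ring
    linarith

/-- Square summability of the samples of a Fourier–Laplace transform along a logarithmic curve. -/
lemma summable_fourierLaplace_log {u : ℝ → ℂ} (hu : MemLp u 2 (volume.restrict (Ioc 0 1)))
    (c : ℝ) (s : ℤ) :
    Summable fun n : ℕ =>
      ‖fourierLaplace u (Real.pi * (2 * n + s : ℤ) / 2 + Complex.I * (Real.log n + c : ℝ))‖ ^ 2 := by
  obtain ⟨N, hN1, hN⟩ : ∃ N : ℕ, 1 ≤ N ∧ 1 ≤ Real.log N + c := by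
    have h1 : Tendsto (fun n : ℕ => Real.log n) atTop atTop :=
      Real.tendsto_log_atTop.comp tendsto_natCast_atTop_atTop
    obtain ⟨N, h2, h3⟩ := ((h1.eventually_ge_atTop (1 - c)).and (eventually_ge_atTop 1)).exists
    exact ⟨N, h3, by linarith⟩
  have hN0 : (0 : ℝ) < N := by exact_mod_cast hN1
  set x : ℤ → ℝ := fun l => ‖fourierLaplace u (Real.pi * l / 2)‖ with hx
  have hxs : Summable fun l => x l ^ 2 := summable_fourierLaplace_int hu
  set B : ℝ := ∑' j : ℤ, Real.sqrt |(j : ℝ)| / (1 + (j : ℝ) ^ 2) with hB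
  rw [← summable_nat_add_iff N]
  have hy : ∀ n : ℕ, 0 < Real.log ((n + N : ℕ) : ℝ) + c := by
    intro n
    have : (N : ℝ) ≤ ((n + N : ℕ) : ℝ) := by push_cast; linarith [Nat.cast_nonneg (α := ℝ) n]
    have := Real.log_le_log hN0 this
    linarith
  -- Schur test: the column sums of the weights are uniformly bounded
  have hcol : ∀ (S : Finset ℕ) (l : ℤ),
      ∑ n ∈ S, poissonWeight (Real.log ((n + N : ℕ) : ℝ) + c) (l - (2 * (n + N : ℕ) + s))
        ≤ 12 * Real.pi + 6 * B := by
    intro S l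
    obtain ⟨Y, hY1, hY⟩ := poissonWeight_log_le hN1 hN l s
    have hinj : ∀ n ∈ S, ∀ m ∈ S, l - (2 * ((n + N : ℕ) : ℤ) + s) = l - (2 * ((m + N : ℕ) : ℤ) + s)
        → n = m := by
      intro n _ m _ h
      push_cast at h
      omega
    have hYpos : 0 < Real.pi * Y / 2 := by have := Real.pi_pos; positivity
    have hp1 := hasSum_poissonWeight_one hYpos
    have h1 : ∑ n ∈ S, (Y / (Y ^ 2 + ((l - (2 * (n + N : ℕ) + s) : ℤ) : ℝ) ^ 2)) ≤ 2 * Real.pi := by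
      calc _ ≤ ∑ n ∈ S, 2 * Real.pi * poissonWeight (Real.pi * Y / 2) (l - (2 * (n + N : ℕ) + s)) :=
            Finset.sum_le_sum fun n _ => le_poissonWeight hY1 _
        _ = 2 * Real.pi * ∑ j ∈ S.image (fun n : ℕ => l - (2 * ((n + N : ℕ) : ℤ) + s)),
              poissonWeight (Real.pi * Y / 2) j := by
            rw [Finset.sum_image hinj, Finset.mul_sum]
        _ ≤ 2 * Real.pi * 1 := by
            gcongr
            exact sum_le_hasSum _ (fun j _ => poissonWeight_nonneg hYpos j) hp1
        _ = _ := mul_one _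
    have h2 : ∑ n ∈ S, (Real.sqrt |((l - (2 * (n + N : ℕ) + s) : ℤ) : ℝ)|
        / (1 + ((l - (2 * (n + N : ℕ) + s) : ℤ) : ℝ) ^ 2)) ≤ B := by
      calc _ = ∑ j ∈ S.image (fun n : ℕ => l - (2 * ((n + N : ℕ) : ℤ) + s)),
              Real.sqrt |(j : ℝ)| / (1 + (j : ℝ) ^ 2) := by
            rw [Finset.sum_image hinj]
        _ ≤ B := summable_sqrt_div.sum_le_tsum _ fun j _ => by positivity
    calc _ ≤ ∑ n ∈ S, (6 * (Y / (Y ^ 2 + ((l - (2 * (n + N : ℕ) + s) : ℤ) : ℝ) ^ 2))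
          + 6 * (Real.sqrt |((l - (2 * (n + N : ℕ) + s) : ℤ) : ℝ)|
            / (1 + ((l - (2 * (n + N : ℕ) + s) : ℤ) : ℝ) ^ 2))) :=
          Finset.sum_le_sum fun n _ => hY (n + N) (Nat.le_add_left _ _)
      _ ≤ _ := by
          rw [Finset.sum_add_distrib, ← Finset.mul_sum, ← Finset.mul_sum]
          linarith
  refine summable_of_sum_le (c := (12 * Real.pi + 6 * B) * ∑' l, x l ^ 2) (fun n => sq_nonneg _)
    fun S => ?_
  have hs := fun n : ℕ => norm_sq_fourierLaplace_sample_le hu (hy n) (2 * (n + N : ℕ) + s)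
  calc _ ≤ ∑ n ∈ S, ∑' l : ℤ,
        poissonWeight (Real.log ((n + N : ℕ) : ℝ) + c) (l - (2 * (n + N : ℕ) + s)) * x l ^ 2 :=
        Finset.sum_le_sum fun n _ => (hs n).2
    _ = ∑' l : ℤ, ∑ n ∈ S,
        poissonWeight (Real.log ((n + N : ℕ) : ℝ) + c) (l - (2 * (n + N : ℕ) + s)) * x l ^ 2 :=
        (Summable.tsum_finsetSum fun n _ => (hs n).1).symm
    _ ≤ ∑' l : ℤ, (12 * Real.pi + 6 * B) * x l ^ 2 := by
        refine Summable.tsum_le_tsum (fun l => ?_) (summable_sum fun n _ => (hs n).1)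
          (hxs.mul_left _)
        rw [← Finset.sum_mul]
        exact mul_le_mul_of_nonneg_right (hcol S l) (sq_nonneg _)
    _ = _ := tsum_mul_left

/-! ### The leading terms of the characteristic function -/

lemma fourierLaplace_neg (u : ℝ → ℂ) (k : ℂ) :
    fourierLaplace u (-k)
      = Complex.exp (-2 * Complex.I * k) * fourierLaplace (fun t => u (1 - t)) k := by
  have h := intervalIntegral.integral_comp_sub_left (a := 0) (b := 1)
    (fun t => u t * Complex.exp (2 * Complex.I * (-k) * t)) 1
  simp only [sub_self, sub_zero] at h
  rw [fourierLaplace, ← h, fourierLaplace, ← intervalIntegral.integral_const_mul]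
  refine intervalIntegral.integral_congr fun t _ => ?_
  have : (2 * Complex.I * (-k) * ((1 - t : ℝ) : ℂ))
      = -2 * Complex.I * k + 2 * Complex.I * k * t := by push_cast; ring
  simp only [this, Complex.exp_add]
  ring

lemma intervalIntegrable_reflect {u : ℝ → ℝ} (hu : IntervalIntegrable u volume 0 1) :
    IntervalIntegrable (fun t => u (1 - t)) volume 0 1 := by
  simpa using (hu.comp_sub_left 1).symm

lemma norm_exp_neg_two_I_mul (k : ℂ) : ‖Complex.exp (-2 * Complex.I * k)‖ = Real.exp (2 * k.im) := by
  rw [Complex.norm_exp]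
  congr 1
  simp

/-- The Riemann–Lebesgue lemma in the whole plane. -/
lemma exists_norm_fourierLaplace_le_exp {u : ℝ → ℝ} (hu : IntervalIntegrable u volume 0 1)
    {η : ℝ} (hη : 0 < η) :
    ∃ R : ℝ, 0 < R ∧ ∀ k : ℂ, R ≤ ‖k‖ →
      ‖fourierLaplace (fun t => (u t : ℂ)) k‖ ≤ η * Real.exp (2 * |k.im|) := by
  obtain ⟨R₁, hR₁, h₁⟩ := exists_norm_fourierLaplace_le hu hη
  obtain ⟨R₂, hR₂, h₂⟩ := exists_norm_fourierLaplace_le (intervalIntegrable_reflect hu) hη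
  refine ⟨max R₁ R₂, lt_max_of_lt_left hR₁, fun k hk => ?_⟩
  rcases le_total 0 k.im with him | him
  · refine (h₁ k ((le_max_left _ _).trans hk) him).trans (le_mul_of_one_le_right hη.le ?_)
    exact Real.one_le_exp (by positivity)
  · have h3 := h₂ (-k) (by rw [norm_neg]; exact (le_max_right _ _).trans hk) (by simpa using him)
    have h4 := fourierLaplace_neg (fun t => (u t : ℂ)) (-k)
    rw [neg_neg] at h4
    rw [h4, norm_mul, norm_exp_neg_two_I_mul, abs_of_nonpos him, mul_comm, Complex.neg_im]
    gcongr

/-- Slow variation of Fourier–Laplace transforms in horizontal strips. -/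
lemma exists_norm_fourierLaplace_sub_le_strip {u : ℝ → ℝ} (hu : IntervalIntegrable u volume 0 1)
    (B : ℝ) {η : ℝ} (hη : 0 < η) :
    ∃ R : ℝ, 0 < R ∧ ∀ k l : ℂ, R + ‖k - l‖ ≤ ‖k‖ → |k.im| ≤ B → |l.im| ≤ B →
      ‖fourierLaplace (fun t => (u t : ℂ)) k - fourierLaplace (fun t => (u t : ℂ)) l‖
        ≤ η * ‖k - l‖ := by
  obtain ⟨R, hR, hRk⟩ := exists_norm_fourierLaplace_le_exp
    (u := fun t => t * u t) (hu.continuousOn_mul continuousOn_id)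
    (show 0 < η / (2 * Real.exp (2 * B)) by positivity)
  refine ⟨R, hR, fun k l hkl hk hl => ?_⟩
  refine (convex_segment l k).norm_image_sub_le_of_norm_hasDerivWithin_le
    (f := fourierLaplace fun t => (u t : ℂ))
    (fun z _ => (hasDerivAt_fourierLaplace ⟨hu.1.ofReal, hu.2.ofReal⟩ z).hasDerivWithinAt)
    (fun z hz => ?_) (left_mem_segment ℝ l k) (right_mem_segment ℝ l k)
  have him : |z.im| ≤ B := by
    have hconv : Convex ℝ (Complex.imLm ⁻¹' Icc (-B) B) := (convex_Icc (-B) B).linear_preimage _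
    exact abs_le.mpr (hconv.segment_subset (abs_le.mp hl) (abs_le.mp hk) hz)
  have hzn : R ≤ ‖z‖ := by
    have h1 : ‖z - k‖ ≤ ‖l - k‖ := by
      have := norm_sub_le_of_mem_segment (y := z) (x := k) (z := l) (segment_symm ℝ l k ▸ hz)
      simpa using this
    have h2 := norm_add_le z (k - z)
    rw [add_sub_cancel] at h2
    rw [norm_sub_rev l k, norm_sub_rev z k] at h1
    linarith
  have h3 := hRk z hzn
  push_cast at h3
  rw [norm_mul, norm_mul, Complex.norm_I, Complex.norm_ofNat, mul_one]
  calc _ ≤ 2 * (η / (2 * Real.exp (2 * B)) * Real.exp (2 * |z.im|)) :=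
        mul_le_mul_of_nonneg_left h3 two_pos.le
    _ ≤ 2 * (η / (2 * Real.exp (2 * B)) * Real.exp (2 * B)) := by gcongr
    _ = η := by field_simp

/-- The second derivative of `q` on `(0,1)`, complex-valued. -/
def secondDeriv (q : ℝ → ℝ) (t : ℝ) : ℂ := ((deriv (deriv01 q) t : ℝ) : ℂ)

lemma MemW22.intervalIntegrable_deriv {q : ℝ → ℝ} (hq : MemW22 q) :
    IntervalIntegrable (deriv (deriv01 q)) volume 0 1 :=
  hq.absolutelyContinuous.intervalIntegrable_deriv

lemma MemW22.memLp_secondDeriv {q : ℝ → ℝ} (hq : MemW22 q) :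
    MemLp (secondDeriv q) 2 (volume.restrict (Ioc 0 1)) := by
  rw [← restrict_Ioo_eq_restrict_Ioc]
  exact hq.memLp.ofReal

/-- The cosine transform `∫₀¹ q''(t) cos 2kt dt`. -/
def cosTransform (q : ℝ → ℝ) (k : ℂ) : ℂ :=
  (fourierLaplace (secondDeriv q) k + fourierLaplace (secondDeriv q) (-k)) / 2

lemma integral_mul_cos_eq {q : ℝ → ℝ} (hq : MemW22 q) (k : ℂ) :
    ∫ t in (0 : ℝ)..1, ((deriv (deriv01 q) t : ℝ) : ℂ) * Complex.cos (2 * k * t)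
      = cosTransform q k := by
  have hi : IntervalIntegrable (secondDeriv q) volume 0 1 :=
    ⟨hq.intervalIntegrable_deriv.1.ofReal, hq.intervalIntegrable_deriv.2.ofReal⟩
  have hE : ∀ k : ℂ, IntervalIntegrable
      (fun t : ℝ => secondDeriv q t * Complex.exp (2 * Complex.I * k * t)) volume 0 1 :=
    fun k => hi.mul_continuousOn (by fun_prop)
  rw [cosTransform, fourierLaplace, fourierLaplace, ← intervalIntegral.integral_add (hE k) (hE (-k)),
    ← intervalIntegral.integral_div]
  refine intervalIntegral.integral_congr fun t _ => ?_
  simp only [secondDeriv, Complex.cos]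
  have e1 : 2 * k * t * Complex.I = 2 * Complex.I * k * t := by ring
  have e2 : -(2 * k * t) * Complex.I = 2 * Complex.I * -k * t := by ring
  rw [e1, e2]
  ring

/-- The non-oscillating part of `8 k² Δ(k²) / q'(1)`. -/
def polyPart (q : ℝ → ℝ) (h : ℝ) (k : ℂ) : ℂ :=
  (4 * omega q * k ^ 2 + constTerm q h) / deriv01 q 1

/-- `8 k² Δ(k²) = q'(1) (cos 2k + polyPart + o(e^{2|Im k|}))`. -/
lemma exists_charW_eq {q : ℝ → ℝ} (hq : MemW22 q) (hq1 : q 1 = 0) (ha : deriv01 q 1 ≠ 0) (h : ℝ)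
    {η : ℝ} (hη : 0 < η) :
    ∃ R : ℝ, 0 < R ∧ ∀ k : ℂ, R ≤ ‖k‖ → ∃ e : ℂ, ‖e‖ ≤ η * Real.exp (2 * |k.im|) ∧
      8 * k ^ 2 * charW q h (k ^ 2)
        = deriv01 q 1 * (Complex.cos (2 * k) + polyPart q h k + e) := by
  obtain ⟨C, K, hC, hK, hb⟩ := exists_bound_charW_sub hq hq1 h
  have ha' : (0 : ℝ) < |deriv01 q 1| := abs_pos.mpr ha
  have hac : (deriv01 q 1 : ℂ) ≠ 0 := by exact_mod_cast ha
  obtain ⟨R₁, hR₁, h₁⟩ := exists_norm_fourierLaplace_le_exp hq.intervalIntegrable_deriv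
    (show 0 < η * |deriv01 q 1| / 2 by positivity)
  set R₂ : ℝ := 2 * C / (η * |deriv01 q 1|) with hR₂
  refine ⟨max K (max R₁ R₂), lt_max_of_lt_left hK, fun k hk => ?_⟩
  have hkK : K ≤ ‖k‖ := (le_max_left _ _).trans hk
  have hkR₁ : R₁ ≤ ‖k‖ := ((le_max_left _ _).trans (le_max_right _ _)).trans hk
  have hkR₂ : R₂ ≤ ‖k‖ := ((le_max_right _ _).trans (le_max_right _ _)).trans hk
  have hk0 : 0 < ‖k‖ := hK.trans_le hkK
  have h2 := hb k hkK
  rw [integral_mul_cos_eq hq] at h2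
  have hE : ‖cosTransform q k‖ ≤ η * |deriv01 q 1| / 2 * Real.exp (2 * |k.im|) := by
    have e1 := h₁ k hkR₁
    have e2 := h₁ (-k) (by rwa [norm_neg])
    rw [Complex.neg_im, abs_neg] at e2
    rw [cosTransform, norm_div, Complex.norm_ofNat]
    have := norm_add_le (fourierLaplace (secondDeriv q) k) (fourierLaplace (secondDeriv q) (-k))
    have e3 : ‖fourierLaplace (secondDeriv q) k‖ ≤ _ := e1
    have e4 : ‖fourierLaplace (secondDeriv q) (-k)‖ ≤ _ := e2
    linarith
  have hC' : C * (Real.exp (2 * |k.im|) / ‖k‖) ≤ η * |deriv01 q 1| / 2 * Real.exp (2 * |k.im|) := by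
    have h3 : C ≤ η * |deriv01 q 1| / 2 * ‖k‖ := by
      rw [hR₂, div_le_iff₀ (by positivity)] at hkR₂
      linarith
    calc C * (Real.exp (2 * |k.im|) / ‖k‖)
        ≤ η * |deriv01 q 1| / 2 * ‖k‖ * (Real.exp (2 * |k.im|) / ‖k‖) := by gcongr
      _ = _ := by field_simp
  refine ⟨8 * k ^ 2 * charW q h (k ^ 2) / deriv01 q 1 - Complex.cos (2 * k) - polyPart q h k,
    ?_, by field_simp; ring⟩
  have e : 8 * k ^ 2 * charW q h (k ^ 2) / deriv01 q 1 - Complex.cos (2 * k) - polyPart q h k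
      = ((8 * k ^ 2 * charW q h (k ^ 2) - (4 * omega q * k ^ 2
        + deriv01 q 1 * Complex.cos (2 * k) + constTerm q h - cosTransform q k))
        - cosTransform q k) / deriv01 q 1 := by
    rw [polyPart]
    field_simp
    ring
  rw [e, norm_div, Complex.norm_real, Real.norm_eq_abs, div_le_iff₀ ha']
  refine (norm_sub_le _ _).trans ?_
  linarith

lemma le_norm_cos_two_mul (k : ℂ) : (Real.exp (2 * |k.im|) - 1) / 2 ≤ ‖Complex.cos (2 * k)‖ := by
  have key : ∀ k : ℂ, 0 ≤ k.im → (Real.exp (2 * k.im) - 1) / 2 ≤ ‖Complex.cos (2 * k)‖ := by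
    intro k hk
    have e1 : ‖Complex.exp (2 * k * Complex.I)‖ ≤ 1 := by
      rw [Complex.norm_exp, Real.exp_le_one_iff]
      simp [hk]
    have e2 : ‖Complex.exp (-(2 * k) * Complex.I)‖ = Real.exp (2 * k.im) := by
      rw [Complex.norm_exp]; simp
    have e3 := norm_sub_norm_le (Complex.exp (-(2 * k) * Complex.I))
      (-Complex.exp (2 * k * Complex.I))
    rw [norm_neg, e2, sub_neg_eq_add] at e3
    rw [Complex.cos, norm_div, Complex.norm_ofNat, add_comm]
    linarith
  rcases le_total 0 k.im with h | h
  · rw [abs_of_nonneg h]; exact key k h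
  · have := key (-k) (by simpa using h)
    rw [abs_of_nonpos h]
    simpa using this

lemma re_cos_two_mul (k : ℂ) :
    (Complex.cos (2 * k)).re = Real.cos (2 * |k.re|) * Real.cosh (2 * |k.im|) := by
  have h : (2 * k : ℂ) = ((2 * k.re : ℝ) : ℂ) + ((2 * k.im : ℝ) : ℂ) * Complex.I := by
    conv_lhs => rw [← Complex.re_add_im k]
    push_cast; ring
  rw [h, Complex.cos_add_mul_I]
  have h1 : Real.cos (2 * |k.re|) = Real.cos (2 * k.re) := by
    rw [← abs_two, ← abs_mul, Real.cos_abs, abs_two]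
  have h2 : Real.cosh (2 * |k.im|) = Real.cosh (2 * k.im) := by
    rw [← abs_two, ← abs_mul, Real.cosh_abs, abs_two]
  rw [h1, h2, ← Complex.ofReal_cos, ← Complex.ofReal_cosh, ← Complex.ofReal_sin,
    ← Complex.ofReal_sinh]
  simp [-Complex.ofReal_cos, -Complex.ofReal_cosh, -Complex.ofReal_sin, -Complex.ofReal_sinh]

/-- If `e^{2y}` grows at most like `ρ²`, then `y² = o(ρ)`. -/
lemma exists_sq_le_of_exp_le (C : ℝ) {δ : ℝ} (hδ : 0 < δ) :
    ∃ R : ℝ, 0 < R ∧ ∀ ρ y : ℝ, R ≤ ρ → 0 ≤ y → Real.exp (2 * y) ≤ C * ρ ^ 2 → y ^ 2 ≤ δ * ρ := by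
  refine ⟨720 * |C| / δ ^ 3 + 1, by positivity, fun ρ y hρ hy h => ?_⟩
  by_contra! hcon
  have hρ0 : 0 < ρ := lt_of_lt_of_le (by positivity) hρ
  -- `e^{2y} ≥ (2y)⁶ / 6!`
  have h1 := Real.pow_div_factorial_le_exp (2 * y) (by positivity) 6
  have h2 : (δ * ρ) ^ 3 ≤ (y ^ 2) ^ 3 := pow_le_pow_left₀ (by positivity) hcon.le 3
  have h3 : (Nat.factorial 6 : ℝ) = 720 := by norm_num [Nat.factorial]
  rw [h3] at h1
  have h4 : 720 * |C| < δ ^ 3 * ρ := by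
    have h5 : 720 * |C| / δ ^ 3 < ρ := by linarith
    rw [div_lt_iff₀ (by positivity)] at h5
    linarith
  have h6 : C * ρ ^ 2 ≤ |C| * ρ ^ 2 := by gcongr; exact le_abs_self C
  have h7 : (2 * y) ^ 6 = 64 * (y ^ 2) ^ 3 := by ring
  have h8 : 720 * |C| * ρ ^ 2 < δ ^ 3 * ρ * ρ ^ 2 := by gcongr
  have h9 : (δ * ρ) ^ 3 = δ ^ 3 * ρ * ρ ^ 2 := by ring
  have h10 : 0 < δ ^ 3 * ρ * ρ ^ 2 := by positivity
  rw [h7] at h1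
  nlinarith

lemma norm_sub_abs_re_le {k : ℂ} (hk : k ≠ 0) : ‖k‖ - |k.re| ≤ k.im ^ 2 / ‖k‖ := by
  have h0 : 0 < ‖k‖ := norm_pos_iff.mpr hk
  rw [le_div_iff₀ h0]
  have h1 := Complex.sq_norm k
  rw [Complex.normSq_apply] at h1
  have h2 := Complex.abs_re_le_norm k
  nlinarith [abs_nonneg k.re, sq_abs k.re]

/-! ### The number of zeros of the characteristic function in large disks -/

lemma norm_polyPart_le (q : ℝ → ℝ) (h : ℝ) {k : ℂ} (hk : 1 ≤ ‖k‖) :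
    ‖polyPart q h k‖ ≤ (4 * |omega q| + |constTerm q h|) / |deriv01 q 1| * ‖k‖ ^ 2 := by
  rw [polyPart, norm_div, Complex.norm_real, Real.norm_eq_abs, div_mul_eq_mul_div]
  gcongr
  refine (norm_add_le _ _).trans ?_
  rw [norm_mul, norm_mul, Complex.norm_real, Complex.norm_real, Complex.norm_ofNat, norm_pow,
    Real.norm_eq_abs, Real.norm_eq_abs]
  have : |constTerm q h| * 1 ≤ |constTerm q h| * ‖k‖ ^ 2 := by
    gcongr
    exact one_le_pow₀ hk
  linarith

/-- The growth of the cosine confines zeros to `e^{2|Im k|} = O(|k|²)`. -/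
lemma exists_exp_im_le (q : ℝ → ℝ) (h : ℝ) :
    ∃ M : ℝ, 0 < M ∧ ∀ k : ℂ, 1 ≤ ‖k‖ → ∀ s : ℝ, 0 ≤ s → s ≤ 1 → ∀ e : ℂ,
      ‖e‖ ≤ 1 / 8 * Real.exp (2 * |k.im|) →
      Complex.cos (2 * k) + s * (polyPart q h k + e) = 0 →
      Real.exp (2 * |k.im|) ≤ M * ‖k‖ ^ 2 := by
  set P := (4 * |omega q| + |constTerm q h|) / |deriv01 q 1| with hP
  have hP0 : 0 ≤ P := by positivity
  refine ⟨3 * (P + 1), by positivity, fun k hk s hs0 hs1 e he h0 => ?_⟩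
  have h1 := le_norm_cos_two_mul k
  have h2 : ‖Complex.cos (2 * k)‖ ≤ P * ‖k‖ ^ 2 + 1 / 8 * Real.exp (2 * |k.im|) := by
    rw [eq_neg_of_add_eq_zero_left h0, norm_neg, norm_mul, Complex.norm_real,
      Real.norm_of_nonneg hs0]
    calc _ ≤ 1 * ‖polyPart q h k + e‖ := by gcongr
      _ ≤ _ := by
        rw [one_mul]
        exact (norm_add_le _ _).trans (add_le_add (norm_polyPart_le q h hk) he)
  have h3 : 1 ≤ ‖k‖ ^ 2 := one_le_pow₀ hk
  nlinarith [Real.exp_pos (2 * |k.im|)]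

/-- On the circles `|k| = Lπ/2` the sign of `cos 2k` is that of `(-1)^L` where the imaginary part is
small, so a term whose real part does not compensate for it cannot produce a zero. The parameter `s` runs
through the homotopy from the cosine to the characteristic function. -/
lemma exists_cos_add_ne_zero (q : ℝ → ℝ) (h : ℝ) {σ : ℝ}
    (hp : ∃ θ < 1, ∃ R : ℝ, ∀ k : ℂ, R ≤ ‖k‖ → |k.im| ≤ |k.re| / 2 →
      -σ * (polyPart q h k).re ≤ θ) :
    ∃ η > 0, ∃ N : ℕ, ∀ L : ℕ, N ≤ L → (-1 : ℝ) ^ L = σ → ∀ k : ℂ, ‖k‖ = L * Real.pi / 2 →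
      ∀ s : ℝ, 0 ≤ s → s ≤ 1 → ∀ e : ℂ, ‖e‖ ≤ η * Real.exp (2 * |k.im|) →
        Complex.cos (2 * k) + s * (polyPart q h k + e) ≠ 0 := by
  obtain ⟨θ, hθ, R₁, hp⟩ := hp
  set θ' := max θ 0 with hθ'
  have hθ'1 : θ' < 1 := max_lt hθ one_pos
  have hθ'0 : 0 ≤ θ' := le_max_right _ _
  -- the gap `1 - θ'` has to absorb the error `e` and the deviation of `|cos (2 Re k)|` from `1`
  set η := (1 - θ') / 8 with hη
  have hη0 : 0 < η := by rw [hη]; linarith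
  have hη1 : η ≤ 1 / 8 := by rw [hη]; linarith
  obtain ⟨M, hM, hexp⟩ := exists_exp_im_le q h
  obtain ⟨R₂, hR₂, hsq⟩ := exists_sq_le_of_exp_le M hη0
  obtain ⟨N, hN⟩ := exists_nat_ge (max 1 (max R₁ R₂))
  refine ⟨η, hη0, N, fun L hL hσ k hk s hs0 hs1 e he h0 => ?_⟩
  have hpi := Real.pi_gt_three
  have hLN : (N : ℝ) ≤ L := by exact_mod_cast hL
  have hkL : (L : ℝ) ≤ ‖k‖ := by
    rw [hk]
    nlinarith [Nat.cast_nonneg (α := ℝ) L]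
  have hkN : max 1 (max R₁ R₂) ≤ ‖k‖ := hN.trans (hLN.trans hkL)
  have hk1 : 1 ≤ ‖k‖ := (le_max_left _ _).trans hkN
  have hkR₁ : R₁ ≤ ‖k‖ := ((le_max_left _ _).trans (le_max_right _ _)).trans hkN
  have hkR₂ : R₂ ≤ ‖k‖ := ((le_max_right _ _).trans (le_max_right _ _)).trans hkN
  have hk0 : k ≠ 0 := norm_pos_iff.mp (by linarith)
  set y := |k.im| with hy
  have hy0 : 0 ≤ y := abs_nonneg _
  have hexpk := hexp k hk1 s hs0 hs1 e (he.trans (by gcongr)) h0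
  have hysq : y ^ 2 ≤ η * ‖k‖ := hsq _ _ hkR₂ hy0 hexpk
  have hre : ‖k‖ - |k.re| ≤ η := by
    refine (norm_sub_abs_re_le hk0).trans ?_
    rw [div_le_iff₀ (by linarith), ← sq_abs]
    exact hysq
  have hyre : y ≤ |k.re| / 2 := by
    have h1 : 7 / 8 * ‖k‖ ≤ |k.re| := by nlinarith
    have h2 : y ^ 2 ≤ (|k.re| / 2) ^ 2 := by nlinarith
    exact (pow_le_pow_iff_left₀ hy0 (by positivity) two_ne_zero).mp h2
  have hpk := hp k hkR₁ hyre
  -- `2 |Re k|` is close to `2 |k| = Lπ`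
  have hcos : 1 - 2 * η ≤ σ * Real.cos (2 * |k.re|) := by
    have h1 : 2 * |k.re| = L * Real.pi - 2 * (‖k‖ - |k.re|) := by rw [hk]; ring
    have h2 : σ * σ = 1 := by
      rw [← hσ, ← pow_add, ← two_mul, pow_mul]; simp
    rw [h1, Real.cos_nat_mul_pi_sub, hσ, ← mul_assoc, h2, one_mul]
    have h3 := Real.one_sub_sq_div_two_le_cos (x := 2 * (‖k‖ - |k.re|))
    have h4 : 0 ≤ ‖k‖ - |k.re| := sub_nonneg.mpr (Complex.abs_re_le_norm k)
    nlinarith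
  have hcosh := Real.one_le_cosh (2 * y)
  have hexpc : Real.exp (2 * y) ≤ 2 * Real.cosh (2 * y) := by
    rw [Real.cosh_eq]
    linarith [Real.exp_pos (-(2 * y))]
  have hσ1 : |σ| = 1 := by rw [← hσ, abs_pow]; simp
  have hmain : σ * (Complex.cos (2 * k)).re = s * (-σ * (polyPart q h k).re) - s * (σ * e.re) := by
    rw [eq_neg_of_add_eq_zero_left h0]
    simp
    ring
  rw [re_cos_two_mul, ← mul_assoc] at hmain
  have hb1 : s * (-σ * (polyPart q h k).re) ≤ θ' := by
    calc _ ≤ s * θ' := by gcongr; exact hpk.trans (le_max_left _ _)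
      _ ≤ 1 * θ' := by gcongr
      _ = _ := one_mul _
  have hb2 : -(s * (σ * e.re)) ≤ 2 * η * Real.cosh (2 * y) := by
    calc _ ≤ |s * (σ * e.re)| := neg_le_abs _
      _ = s * |e.re| := by rw [abs_mul, abs_mul, hσ1, one_mul, abs_of_nonneg hs0]
      _ ≤ 1 * ‖e‖ := by gcongr; exact Complex.abs_re_le_norm e
      _ ≤ η * (2 * Real.cosh (2 * y)) := by rw [one_mul]; exact he.trans (by gcongr)
      _ = _ := by ring
  have hb3 : (1 - 2 * η) * Real.cosh (2 * y) ≤ σ * Real.cos (2 * |k.re|) * Real.cosh (2 * y) := by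
    gcongr
  have hb4 : θ' = 1 - 8 * η := by rw [hη]; ring
  nlinarith

/-- The number of zeros of the characteristic function in the disks of radius `(Lπ/2)²`. -/
lemma exists_card_zeros {q : ℝ → ℝ} (hq : MemW22 q) (hq1 : q 1 = 0) (ha : deriv01 q 1 ≠ 0) (h : ℝ)
    {σ : ℝ} (hp : ∃ θ < 1, ∃ R : ℝ, ∀ k : ℂ, R ≤ ‖k‖ → |k.im| ≤ |k.re| / 2 →
      -σ * (polyPart q h k).re ≤ θ) :
    ∃ N : ℕ, ∀ L : ℕ, N ≤ L → (-1 : ℝ) ^ L = σ → ∃ T : Multiset ℂ,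
      (∀ z, T.count z
        = if ‖z‖ < (L * Real.pi / 2) ^ 2 then analyticOrderNatAt (charW q h) z else 0) ∧
      Multiset.card T + 1 = L := by
  obtain ⟨η, hη, N₁, h₁⟩ := exists_cos_add_ne_zero q h hp
  obtain ⟨R, hR, h₂⟩ := exists_charW_eq hq hq1 ha h hη
  obtain ⟨N₂, hN₂⟩ := exists_nat_ge R
  have hpi := Real.pi_gt_three
  refine ⟨max 1 (max N₁ N₂), fun L hL hσ => ?_⟩
  have hL0 : 0 < L := lt_of_lt_of_le one_pos ((le_max_left _ _).trans hL)
  have hLN₁ : N₁ ≤ L := ((le_max_left _ _).trans (le_max_right _ _)).trans hL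
  have hLN₂ : (N₂ : ℝ) ≤ L := by
    exact_mod_cast ((le_max_right _ _).trans (le_max_right _ _)).trans hL
  have hac : (deriv01 q 1 : ℂ) ≠ 0 := by exact_mod_cast ha
  have hroot : ∀ z ∈ Metric.sphere (0 : ℂ) ((L * Real.pi / 2) ^ 2),
      ∃ k : ℂ, z = k ^ 2 ∧ ‖k‖ = L * Real.pi / 2 := by
    intro z hz
    obtain ⟨k, hk⟩ := IsAlgClosed.exists_pow_nat_eq z (n := 2) two_pos
    refine ⟨k, hk.symm, ?_⟩
    rw [mem_sphere_zero_iff_norm, ← hk, norm_pow] at hz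
    exact (pow_left_inj₀ (norm_nonneg _) (by positivity) two_ne_zero).mp hz
  refine exists_zeros_multiset_card (differentiable_charW hq.continuousOn h) hL0
    (a := 8) (b := deriv01 q 1) (by norm_num) hac ?_ ?_
  · intro z hz
    obtain ⟨k, rfl, hk⟩ := hroot z hz
    rw [cosTwoSqrt_sq]
    have := h₁ L hLN₁ hσ k hk 0 le_rfl zero_le_one 0 (by simp; positivity)
    simpa using this
  · intro z hz t ht h0
    obtain ⟨k, rfl, hk⟩ := hroot z hz
    have hkR : R ≤ ‖k‖ := by
      rw [hk]
      nlinarith [Nat.cast_nonneg (α := ℝ) L]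
    obtain ⟨e, he, heq⟩ := h₂ k hkR
    rw [cosTwoSqrt_sq, heq] at h0
    have ht1 : (0 : ℝ) < 1 + t := by linarith
    have ht1c : (1 + t : ℂ) ≠ 0 := by exact_mod_cast ht1.ne'
    -- division by `1 + t` turns the segment condition into a point of the homotopy
    refine h₁ L hLN₁ hσ k hk (1 / (1 + t)) (by positivity)
      (by rw [div_le_one ht1]; linarith) e he ?_
    have h3 : deriv01 q 1 * (Complex.cos (2 * k) + polyPart q h k + e + t * Complex.cos (2 * k))
        = 0 := by linear_combination h0
    have h4 := (mul_eq_zero.mp h3).resolve_left hac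
    push_cast
    field_simp
    linear_combination h4

/-! ### Localization of the large zeros -/

lemma complex_sq_sqrt (z : ℂ) : Complex.sqrt z ^ 2 = z := by
  rw [Complex.sqrt]
  exact_mod_cast Complex.cpow_nat_inv_pow z two_ne_zero

lemma complex_sqrt_re_nonneg (z : ℂ) : 0 ≤ (Complex.sqrt z).re := by
  rw [Complex.sqrt, Complex.cpow_inv_two_re]
  exact Real.sqrt_nonneg _

lemma norm_complex_sqrt_sq (z : ℂ) : ‖Complex.sqrt z‖ ^ 2 = ‖z‖ := by
  rw [← norm_pow, complex_sq_sqrt]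

lemma im_eq_two_mul_sqrt (z : ℂ) : z.im = 2 * (Complex.sqrt z).re * (Complex.sqrt z).im := by
  conv_lhs => rw [← complex_sq_sqrt z]
  rw [sq, Complex.mul_im]
  ring

lemma complex_sqrt_im_pos {z : ℂ} (hz : 0 < z.im) : 0 < (Complex.sqrt z).im := by
  have h1 := im_eq_two_mul_sqrt z
  have h2 := complex_sqrt_re_nonneg z
  by_contra! h
  nlinarith

lemma complex_sqrt_im_neg {z : ℂ} (hz : z.im < 0) : (Complex.sqrt z).im < 0 := by
  have h1 := im_eq_two_mul_sqrt z
  have h2 := complex_sqrt_re_nonneg z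
  by_contra! h
  nlinarith

/-- The size of `ζ` is controlled by `e^{iζ} - 1`, as long as `Re ζ` stays away from the next periods
`±2π`. -/
lemma norm_le_of_norm_exp_sub_one_le {ζ : ℂ} (hre : |ζ.re| ≤ 3 / 2 * Real.pi)
    (h : ‖Complex.exp (Complex.I * ζ) - 1‖ ≤ 1 / 2) :
    ‖ζ‖ ≤ 3 / 2 * ‖Complex.exp (Complex.I * ζ) - 1‖ := by
  have hpos : 0 < (Complex.exp (Complex.I * ζ)).re := by
    have h1 := (abs_le.mp ((Complex.abs_re_le_norm _).trans h)).1
    rw [Complex.sub_re, Complex.one_re] at h1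
    linarith
  have him : (Complex.I * ζ).im = ζ.re := by simp
  rw [Complex.exp_re, him] at hpos
  have hcos : 0 < Real.cos |ζ.re| := by
    rw [Real.cos_abs]
    exact (pos_iff_pos_of_mul_pos hpos).mp (Real.exp_pos _)
  have hlt : |ζ.re| < Real.pi / 2 := by
    by_contra! hcon
    exact absurd hcos (not_lt.mpr (Real.cos_nonpos_of_pi_div_two_le_of_le hcon (by linarith)))
  have hlt' := abs_lt.mp hlt
  have hlog := Complex.norm_log_one_add_half_le_self h
  rw [add_sub_cancel, Complex.log_exp (by rw [him]; linarith [Real.pi_pos])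
    (by rw [him]; linarith [Real.pi_pos]), norm_mul, Complex.norm_I, one_mul] at hlog
  exact hlog

lemma summable_sq_of_eventually_le {x A B : ℕ → ℝ} {C : ℝ} (hx : ∀ n, 0 ≤ x n)
    (h : ∀ᶠ n in atTop, x n ≤ C * (A n + B n)) (hA : Summable fun n => A n ^ 2)
    (hB : Summable fun n => B n ^ 2) : Summable fun n => x n ^ 2 := by
  refine Summable.of_norm_bounded_eventually_nat (g := fun n => 2 * C ^ 2 * (A n ^ 2 + B n ^ 2))
    ((hA.add hB).mul_left _) ?_
  filter_upwards [h] with n hn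
  rw [Real.norm_of_nonneg (sq_nonneg _)]
  calc x n ^ 2 ≤ (C * (A n + B n)) ^ 2 := pow_le_pow_left₀ (hx n) hn 2
    _ = C ^ 2 * (A n + B n) ^ 2 := by ring
    _ ≤ C ^ 2 * (2 * (A n ^ 2 + B n ^ 2)) := by
        gcongr
        nlinarith [sq_nonneg (A n - B n)]
    _ = _ := by ring

/-- Large zeros `k²` of the characteristic function satisfy `|Im k| = O(log |k|)`. -/
lemma exists_zero_im_bounds {q : ℝ → ℝ} (hq : MemW22 q) (hq1 : q 1 = 0) (ha : deriv01 q 1 ≠ 0)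
    (h : ℝ) :
    ∃ M > 0, ∀ δ > 0, ∃ R : ℝ, ∀ k : ℂ, R ≤ ‖k‖ → charW q h (k ^ 2) = 0 →
      Real.exp (2 * |k.im|) ≤ M * ‖k‖ ^ 2 ∧ k.im ^ 2 ≤ δ * ‖k‖ := by
  obtain ⟨M, hM, hexp⟩ := exists_exp_im_le q h
  obtain ⟨R₁, hR₁, h₁⟩ := exists_charW_eq hq hq1 ha h (show (0 : ℝ) < 1 / 8 by norm_num)
  refine ⟨M, hM, fun δ hδ => ?_⟩
  obtain ⟨R₂, hR₂, hsq⟩ := exists_sq_le_of_exp_le M hδ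
  refine ⟨max 1 (max R₁ R₂), fun k hk h0 => ?_⟩
  have hk1 : 1 ≤ ‖k‖ := (le_max_left _ _).trans hk
  have hkR₁ : R₁ ≤ ‖k‖ := ((le_max_left _ _).trans (le_max_right _ _)).trans hk
  have hkR₂ : R₂ ≤ ‖k‖ := ((le_max_right _ _).trans (le_max_right _ _)).trans hk
  obtain ⟨e, he, heq⟩ := h₁ k hkR₁
  rw [h0, mul_zero, eq_comm] at heq
  have h3 := (mul_eq_zero.mp heq).resolve_left (by exact_mod_cast ha)
  have h4 := hexp k hk1 1 zero_le_one le_rfl e he (by push_cast; linear_combination h3)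
  refine ⟨h4, ?_⟩
  rw [← sq_abs]
  exact hsq _ _ hkR₂ (abs_nonneg _) h4

/-- The square roots of large zeros have real part close to their modulus, so that an annulus for the
modulus amounts to a vertical strip. -/
lemma exists_zero_re_bounds {q : ℝ → ℝ} (hq : MemW22 q) (hq1 : q 1 = 0) (ha : deriv01 q 1 ≠ 0)
    (h : ℝ) {δ : ℝ} (hδ : 0 < δ) :
    ∃ R : ℝ, ∀ z : ℂ, R ≤ ‖Complex.sqrt z‖ → charW q h z = 0 →
      ‖Complex.sqrt z‖ - δ ≤ (Complex.sqrt z).re := by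
  obtain ⟨M, -, hM⟩ := exists_zero_im_bounds hq hq1 ha h
  obtain ⟨R, hR⟩ := hM δ hδ
  refine ⟨max 1 R, fun z hz h0 => ?_⟩
  have h1 : 1 ≤ ‖Complex.sqrt z‖ := (le_max_left _ _).trans hz
  have h2 := (hR _ ((le_max_right _ _).trans hz) (by rwa [complex_sq_sqrt])).2
  have h3 := norm_sub_abs_re_le (k := Complex.sqrt z) (norm_pos_iff.mp (by linarith))
  rw [abs_of_nonneg (complex_sqrt_re_nonneg z)] at h3
  have h4 : (Complex.sqrt z).im ^ 2 / ‖Complex.sqrt z‖ ≤ δ := by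
    rw [div_le_iff₀ (by linarith)]; exact h2
  linarith

/-- For `ω ≠ 0` large zeros are not real. -/
lemma exists_zero_im_ne_zero {q : ℝ → ℝ} (hq : MemW22 q) (hq1 : q 1 = 0) (ha : deriv01 q 1 ≠ 0)
    (h : ℝ) (hω : omega q ≠ 0) :
    ∃ R : ℝ, ∀ z : ℂ, R ≤ ‖Complex.sqrt z‖ → charW q h z = 0 → z.im ≠ 0 := by
  obtain ⟨R₁, hR₁, h₁⟩ := exists_charW_eq hq hq1 ha h one_pos
  obtain ⟨R₂, h₂⟩ := exists_zero_re_bounds hq hq1 ha h (δ := 1) one_pos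
  set W := 4 * |omega q| with hW
  have hW0 : 0 < W := by positivity
  set B := 2 * |deriv01 q 1| + |constTerm q h| with hB
  have hB0 : 0 ≤ B := by positivity
  refine ⟨max (max R₁ R₂) (max 2 (B / W + 1)), fun z hz h0 him => ?_⟩
  have hR₁z : R₁ ≤ ‖Complex.sqrt z‖ := ((le_max_left _ _).trans (le_max_left _ _)).trans hz
  have hR₂z : R₂ ≤ ‖Complex.sqrt z‖ := ((le_max_right _ _).trans (le_max_left _ _)).trans hz
  have h2z : 2 ≤ ‖Complex.sqrt z‖ := ((le_max_left _ _).trans (le_max_right _ _)).trans hz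
  have hBz : B / W + 1 ≤ ‖Complex.sqrt z‖ := ((le_max_right _ _).trans (le_max_right _ _)).trans hz
  obtain ⟨e, he, heq⟩ := h₁ _ hR₁z
  have hre := h₂ z hR₂z h0
  set k := Complex.sqrt z with hk
  have hkim : k.im = 0 := by
    rw [im_eq_two_mul_sqrt, ← hk] at him
    rcases mul_eq_zero.mp him with h | h
    · linarith
    · exact h
  rw [hkim] at he
  simp only [abs_zero, mul_zero, Real.exp_zero, one_mul] at he
  rw [complex_sq_sqrt, h0, mul_zero, eq_comm] at heq
  have hac : (deriv01 q 1 : ℂ) ≠ 0 := by exact_mod_cast ha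
  have h3 : (4 * omega q * k ^ 2 : ℂ)
      = -(deriv01 q 1 * (Complex.cos (2 * k) + e)) - constTerm q h := by
    rw [polyPart] at heq
    field_simp at heq
    linear_combination heq
  have hcos : ‖Complex.cos (2 * k)‖ ≤ 1 := by
    have := norm_cos_le (2 * k)
    simpa [hkim] using this
  have h4 : W * ‖k‖ ^ 2 ≤ B := by
    have h5 : ‖(4 * omega q * k ^ 2 : ℂ)‖ = W * ‖k‖ ^ 2 := by
      simp [hW]
    rw [← h5, h3]
    refine (norm_sub_le _ _).trans ?_
    rw [norm_neg, norm_mul, Complex.norm_real, Complex.norm_real, Real.norm_eq_abs,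
      Real.norm_eq_abs, hB]
    have h6 := norm_add_le (Complex.cos (2 * k)) e
    have : |deriv01 q 1| * ‖Complex.cos (2 * k) + e‖ ≤ |deriv01 q 1| * 2 := by
      gcongr
      linarith
    linarith
  have h7 : B < W * ‖k‖ := by
    have : B / W < ‖k‖ := by linarith
    rw [div_lt_iff₀ hW0] at this
    linarith
  nlinarith

/-- The logarithmic curve near which the square roots of the large zeros lie if `ω ≠ 0`. -/
def logCurve (c : ℝ) (s : ℤ) (n : ℕ) : ℂ :=
  Real.pi * (2 * n + s : ℤ) / 2 + Complex.I * (Real.log n + c : ℝ)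

lemma logCurve_re (c : ℝ) (s : ℤ) (n : ℕ) : (logCurve c s n).re = Real.pi * (2 * n + s) / 2 := by
  have : logCurve c s n = ((Real.pi * (2 * n + s) / 2 : ℝ) : ℂ)
      + Complex.I * (Real.log n + c : ℝ) := by
    rw [logCurve]; push_cast; ring
  rw [this]
  generalize Real.log n + c = y
  simp

lemma logCurve_im (c : ℝ) (s : ℤ) (n : ℕ) : (logCurve c s n).im = Real.log n + c := by
  have : logCurve c s n = ((Real.pi * (2 * n + s) / 2 : ℝ) : ℂ)
      + Complex.I * (Real.log n + c : ℝ) := by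
    rw [logCurve]; push_cast; ring
  rw [this]
  generalize Real.log n + c = y
  simp

lemma exp_logCurve (c : ℝ) (s : ℤ) {n : ℕ} (hn : n ≠ 0) :
    Complex.exp (-2 * Complex.I * logCurve c s n)
      = (((-1) ^ s * Real.exp (2 * c) * (n : ℝ) ^ 2 : ℝ) : ℂ) := by
  have e1 : -2 * Complex.I * logCurve c s n
      = ((-(2 * n + s : ℤ) : ℤ) : ℂ) * (Real.pi * Complex.I) + ((2 * Real.log n + 2 * c : ℝ) : ℂ) := by
    rw [logCurve]
    push_cast
    linear_combination (-2 * ((Complex.log n) + c)) * Complex.I_sq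
  have hn' : (0 : ℝ) < n := by positivity
  have e2 : Real.exp (2 * Real.log n + 2 * c) = Real.exp (2 * c) * (n : ℝ) ^ 2 := by
    rw [Real.exp_add, two_mul (Real.log n), Real.exp_add, Real.exp_log hn']
    ring
  rw [e1, Complex.exp_add, Complex.exp_int_mul, Complex.exp_pi_mul_I, ← Complex.ofReal_exp, e2]
  have e3 : ((-1 : ℂ)) ^ (-(2 * n + s : ℤ)) = (-1) ^ s := by
    rw [zpow_neg, zpow_add₀ (by norm_num), zpow_mul]
    norm_num
    rw [← inv_zpow]
    norm_num
  rw [e3]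
  push_cast
  ring

/-! ### Asymptotics of the square roots for `ω ≠ 0` -/

/-- The Fourier–Laplace transform of the reflected function `q''(1 - t)`. -/
def reflTransform (q : ℝ → ℝ) (k : ℂ) : ℂ :=
  fourierLaplace (fun t => ((deriv (deriv01 q) (1 - t) : ℝ) : ℂ)) k

/-- The equation satisfied by `e^{-2ik}` when `k²` is a zero. -/
lemma exists_exp_mul_eq {q : ℝ → ℝ} (hq : MemW22 q) (hq1 : q 1 = 0) (ha : deriv01 q 1 ≠ 0)
    (h : ℝ) :
    ∃ C K : ℝ, 0 < C ∧ 0 < K ∧ ∀ k : ℂ, K ≤ ‖k‖ → 0 ≤ k.im → charW q h (k ^ 2) = 0 →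
      ∃ τ b : ℂ, ‖τ‖ ≤ C * (‖reflTransform q k‖ + 1 / ‖k‖) ∧ ‖b‖ ≤ C ∧
        Complex.exp (-2 * Complex.I * k) * (1 - τ)
          = -(8 * omega q / deriv01 q 1) * k ^ 2 + b := by
  obtain ⟨C, K, hC, hK, hb⟩ := exists_bound_charW_sub hq hq1 h
  obtain ⟨R, hR, hg⟩ := exists_norm_fourierLaplace_le hq.intervalIntegrable_deriv one_pos
  have hac : (deriv01 q 1 : ℂ) ≠ 0 := by exact_mod_cast ha
  set A := |deriv01 q 1| with hA
  have hA0 : 0 < A := abs_pos.mpr ha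
  have hAn : ‖(deriv01 q 1 : ℂ)‖ = A := by rw [Complex.norm_real, Real.norm_eq_abs]
  refine ⟨1 + (1 + 2 * C + 2 * |constTerm q h|) / A, max K R, by positivity, lt_max_of_lt_left hK,
    fun k hk him h0 => ?_⟩
  have hkK : K ≤ ‖k‖ := (le_max_left _ _).trans hk
  have hk0 : 0 < ‖k‖ := hK.trans_le hkK
  have hgk : ‖fourierLaplace (secondDeriv q) k‖ ≤ 1 := hg k ((le_max_right _ _).trans hk) him
  set E := Complex.exp (-2 * Complex.I * k) with hE
  have hE0 : E ≠ 0 := Complex.exp_ne_zero _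
  have hEn : ‖E‖ = Real.exp (2 * k.im) := norm_exp_neg_two_I_mul k
  have hE1 : 1 ≤ ‖E‖ := by rw [hEn]; exact Real.one_le_exp (by positivity)
  have hcos : Complex.cos (2 * k) = (E + E⁻¹) / 2 := by
    rw [Complex.cos, hE, ← Complex.exp_neg, add_comm]
    congr 3 <;> ring_nf
  have hT : cosTransform q k = (fourierLaplace (secondDeriv q) k + E * reflTransform q k) / 2 := by
    rw [cosTransform, fourierLaplace_neg]; rfl
  have hbk := hb k hkK
  rw [integral_mul_cos_eq hq, h0, mul_zero, zero_sub, norm_neg, abs_of_nonneg him, ← hEn] at hbk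
  set err := 4 * (omega q : ℂ) * k ^ 2 + deriv01 q 1 * Complex.cos (2 * k) + constTerm q h
    - cosTransform q k with herr
  refine ⟨reflTransform q k / deriv01 q 1 + 2 * err / (deriv01 q 1 * E),
    -E⁻¹ - 2 * constTerm q h / deriv01 q 1 + fourierLaplace (secondDeriv q) k / deriv01 q 1,
    ?_, ?_, ?_⟩
  · have h1 : ‖2 * err / (deriv01 q 1 * E)‖ ≤ 2 * C / A * (1 / ‖k‖) := by
      rw [norm_div, norm_mul, norm_mul, hAn, Complex.norm_ofNat,
        div_le_iff₀ (by positivity)]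
      calc 2 * ‖err‖ ≤ 2 * (C * (‖E‖ / ‖k‖)) := by gcongr
        _ = _ := by field_simp
    have h2 : ‖reflTransform q k / deriv01 q 1‖ = 1 / A * ‖reflTransform q k‖ := by
      rw [norm_div, hAn]; ring
    refine (norm_add_le _ _).trans ?_
    rw [h2]
    have h3 : 1 / A ≤ 1 + (1 + 2 * C + 2 * |constTerm q h|) / A := by
      have : 1 / A ≤ (1 + 2 * C + 2 * |constTerm q h|) / A := by
        gcongr
        linarith [abs_nonneg (constTerm q h)]
      linarith
    have h4 : 2 * C / A ≤ 1 + (1 + 2 * C + 2 * |constTerm q h|) / A := by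
      have : 2 * C / A ≤ (1 + 2 * C + 2 * |constTerm q h|) / A := by
        gcongr
        linarith [abs_nonneg (constTerm q h)]
      linarith
    rw [mul_add]
    refine add_le_add ?_ (h1.trans ?_) <;> gcongr
  · have h1 : ‖E⁻¹‖ ≤ 1 := by
      rw [norm_inv]; exact inv_le_one_of_one_le₀ hE1
    have h2 : ‖(2 * constTerm q h / deriv01 q 1 : ℂ)‖ = 2 * |constTerm q h| / A := by
      rw [norm_div, norm_mul, hAn, Complex.norm_real, Complex.norm_ofNat, Real.norm_eq_abs]
    have h3 : ‖fourierLaplace (secondDeriv q) k / deriv01 q 1‖ ≤ 1 / A := by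
      rw [norm_div, hAn]; gcongr
    have h4 : 0 ≤ 2 * C / A := by positivity
    have h5 := norm_add_le (-E⁻¹ - 2 * constTerm q h / deriv01 q 1 : ℂ)
      (fourierLaplace (secondDeriv q) k / deriv01 q 1)
    have h6 := norm_sub_le (-E⁻¹ : ℂ) (2 * constTerm q h / deriv01 q 1)
    rw [norm_neg] at h6
    have h7 : (1 + 2 * C + 2 * |constTerm q h|) / A
        = 1 / A + 2 * C / A + 2 * |constTerm q h| / A := by ring
    linarith
  · rw [hcos, hT] at herr
    field_simp
    rw [herr]
    field_simp
    ring

/-- The logarithmic bound of the imaginary part in the weak form `O(x^{1/4})`, written with the square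
summable factor `x^{-3/4}`. -/
lemma im_le_of_exp_le {M x y : ℝ} (hM : 0 < M) (hx : 1 ≤ x)
    (h : Real.exp (2 * y) ≤ M * x ^ 2) :
    y ≤ (|Real.log M| + 8) * (x * x ^ (-(3 / 4) : ℝ)) := by
  have hx0 : 0 < x := by linarith
  have h2 := Real.log_le_log (Real.exp_pos _) h
  rw [Real.log_exp, Real.log_mul hM.ne' (by positivity), Real.log_pow] at h2
  have h3 := Real.log_le_rpow_div hx0.le (show (0 : ℝ) < 1 / 4 by norm_num)
  have h4 : x * x ^ (-(3 / 4) : ℝ) = x ^ (1 / 4 : ℝ) := by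
    nth_rewrite 1 [← Real.rpow_one x]
    rw [← Real.rpow_add hx0]
    norm_num
  have h5 : 1 ≤ x ^ (1 / 4 : ℝ) := Real.one_le_rpow hx (by norm_num)
  rw [h4]
  have h6 := le_abs_self (Real.log M)
  have h7 : |Real.log M| * 1 ≤ |Real.log M| * x ^ (1 / 4 : ℝ) := by gcongr
  have h8 := abs_nonneg (Real.log M)
  push_cast at h2
  linarith

/-- Near the real axis `k²` agrees with `(xπ)²` up to a relative error of order `A`. -/
lemma norm_div_sq_sub_one_le {k : ℂ} {x A Y : ℝ} (hx : 1 ≤ x) (hk : ‖k‖ ≤ 8 * x)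
    (hxA : 1 ≤ x * A) (h : ‖k - x * Real.pi‖ ≤ 5 + Y * (x * A)) :
    ‖(k / (x * Real.pi)) ^ 2 - 1‖ ≤ 5 * (5 + Y) * A := by
  have hpi := Real.pi_gt_three
  have hx0 : 0 < x := by linarith
  have hn : ‖((x : ℂ) * Real.pi)‖ = x * Real.pi := by
    simp [abs_of_pos Real.pi_pos, abs_of_pos hx0]
  have hxπ : x ≤ x * Real.pi := le_mul_of_one_le_right hx0.le (by linarith)
  have hn0 : ((x : ℂ) * Real.pi) ≠ 0 := by
    rw [← norm_pos_iff, hn]; positivity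
  have h0 : 0 ≤ (5 + Y) * (x * A) := by
    have := norm_nonneg (k - x * Real.pi)
    linarith
  have h2 : ‖k / (x * Real.pi) - 1‖ ≤ (5 + Y) * A := by
    have e1 : k / (x * Real.pi) - 1 = (k - x * Real.pi) / (x * Real.pi) := by
      rw [sub_div, div_self hn0]
    rw [e1, norm_div, hn, div_le_iff₀ (by positivity)]
    have e3 : (5 + Y) * (x * A) * 1 ≤ (5 + Y) * (x * A) * Real.pi := by
      gcongr
      linarith
    linarith
  have h3 : ‖k / (x * Real.pi) + 1‖ ≤ 5 := by
    refine (norm_add_le _ _).trans ?_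
    rw [norm_div, hn, norm_one]
    have : ‖k‖ / (x * Real.pi) ≤ 4 := by
      rw [div_le_iff₀ (by positivity)]
      have : x * 3 ≤ x * Real.pi := by gcongr
      linarith
    linarith
  have e : (k / (x * Real.pi)) ^ 2 - 1 = (k / (x * Real.pi) + 1) * (k / (x * Real.pi) - 1) := by
    ring
  rw [e, norm_mul, mul_assoc]
  gcongr

/-- The equation for `e^{-2ik}`, solved for the deviation `v - 1` of its quotient by `e^{-2iμ}`. -/
lemma norm_sub_one_le_of_mul_eq {v τ x y : ℂ} {α β γ A t : ℝ} (hα : 0 ≤ α) (hβ : 0 ≤ β)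
    (ht : 0 ≤ t) (h : (v - 1) * (1 - τ) = x + y + τ) (hx : ‖x‖ ≤ α * A) (hy : ‖y‖ ≤ β * A)
    (hτ : ‖τ‖ ≤ γ * (t + A)) (hτ2 : ‖τ‖ ≤ 1 / 2) :
    ‖v - 1‖ ≤ 2 * (α + β + γ) * (A + t) := by
  have h1τ : 1 / 2 ≤ ‖1 - τ‖ := by
    have := norm_sub_norm_le 1 τ
    rw [norm_one] at this
    linarith
  have h1 : ‖v - 1‖ * ‖1 - τ‖ ≤ α * A + β * A + γ * (t + A) := by
    rw [← norm_mul, h]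
    exact (norm_add_le _ _).trans (add_le_add ((norm_add_le _ _).trans (add_le_add hx hy)) hτ)
  have h2 : ‖v - 1‖ * (1 / 2) ≤ ‖v - 1‖ * ‖1 - τ‖ := by gcongr
  have h3 : 0 ≤ (α + β) * t := by positivity
  linarith

/-- A first approximation of `e^{-2i(k-μ)}` improves itself, since the remainder varies slowly. -/
lemma norm_sub_le_of_norm_exp_le {k μ : ℂ} {C A t t' : ℝ} (hC : 0 < C)
    (hre : |(-2 * (k - μ)).re| ≤ 3 / 2 * Real.pi)
    (hv : ‖Complex.exp (Complex.I * (-2 * (k - μ))) - 1‖ ≤ C * (A + t))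
    (hsmall : C * (A + t) ≤ 1 / 2)
    (ht : ‖k - μ‖ ≤ 1 → t ≤ t' + 1 / (2 * C) * ‖k - μ‖) :
    ‖k - μ‖ ≤ 2 * C * (A + t') := by
  have hkμ := norm_le_of_norm_exp_sub_one_le hre (hv.trans hsmall)
  rw [norm_mul, norm_neg, Complex.norm_ofNat] at hkμ
  have h1 := ht (by linarith)
  have h5 : C * t ≤ C * t' + 1 / 2 * ‖k - μ‖ := by
    calc _ ≤ C * (t' + 1 / (2 * C) * ‖k - μ‖) := by gcongr
      _ = _ := by field_simp
  have h6 : 2 * ‖k - μ‖ ≤ 3 / 2 * (C * (A + t)) := hkμ.trans (by gcongr)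
  have h7 := norm_nonneg (k - μ)
  linarith

lemma MemW22.memLp_reflect {q : ℝ → ℝ} (hq : MemW22 q) :
    MemLp (fun t : ℝ => ((deriv (deriv01 q) (1 - t) : ℝ) : ℂ)) 2
      (volume.restrict (Ioc 0 1)) := by
  rw [← restrict_Ioo_eq_restrict_Ioc]
  have h1 : MeasurePreserving (fun t : ℝ => 1 - t) (volume.restrict (Ioo 0 1))
      (volume.restrict (Ioo 0 1)) := by
    have h2 := (Measure.measurePreserving_sub_left (volume : Measure ℝ) 1).restrict_preimage
      (measurableSet_Ioo (a := (0 : ℝ)) (b := 1))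
    have h3 : (fun t : ℝ => 1 - t) ⁻¹' Ioo 0 1 = Ioo 0 1 := by
      ext t; simp
    rwa [h3] at h2
  exact (hq.memLp.comp_measurePreserving h1).ofReal

set_option maxHeartbeats 1000000 in
/-- The square roots of zeros in the consecutive annuli, taken from the upper half-plane, approach
the logarithmic curve at a square summable rate. -/
lemma summable_sqrt_sub_logCurve {q : ℝ → ℝ} (hq : MemW22 q) (hq1 : q 1 = 0)
    (ha : deriv01 q 1 ≠ 0) (h : ℝ) (hω : omega q ≠ 0) {c : ℝ} {s : ℤ} (hs0 : 0 ≤ s) (hs1 : s ≤ 1)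
    (hcs : (-1 : ℝ) ^ s * Real.exp (2 * c) = -(8 * Real.pi ^ 2 * omega q / deriv01 q 1))
    {z : ℕ → ℂ} (hz : ∀ᶠ n in atTop, charW q h (z n) = 0 ∧ 0 < (z n).im ∧
      (n + s / 2 - 1 / 2) * Real.pi ≤ ‖Complex.sqrt (z n)‖ ∧
      ‖Complex.sqrt (z n)‖ ≤ (n + s / 2 + 1 / 2) * Real.pi) :
    Summable fun n => ‖Complex.sqrt (z n) - logCurve c s n‖ ^ 2 := by
  have hpi := Real.pi_gt_three
  have hpi4 := Real.pi_le_four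
  have hac : (deriv01 q 1 : ℂ) ≠ 0 := by exact_mod_cast ha
  have hωc : (omega q : ℂ) ≠ 0 := by exact_mod_cast hω
  have hs0' : (0 : ℝ) ≤ s := by exact_mod_cast hs0
  have hs1' : (s : ℝ) ≤ 1 := by exact_mod_cast hs1
  obtain ⟨C, K, hC, hK, heq⟩ := exists_exp_mul_eq hq hq1 ha h
  obtain ⟨M, hM, him⟩ := exists_zero_im_bounds hq hq1 ha h
  obtain ⟨Rb, hRb⟩ := him 1 one_pos
  obtain ⟨Rr, hRr⟩ := exists_zero_re_bounds hq hq1 ha h (δ := 1 / 2) (by norm_num)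
  have hgr := intervalIntegrable_reflect hq.intervalIntegrable_deriv
  set A : ℕ → ℝ := fun n => (n : ℝ) ^ (-(3 / 4) : ℝ) with hAdef
  -- `W` is the modulus of `e^{-2iμ} / n²`
  set W : ℝ := 8 * Real.pi ^ 2 * |omega q| / |deriv01 q 1| with hW
  have hW0 : 0 < W := by positivity
  set Y : ℝ := |Real.log (64 * M)| + 8 with hY
  have hY0 : 0 < Y := by positivity
  set C₁ : ℝ := 2 * (5 * (5 + Y) + C / W + C) with hC₁
  have hC₁0 : 0 < C₁ := by positivity
  have hArate : Summable fun n => A n ^ 2 := by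
    have h1 : Summable fun n : ℕ => (n : ℝ) ^ (-(3 / 2) : ℝ) :=
      Real.summable_nat_rpow.mpr (by norm_num)
    refine h1.congr fun n => ?_
    rw [hAdef, ← Real.rpow_natCast, ← Real.rpow_mul (Nat.cast_nonneg n)]
    norm_num
  have hAlim : Tendsto A atTop (𝓝 0) :=
    (tendsto_rpow_neg_atTop (by norm_num : (0 : ℝ) < 3 / 4)).comp tendsto_natCast_atTop_atTop
  obtain ⟨R₁, hR₁, hsmall⟩ := exists_norm_fourierLaplace_le hgr
    (show 0 < 1 / (4 * (C₁ + C)) by positivity)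
  obtain ⟨R₂, hR₂, hslow⟩ := exists_norm_fourierLaplace_sub_le hgr
    (show 0 < 1 / (2 * C₁) by positivity)
  -- the approximation of `e^{-2i(k-μ)}` by `1`
  have hmain : ∀ᶠ n : ℕ in atTop,
      ‖Complex.sqrt (z n) - logCurve c s n‖
        ≤ 2 * C₁ * (A n + ‖reflTransform q (logCurve c s n)‖) := by
    obtain ⟨N, hN⟩ := exists_nat_ge (max (max K Rb) (max (max Rr R₁) (R₂ + 1)))
    have hlogc : Tendsto (fun n : ℕ => Real.log n) atTop atTop :=
      Real.tendsto_log_atTop.comp tendsto_natCast_atTop_atTop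
    filter_upwards [hz, eventually_ge_atTop (max 1 N), hlogc.eventually_ge_atTop (-c),
      hAlim.eventually_le_const (show (0 : ℝ) < 1 / (4 * (C₁ + C)) by positivity)]
      with n hzn hnN hlogn hAn
    obtain ⟨h0, hzim, hlow, hhigh⟩ := hzn
    have hn1 : (1 : ℝ) ≤ n := by exact_mod_cast (le_max_left _ _).trans hnN
    have hn0 : (0 : ℝ) < n := by linarith
    have hnN' : (N : ℝ) ≤ n := by exact_mod_cast (le_max_right _ _).trans hnN
    set k := Complex.sqrt (z n) with hk
    have hsπ0 : 0 ≤ s / 2 * Real.pi := by positivity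
    have hsπ1 : s / 2 * Real.pi ≤ 1 / 2 * Real.pi := by gcongr
    have hnπ3 : (n : ℝ) * 3 ≤ n * Real.pi := by gcongr
    have hnπ4 : (n : ℝ) * Real.pi ≤ n * 4 := by gcongr
    have hl1 : n * Real.pi - Real.pi / 2 ≤ ‖k‖ := by linarith
    have hl2 : ‖k‖ ≤ n * Real.pi + Real.pi := by linarith
    have hkn : (n : ℝ) ≤ ‖k‖ := by linarith
    have hk8 : ‖k‖ ≤ 8 * n := by linarith
    have hkN := (hN.trans hnN').trans hkn
    have hkK : K ≤ ‖k‖ := ((le_max_left _ _).trans (le_max_left _ _)).trans hkN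
    have hkRb : Rb ≤ ‖k‖ := ((le_max_right _ _).trans (le_max_left _ _)).trans hkN
    have hkRr : Rr ≤ ‖k‖ :=
      (((le_max_left _ _).trans (le_max_left _ _)).trans (le_max_right _ _)).trans hkN
    have hkR₁ : R₁ ≤ ‖k‖ :=
      (((le_max_right _ _).trans (le_max_left _ _)).trans (le_max_right _ _)).trans hkN
    have hkR₂ : R₂ + 1 ≤ ‖k‖ := ((le_max_right _ _).trans (le_max_right _ _)).trans hkN
    have hk0 : 0 < ‖k‖ := by linarith
    have hkim : 0 < k.im := complex_sqrt_im_pos hzim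
    have h0' : charW q h (k ^ 2) = 0 := by rwa [complex_sq_sqrt]
    obtain ⟨τ, b, hτ, hb, hE⟩ := heq k hkK hkim.le h0'
    have hkre := hRr (z n) hkRr h0
    have hkre' := Complex.abs_re_le_norm k
    have hkre0 := complex_sqrt_re_nonneg (z n)
    rw [← hk] at hkre hkre0
    rw [abs_of_nonneg hkre0] at hkre'
    have hexp := (hRb k hkRb h0').1
    rw [abs_of_pos hkim] at hexp
    -- `Im k = O(n^{1/4})`
    have hyA : k.im ≤ Y * (n * A n) := by
      refine im_le_of_exp_le (by positivity) hn1 (hexp.trans ?_)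
      calc M * ‖k‖ ^ 2 ≤ M * (8 * n) ^ 2 := by gcongr
        _ = _ := by ring
    have hA0 : 0 ≤ A n := Real.rpow_nonneg hn0.le _
    have hinvA : 1 / (n : ℝ) ≤ A n := by
      rw [hAdef, one_div, ← Real.rpow_neg_one]
      exact Real.rpow_le_rpow_of_exponent_le hn1 (by norm_num)
    have hnA : 1 ≤ n * A n := by
      rw [div_le_iff₀ hn0] at hinvA
      linarith
    set μ := logCurve c s n with hμ
    set Λ := Complex.exp (-2 * Complex.I * μ) with hΛ
    have hΛ0 : Λ ≠ 0 := Complex.exp_ne_zero _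
    have hΛe : Λ = -(8 * omega q / deriv01 q 1) * (n * Real.pi) ^ 2 := by
      rw [hΛ, hμ, exp_logCurve c s (by exact_mod_cast hn0.ne'), hcs]
      push_cast
      ring
    have hΛn : ‖Λ‖ = W * (n : ℝ) ^ 2 := by
      rw [hΛe, hW]
      simp [abs_of_pos Real.pi_pos]
      ring
    set v := Complex.exp (Complex.I * (-2 * (k - μ))) with hv
    have hvE : v = Complex.exp (-2 * Complex.I * k) / Λ := by
      rw [hv, hΛ, ← Complex.exp_sub]; congr 1; ring
    have hvτ : (v - 1) * (1 - τ) = ((k / (n * Real.pi)) ^ 2 - 1) + b / Λ + τ := by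
      have h1 : v * (1 - τ) = (k / (n * Real.pi)) ^ 2 + b / Λ := by
        rw [hvE, div_mul_eq_mul_div, hE, add_div]
        congr 1
        rw [hΛe]
        have hnc : (n : ℂ) ≠ 0 := by exact_mod_cast hn0.ne'
        have hpc : (Real.pi : ℂ) ≠ 0 := by exact_mod_cast Real.pi_ne_zero
        field_simp
      linear_combination h1
    have hκ : ‖(k / (n * Real.pi)) ^ 2 - 1‖ ≤ 5 * (5 + Y) * A n := by
      have h1 : ‖k - n * Real.pi‖ ≤ 5 + Y * (n * A n) := by
        have e1 := Complex.norm_le_abs_re_add_abs_im (k - n * Real.pi)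
        have e2 : (k - n * Real.pi).re = k.re - n * Real.pi := by simp
        have e3 : (k - n * Real.pi).im = k.im := by simp
        rw [e2, e3, abs_of_pos hkim] at e1
        have e4 : |k.re - n * Real.pi| ≤ 5 := by
          rw [abs_le]
          constructor <;> linarith
        linarith
      have := norm_div_sq_sub_one_le (k := k) hn1 hk8 hnA (by simpa using h1)
      simpa using this
    have hbΛ : ‖b / Λ‖ ≤ C / W * A n := by
      rw [norm_div, hΛn]
      calc ‖b‖ / (W * (n : ℝ) ^ 2) ≤ C / (W * (n : ℝ)) := by
            gcongr
            nlinarith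
        _ = C / W * (1 / n) := by field_simp
        _ ≤ _ := by gcongr
    have hτ' : ‖τ‖ ≤ C * (‖reflTransform q k‖ + A n) := by
      refine hτ.trans ?_
      gcongr
      exact (one_div_le_one_div_of_le hn0 hkn).trans hinvA
    have hTk : ‖reflTransform q k‖ ≤ 1 / (4 * (C₁ + C)) := hsmall k hkR₁ hkim.le
    have hsum : (C₁ + C) * (A n + ‖reflTransform q k‖) ≤ 1 / 2 := by
      calc _ ≤ (C₁ + C) * (1 / (4 * (C₁ + C)) + 1 / (4 * (C₁ + C))) := by gcongr
        _ = _ := by field_simp; norm_num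
    have hTk0 := norm_nonneg (reflTransform q k)
    have hτ2 : ‖τ‖ ≤ 1 / 2 := by
      have : 0 ≤ C₁ * (A n + ‖reflTransform q k‖) := by positivity
      linarith
    have hv1 : ‖v - 1‖ ≤ C₁ * (A n + ‖reflTransform q k‖) :=
      norm_sub_one_le_of_mul_eq (by positivity) (by positivity) hTk0 hvτ hκ hbΛ hτ' hτ2
    have hre : |(-2 * (k - μ)).re| ≤ 3 / 2 * Real.pi := by
      have e1 : (-2 * (k - μ)).re = -2 * (k.re - Real.pi * (2 * n + s) / 2) := by
        rw [hμ, ← logCurve_re c s n]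
        simp
      rw [e1, abs_mul, abs_neg, abs_two]
      have e2 : |k.re - Real.pi * (2 * n + s) / 2| ≤ Real.pi / 2 + 1 / 2 := by
        rw [abs_le]
        constructor <;> linarith
      linarith
    refine norm_sub_le_of_norm_exp_le hC₁0 hre hv1 ?_ fun hkμ1 => ?_
    · have : 0 ≤ C * (A n + ‖reflTransform q k‖) := by positivity
      linarith
    · have hslow' : ‖reflTransform q k - reflTransform q μ‖ ≤ 1 / (2 * C₁) * ‖k - μ‖ :=
        hslow k μ (by linarith) hkim.le (by rw [hμ, logCurve_im]; linarith)
      have := norm_sub_norm_le (reflTransform q k) (reflTransform q μ)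
      linarith
  exact summable_sq_of_eventually_le (fun n => norm_nonneg _) hmain hArate
    (summable_fourierLaplace_log hq.memLp_reflect c s)

/-! ### Asymptotics of the square roots for `ω = 0` -/

/-- For `ω = 0` the square roots of large zeros stay in a horizontal strip and nearly solve
`cos 2k = -Q₂ / q'(1)`. -/
lemma exists_norm_cos_sub_le {q : ℝ → ℝ} (hq : MemW22 q) (hq1 : q 1 = 0) (ha : deriv01 q 1 ≠ 0)
    (h : ℝ) (hω : omega q = 0) :
    ∃ B C K : ℝ, 0 < B ∧ 0 < C ∧ 0 < K ∧ ∀ k : ℂ, K ≤ ‖k‖ → charW q h (k ^ 2) = 0 →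
      |k.im| ≤ B ∧ ‖Complex.cos (2 * k) - (-(Q₂ q h / deriv01 q 1) : ℝ)‖
        ≤ C * (1 / ‖k‖ + ‖cosTransform q k‖) := by
  obtain ⟨C, K, hC, hK, hb⟩ := exists_bound_charW_sub hq hq1 h
  obtain ⟨R, hR, hR'⟩ := exists_charW_eq hq hq1 ha h (show (0 : ℝ) < 1 / 8 by norm_num)
  have hac : (deriv01 q 1 : ℂ) ≠ 0 := by exact_mod_cast ha
  set A := |deriv01 q 1| with hA
  have hA0 : 0 < A := abs_pos.mpr ha
  have hAn : ‖(deriv01 q 1 : ℂ)‖ = A := by rw [Complex.norm_real, Real.norm_eq_abs]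
  set P := |constTerm q h| / A with hP
  have hP0 : 0 ≤ P := by positivity
  set B := 4 * P + 2 with hB
  have hB0 : 0 < B := by positivity
  refine ⟨B, (C * Real.exp (2 * B) + 1) / A, max K R, hB0, by positivity, lt_max_of_lt_left hK,
    fun k hk h0 => ?_⟩
  have hkK : K ≤ ‖k‖ := (le_max_left _ _).trans hk
  have hk0 : 0 < ‖k‖ := hK.trans_le hkK
  have him : |k.im| ≤ B := by
    obtain ⟨e, he, heq⟩ := hR' k ((le_max_right _ _).trans hk)
    rw [h0, mul_zero, eq_comm] at heq
    have h1 := (mul_eq_zero.mp heq).resolve_left hac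
    have h2 : ‖polyPart q h k‖ = P := by
      rw [polyPart, hω]
      simp [hP, hA]
    have h3 : ‖Complex.cos (2 * k)‖ ≤ P + 1 / 8 * Real.exp (2 * |k.im|) := by
      have e1 : Complex.cos (2 * k) = -(polyPart q h k + e) := by linear_combination h1
      rw [e1, norm_neg]
      exact (norm_add_le _ _).trans (add_le_add h2.le he)
    have h4 := le_norm_cos_two_mul k
    have h5 := Real.add_one_le_exp (2 * |k.im|)
    linarith [abs_nonneg k.im]
  refine ⟨him, ?_⟩
  have hbk := hb k hkK
  rw [integral_mul_cos_eq hq, h0, mul_zero, zero_sub, norm_neg, hω, constTerm_eq_Q₂ hq h hω] at hbk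
  have hexp : C * (Real.exp (2 * |k.im|) / ‖k‖) ≤ C * Real.exp (2 * B) * (1 / ‖k‖) := by
    rw [mul_assoc, mul_one_div]
    gcongr
  have e1 : Complex.cos (2 * k) - (-(Q₂ q h / deriv01 q 1) : ℝ)
      = ((4 * ((0 : ℝ) : ℂ) * k ^ 2 + deriv01 q 1 * Complex.cos (2 * k) + Q₂ q h
        - cosTransform q k) + cosTransform q k) / deriv01 q 1 := by
    push_cast
    field_simp
    ring
  rw [e1, norm_div, hAn, div_mul_eq_mul_div]
  gcongr
  refine (norm_add_le _ _).trans ((add_le_add_left (hbk.trans hexp) _).trans ?_)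
  have h1 : 0 ≤ 1 / ‖k‖ := by positivity
  have h2 : 0 ≤ C * Real.exp (2 * B) * ‖cosTransform q k‖ := by positivity
  linarith

lemma exists_norm_cosTransform_le {q : ℝ → ℝ} (hq : MemW22 q) (B : ℝ) {η : ℝ} (hη : 0 < η) :
    ∃ R : ℝ, ∀ k : ℂ, R ≤ ‖k‖ → |k.im| ≤ B → ‖cosTransform q k‖ ≤ η := by
  obtain ⟨R, hR, h⟩ := exists_norm_fourierLaplace_le_exp hq.intervalIntegrable_deriv
    (show 0 < η / Real.exp (2 * B) by positivity)
  refine ⟨R, fun k hk him => ?_⟩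
  have h1 : ‖fourierLaplace (secondDeriv q) k‖ ≤ _ := h k hk
  have h2 : ‖fourierLaplace (secondDeriv q) (-k)‖ ≤ _ := h (-k) (by rwa [norm_neg])
  rw [Complex.neg_im, abs_neg] at h2
  have h3 : η / Real.exp (2 * B) * Real.exp (2 * |k.im|) ≤ η := by
    calc _ ≤ η / Real.exp (2 * B) * Real.exp (2 * B) := by gcongr
      _ = η := by field_simp
  rw [cosTransform, norm_div, Complex.norm_ofNat]
  have := norm_add_le (fourierLaplace (secondDeriv q) k) (fourierLaplace (secondDeriv q) (-k))
  linarith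

lemma exists_norm_cosTransform_sub_le {q : ℝ → ℝ} (hq : MemW22 q) (B : ℝ) {η : ℝ} (hη : 0 < η) :
    ∃ R : ℝ, ∀ k l : ℂ, R + ‖k - l‖ ≤ ‖k‖ → |k.im| ≤ B → |l.im| ≤ B →
      ‖cosTransform q k - cosTransform q l‖ ≤ η * ‖k - l‖ := by
  obtain ⟨R, hR, h⟩ := exists_norm_fourierLaplace_sub_le_strip hq.intervalIntegrable_deriv B hη
  refine ⟨R, fun k l hkl hk hl => ?_⟩
  have e : ‖-k - -l‖ = ‖k - l‖ := by rw [← norm_neg]; congr 1; ring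
  have h1 : ‖fourierLaplace (secondDeriv q) k - fourierLaplace (secondDeriv q) l‖ ≤ _ := h k l hkl hk hl
  have h2 : ‖fourierLaplace (secondDeriv q) (-k) - fourierLaplace (secondDeriv q) (-l)‖ ≤ _ :=
    h (-k) (-l) (by rwa [e, norm_neg]) (by simpa) (by simpa)
  rw [e] at h2
  have e2 : cosTransform q k - cosTransform q l
      = ((fourierLaplace (secondDeriv q) k - fourierLaplace (secondDeriv q) l)
        + (fourierLaplace (secondDeriv q) (-k) - fourierLaplace (secondDeriv q) (-l))) / 2 := by
    simp only [cosTransform]; ring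
  rw [e2, norm_div, Complex.norm_ofNat]
  have := norm_add_le (fourierLaplace (secondDeriv q) k - fourierLaplace (secondDeriv q) l)
    (fourierLaplace (secondDeriv q) (-k) - fourierLaplace (secondDeriv q) (-l))
  linarith

/-- Bessel's inequality along a horizontal line. -/
lemma summable_cosTransform {q : ℝ → ℝ} (hq : MemW22 q) (s : ℂ) :
    Summable fun n : ℕ => ‖cosTransform q (n * Real.pi + s)‖ ^ 2 := by
  have hmem : ∀ s : ℂ, MemLp (fun t : ℝ => secondDeriv q t * Complex.exp (2 * Complex.I * s * t)) 2
      (volume.restrict (Ioc 0 1)) := by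
    intro s
    refine MemLp.of_le_mul (c := Real.exp (2 * |s.im|)) hq.memLp_secondDeriv
      (hq.memLp_secondDeriv.aestronglyMeasurable.mul
        (Continuous.aestronglyMeasurable (by fun_prop))) ?_
    filter_upwards [ae_restrict_mem measurableSet_Ioc] with t ht
    rw [norm_mul, norm_exp_two_I_mul, mul_comm]
    gcongr
    have h1 : |s.im| * t ≤ |s.im| := mul_le_of_le_one_right (abs_nonneg _) ht.2
    have h2 : -s.im * t ≤ |s.im| * t := by
      gcongr
      · exact ht.1.le
      · exact neg_le_abs _
    linarith
  have hsum : ∀ (s : ℂ) (ε : ℤ), ε ≠ 0 →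
      Summable fun n : ℕ => ‖fourierLaplace (secondDeriv q) (ε * n * Real.pi + s)‖ ^ 2 := by
    intro s ε hε
    have hinj : Function.Injective fun n : ℕ => (2 * ε * n : ℤ) := by
      intro m n hmn
      have h1 : (2 * ε : ℤ) ≠ 0 := by omega
      exact_mod_cast mul_left_cancel₀ h1 hmn
    refine ((summable_fourierLaplace_int (hmem s)).comp_injective hinj).congr fun n => ?_
    simp only [Function.comp]
    congr 2
    rw [fourierLaplace, fourierLaplace]
    refine intervalIntegral.integral_congr fun t _ => ?_
    simp only [mul_assoc]
    rw [← Complex.exp_add]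
    congr 2
    push_cast
    ring
  have hp : Summable fun n : ℕ => ‖fourierLaplace (secondDeriv q) (n * Real.pi + s)‖ ^ 2 := by
    simpa using hsum s 1 one_ne_zero
  have hm : Summable fun n : ℕ => ‖fourierLaplace (secondDeriv q) (-(n * Real.pi + s))‖ ^ 2 := by
    refine (hsum (-s) (-1) (by norm_num)).congr fun n => ?_
    congr 3
    push_cast
    ring
  refine summable_sq_of_eventually_le (C := 1 / 2) (fun n => norm_nonneg _)
    (Eventually.of_forall fun n => ?_) hp hm
  rw [cosTransform, norm_div, Complex.norm_ofNat]
  have := norm_add_le (fourierLaplace (secondDeriv q) (n * Real.pi + s))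
    (fourierLaplace (secondDeriv q) (-(n * Real.pi + s)))
  linarith

/-- The factorization of `cos 2k - cos 2s` in terms of `w = e^{2ik}`. -/
lemma exp_sub_mul_exp_sub (k s : ℂ) :
    (Complex.exp (2 * Complex.I * k) - Complex.exp (2 * Complex.I * s))
      * (Complex.exp (2 * Complex.I * k) - Complex.exp (-(2 * Complex.I * s)))
      = 2 * Complex.exp (2 * Complex.I * k) * (Complex.cos (2 * k) - Complex.cos (2 * s)) := by
  have h : ∀ z : ℂ, Complex.cos (2 * z)
      = (Complex.exp (2 * Complex.I * z) + (Complex.exp (2 * Complex.I * z))⁻¹) / 2 := by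
    intro z
    rw [Complex.cos, ← Complex.exp_neg]
    congr 3 <;> ring_nf
  have h1 := Complex.exp_ne_zero (2 * Complex.I * k)
  have h2 := Complex.exp_ne_zero (2 * Complex.I * s)
  rw [h k, h s, Complex.exp_neg]
  field_simp
  ring

/-- For `ω = 0` the numbers `e^{2ik}` belonging to large zeros approach `e^{±2is}`. -/
lemma exists_norm_mul_le {q : ℝ → ℝ} (hq : MemW22 q) (hq1 : q 1 = 0) (ha : deriv01 q 1 ≠ 0)
    (h : ℝ) (hω : omega q = 0) {s : ℂ}
    (hs : Complex.cos (2 * s) = (-(Q₂ q h / deriv01 q 1) : ℝ)) :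
    ∃ B C K : ℝ, 0 < B ∧ 0 < C ∧ 0 < K ∧ ∀ k : ℂ, K ≤ ‖k‖ → charW q h (k ^ 2) = 0 →
      |k.im| ≤ B ∧
      ‖Complex.exp (2 * Complex.I * k) - Complex.exp (2 * Complex.I * s)‖
        * ‖Complex.exp (2 * Complex.I * k) - Complex.exp (-(2 * Complex.I * s))‖
        ≤ C * (1 / ‖k‖ + ‖cosTransform q k‖) := by
  obtain ⟨B, C, K, hB, hC, hK, hk⟩ := exists_norm_cos_sub_le hq hq1 ha h hω
  refine ⟨B, 2 * Real.exp (2 * B) * C, K, hB, by positivity, hK, fun k hkK h0 => ?_⟩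
  obtain ⟨him, hcos⟩ := hk k hkK h0
  refine ⟨him, ?_⟩
  rw [← norm_mul, exp_sub_mul_exp_sub, hs, norm_mul, norm_mul, Complex.norm_ofNat, mul_assoc _ C]
  have h1 : ‖Complex.exp (2 * Complex.I * k)‖ ≤ Real.exp (2 * B) := by
    have := norm_exp_two_I_mul k 1
    rw [Complex.ofReal_one, mul_one, mul_one] at this
    rw [this]
    gcongr
    linarith [(abs_le.mp him).1]
  gcongr

lemma exists_norm_mul_le_const {q : ℝ → ℝ} (hq : MemW22 q) (hq1 : q 1 = 0)
    (ha : deriv01 q 1 ≠ 0) (h : ℝ) (hω : omega q = 0) {s : ℂ}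
    (hs : Complex.cos (2 * s) = (-(Q₂ q h / deriv01 q 1) : ℝ)) {ε : ℝ} (hε : 0 < ε) :
    ∃ K : ℝ, ∀ k : ℂ, K ≤ ‖k‖ → charW q h (k ^ 2) = 0 →
      ‖Complex.exp (2 * Complex.I * k) - Complex.exp (2 * Complex.I * s)‖
        * ‖Complex.exp (2 * Complex.I * k) - Complex.exp (-(2 * Complex.I * s))‖ ≤ ε := by
  obtain ⟨B, C, K, hB, hC, hK, hk⟩ := exists_norm_mul_le hq hq1 ha h hω hs
  obtain ⟨R, hR⟩ := exists_norm_cosTransform_le hq B (show 0 < ε / (2 * C) by positivity)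
  refine ⟨max K (max R (2 * C / ε)), fun k hkK h0 => ?_⟩
  have h1 : K ≤ ‖k‖ := (le_max_left _ _).trans hkK
  have h2 : R ≤ ‖k‖ := ((le_max_left _ _).trans (le_max_right _ _)).trans hkK
  have h3 : 2 * C / ε ≤ ‖k‖ := ((le_max_right _ _).trans (le_max_right _ _)).trans hkK
  obtain ⟨him, hle⟩ := hk k h1 h0
  have h4 : 1 / ‖k‖ ≤ ε / (2 * C) := by
    have := one_div_le_one_div_of_le (by positivity) h3
    rwa [one_div_div] at this
  calc _ ≤ _ := hle
    _ ≤ C * (ε / (2 * C) + ε / (2 * C)) := by gcongr; exact hR k h2 him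
    _ = ε := by field_simp; norm_num

/-- The square roots of zeros in consecutive annuli approach `nπ + s` at a square summable rate, if
`e^{2ik}` keeps away from the other solution `e^{-2is}` of the limit equation. -/
lemma summable_sqrt_sub_linear {q : ℝ → ℝ} (hq : MemW22 q) (hq1 : q 1 = 0)
    (ha : deriv01 q 1 ≠ 0) (h : ℝ) (hω : omega q = 0) {s : ℂ}
    (hs : Complex.cos (2 * s) = (-(Q₂ q h / deriv01 q 1) : ℝ)) {d : ℝ} (hd : 0 < d) {z : ℕ → ℂ}
    (hz : ∀ᶠ n : ℕ in atTop, charW q h (z n) = 0 ∧ n ≤ ‖Complex.sqrt (z n)‖ ∧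
      |(Complex.sqrt (z n) - (n * Real.pi + s)).re| ≤ 3 / 4 * Real.pi ∧
      d ≤ ‖Complex.exp (2 * Complex.I * Complex.sqrt (z n)) - Complex.exp (-(2 * Complex.I * s))‖) :
    Summable fun n : ℕ => ‖Complex.sqrt (z n) - (n * Real.pi + s)‖ ^ 2 := by
  obtain ⟨B, C, K, hB, hC, hK, hk⟩ := exists_norm_mul_le hq hq1 ha h hω hs
  set e₀ := ‖Complex.exp (2 * Complex.I * s)‖ with he₀
  have he₀pos : 0 < e₀ := norm_pos_iff.mpr (Complex.exp_ne_zero _)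
  set C₁ := C / (d * e₀) with hC₁
  have hC₁0 : 0 < C₁ := by positivity
  obtain ⟨R₁, hsmall⟩ := exists_norm_cosTransform_le hq B (show 0 < 1 / (4 * C₁) by positivity)
  obtain ⟨R₂, hslow⟩ := exists_norm_cosTransform_sub_le hq (max B |s.im|)
    (show 0 < 1 / (2 * C₁) by positivity)
  obtain ⟨N, hN⟩ := exists_nat_ge (max (max K R₁) (max (R₂ + 1) (4 * C₁)))
  refine summable_sq_of_eventually_le (A := fun n : ℕ => 1 / (n : ℝ))
    (B := fun n : ℕ => ‖cosTransform q (n * Real.pi + s)‖) (C := 2 * C₁) (fun n => norm_nonneg _)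
    ?_ (by simp) (summable_cosTransform hq s)
  filter_upwards [hz, eventually_ge_atTop (max 1 N)] with n hzn hnN
  obtain ⟨h0, hnk, hre, hdn⟩ := hzn
  have hn1 : (1 : ℝ) ≤ n := by exact_mod_cast (le_max_left _ _).trans hnN
  have hnN' : (N : ℝ) ≤ n := by exact_mod_cast (le_max_right _ _).trans hnN
  set k := Complex.sqrt (z n) with hkdef
  have hkN := (hN.trans hnN').trans hnk
  have hkK : K ≤ ‖k‖ := ((le_max_left _ _).trans (le_max_left _ _)).trans hkN
  have hkR₁ : R₁ ≤ ‖k‖ := ((le_max_right _ _).trans (le_max_left _ _)).trans hkN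
  have hkR₂ : R₂ + 1 ≤ ‖k‖ := ((le_max_left _ _).trans (le_max_right _ _)).trans hkN
  have hnC₁ : 4 * C₁ ≤ n := ((le_max_right _ _).trans (le_max_right _ _)).trans (hN.trans hnN')
  obtain ⟨him, hprod⟩ := hk k hkK (by rwa [complex_sq_sqrt])
  set μ : ℂ := n * Real.pi + s with hμ
  have hnk' : 1 / ‖k‖ ≤ 1 / n := one_div_le_one_div_of_le (by linarith) hnk
  have hv : ‖Complex.exp (Complex.I * (2 * (k - μ))) - 1‖
      ≤ C₁ * (1 / n + ‖cosTransform q k‖) := by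
    have e1 : Complex.exp (Complex.I * (2 * (k - μ)))
        = Complex.exp (2 * Complex.I * k) / Complex.exp (2 * Complex.I * s) := by
      have e2 : Complex.I * (2 * (k - μ))
          = 2 * Complex.I * k - 2 * Complex.I * s - (n : ℕ) * (2 * Real.pi * Complex.I) := by
        rw [hμ]; ring
      rw [e2, Complex.exp_sub, Complex.exp_nat_mul_two_pi_mul_I, div_one, Complex.exp_sub]
    rw [e1, div_sub_one (Complex.exp_ne_zero _), norm_div, ← he₀, hC₁, div_le_iff₀ he₀pos]
    have e3 : C / (d * e₀) * (1 / n + ‖cosTransform q k‖) * e₀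
        = C * (1 / n + ‖cosTransform q k‖) / d := by
      field_simp
    rw [e3, le_div_iff₀ hd]
    calc _ ≤ _ := mul_le_mul_of_nonneg_left hdn (norm_nonneg _)
      _ ≤ _ := hprod
      _ ≤ _ := by gcongr
  have hkμ : ‖k - μ‖ = ‖-(k - μ)‖ := (norm_neg _).symm
  have e4 : Complex.I * (2 * (k - μ)) = Complex.I * (-2 * (-k - -μ)) := by ring
  have e5 : -k - -μ = -(k - μ) := by ring
  rw [e4] at hv
  have := norm_sub_le_of_norm_exp_le (k := -k) (μ := -μ)
    (t' := ‖cosTransform q μ‖) hC₁0 ?_ hv ?_ ?_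
  · rwa [e5, norm_neg] at this
  · have e6 : (-2 * (-k - -μ)).re = 2 * (k - μ).re := by
      rw [e5]; simp; ring
    rw [e6, abs_mul, abs_two]
    linarith
  · have h1 : 1 / (n : ℝ) ≤ 1 / (4 * C₁) := one_div_le_one_div_of_le (by positivity) hnC₁
    calc _ ≤ C₁ * (1 / (4 * C₁) + 1 / (4 * C₁)) := by gcongr; exact hsmall k hkR₁ him
      _ ≤ 1 / 2 := le_of_eq (by field_simp; norm_num)
  · intro h1
    rw [e5, norm_neg] at h1 ⊢
    have hμim : μ.im = s.im := by
      have : μ = ((n * Real.pi : ℝ) : ℂ) + s := by rw [hμ]; push_cast; ring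
      rw [this, Complex.add_im, Complex.ofReal_im, zero_add]
    have h2 := hslow k μ (by linarith) (him.trans (le_max_left _ _))
      (by rw [hμim]; exact le_max_right _ _)
    have h3 := norm_sub_norm_le (cosTransform q k) (cosTransform q μ)
    linarith

/-! ### Enumerating the zeros -/

lemma analyticOrderNatAt_conj {f : ℂ → ℂ} (hf : Differentiable ℂ f) {w : ℂ} (hw : f w ≠ 0)
    (hconj : ∀ z, f ((starRingEnd ℂ) z) = (starRingEnd ℂ) (f z)) (a : ℂ) :
    analyticOrderNatAt f ((starRingEnd ℂ) a) = analyticOrderNatAt f a := by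
  obtain ⟨g, hg, hfg, hga⟩ := exists_entire_factor hf a (analyticOrderNatAt f a)
    (Nat.cast_analyticOrderNatAt (analyticOrderAt_ne_top_of_entire hf hw a)).symm
  have hg' : Differentiable ℂ ((starRingEnd ℂ) ∘ g ∘ (starRingEnd ℂ)) := fun z =>
    by simpa only [Complex.conj_conj] using (hg ((starRingEnd ℂ) z)).conj_conj
  have h : analyticOrderAt f ((starRingEnd ℂ) a) = (analyticOrderNatAt f a : ℕ) := by
    rw [(hf.analyticAt _).analyticOrderAt_eq_natCast]
    refine ⟨_, hg'.analyticAt _, by simpa using hga, Eventually.of_forall fun z => ?_⟩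
    have h1 := hconj ((starRingEnd ℂ) z)
    rw [Complex.conj_conj] at h1
    rw [h1, hfg]
    simp
  rw [analyticOrderNatAt, h]
  rfl

/-- `T` is the multiset of zeros of `f` in the open disk of radius `R` about the origin, each zero
being repeated according to its order. -/
def IsZeroMultiset (f : ℂ → ℂ) (R : ℝ) (T : Multiset ℂ) : Prop :=
  ∀ z, T.count z = if ‖z‖ < R then analyticOrderNatAt f z else 0

/-- The zeros in an annulus. -/
lemma IsZeroMultiset.exists_add {f : ℂ → ℂ} {R R' : ℝ} {T T' : Multiset ℂ}
    (hT : IsZeroMultiset f R T) (hT' : IsZeroMultiset f R' T') (hR : R ≤ R') :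
    ∃ D : Multiset ℂ, T' = T + D ∧
      ∀ z, D.count z = if R ≤ ‖z‖ ∧ ‖z‖ < R' then analyticOrderNatAt f z else 0 := by
  have hle : T ≤ T' := by
    rw [Multiset.le_iff_count]
    intro z
    rw [hT, hT']
    split_ifs with h1 h2
    · exact le_rfl
    · exact absurd (h1.trans_le hR) h2
    · exact Nat.zero_le _
    · exact le_rfl
  obtain ⟨D, rfl⟩ := Multiset.le_iff_exists_add.mp hle
  refine ⟨D, rfl, fun z => ?_⟩
  have h := hT' z
  rw [Multiset.count_add, hT z] at h
  by_cases h1 : ‖z‖ < R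
  · rw [if_pos h1, if_pos (h1.trans_le hR)] at h
    rw [if_neg fun h2 => absurd h2.1 (not_le.mpr h1)]
    omega
  · rw [if_neg h1] at h
    simp only [not_lt.mp h1, true_and]
    omega

/-- The unique zero in an annulus. -/
lemma IsZeroMultiset.exists_singleton {f : ℂ → ℂ} {R R' : ℝ} {T T' : Multiset ℂ}
    (hT : IsZeroMultiset f R T) (hT' : IsZeroMultiset f R' T') (hR : R ≤ R')
    (hcard : Multiset.card T' = Multiset.card T + 1) :
    ∃ e : ℂ, f e = 0 ∧ R ≤ ‖e‖ ∧ ‖e‖ < R' ∧ T' = T + {e} := by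
  obtain ⟨D, rfl, hD⟩ := hT.exists_add hT' hR
  rw [Multiset.card_add, add_left_cancel_iff] at hcard
  obtain ⟨e, rfl⟩ := Multiset.card_eq_one.mp hcard
  have h := hD e
  rw [Multiset.count_singleton_self] at h
  split_ifs at h with h1
  exact ⟨e, apply_eq_zero_of_analyticOrderNatAt_ne_zero (by omega), h1.1, h1.2, rfl⟩

/-- If an annulus contains two zeros and no real ones, they are complex conjugates. -/
lemma IsZeroMultiset.exists_conj_pair {f : ℂ → ℂ} {R R' : ℝ} {T T' : Multiset ℂ}
    (hconj : ∀ z, analyticOrderNatAt f ((starRingEnd ℂ) z) = analyticOrderNatAt f z)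
    (hT : IsZeroMultiset f R T) (hT' : IsZeroMultiset f R' T') (hR : R ≤ R')
    (hcard : Multiset.card T' = Multiset.card T + 2)
    (him : ∀ z, f z = 0 → R ≤ ‖z‖ → z.im ≠ 0) :
    ∃ e : ℂ, f e = 0 ∧ 0 < e.im ∧ R ≤ ‖e‖ ∧ ‖e‖ < R' ∧ T' = T + ({e} + {(starRingEnd ℂ) e}) := by
  obtain ⟨D, rfl, hD⟩ := hT.exists_add hT' hR
  rw [Multiset.card_add, add_left_cancel_iff] at hcard
  obtain ⟨x, y, rfl⟩ := Multiset.card_eq_two.mp hcard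
  have hDc : ∀ z, Multiset.count ((starRingEnd ℂ) z) {x, y} = Multiset.count z {x, y} := fun z => by
    rw [hD, hD, hconj, Complex.norm_conj]
  have hmem : ∀ z ∈ ({x, y} : Multiset ℂ), f z = 0 ∧ R ≤ ‖z‖ ∧ ‖z‖ < R' := by
    intro z hz
    have h := hD z
    have h1 := Multiset.one_le_count_iff_mem.mpr hz
    split_ifs at h with h2
    · exact ⟨apply_eq_zero_of_analyticOrderNatAt_ne_zero (by omega), h2.1, h2.2⟩
    · omega
  have hx := hmem x (by simp)
  have hxim := him x hx.1 hx.2.1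
  have hcx : (starRingEnd ℂ) x ∈ ({x, y} : Multiset ℂ) := by
    rw [← Multiset.one_le_count_iff_mem, hDc, Multiset.one_le_count_iff_mem]
    simp
  have hy : y = (starRingEnd ℂ) x := by
    simp only [Multiset.insert_eq_cons, Multiset.mem_cons, Multiset.mem_singleton] at hcx
    rcases hcx with h | h
    · exact absurd (Complex.conj_eq_iff_im.mp h) hxim
    · exact h.symm
  subst hy
  rcases lt_or_gt_of_ne hxim with h | h
  · refine ⟨(starRingEnd ℂ) x, (hmem _ hcx).1, by simpa using h, (hmem _ hcx).2.1,
      (hmem _ hcx).2.2, ?_⟩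
    rw [Complex.conj_conj, add_comm {(starRingEnd ℂ) x}]
    rfl
  · exact ⟨x, hx.1, h, hx.2.1, hx.2.2, rfl⟩

/-- Removing a conjugate pair from a conjugation invariant multiset. -/
lemma exists_cons_cons_of_im_ne_zero {T : Multiset ℂ}
    (hT : ∀ z, T.count ((starRingEnd ℂ) z) = T.count z) {x : ℂ} (hx : x ∈ T) (him : x.im ≠ 0) :
    ∃ S : Multiset ℂ, T = x ::ₘ (starRingEnd ℂ) x ::ₘ S ∧
      ∀ z, S.count ((starRingEnd ℂ) z) = S.count z := by
  have hne : (starRingEnd ℂ) x ≠ x := fun h => him (Complex.conj_eq_iff_im.mp h)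
  obtain ⟨S, rfl⟩ := Multiset.exists_cons_of_mem hx
  have hcx : (starRingEnd ℂ) x ∈ S := by
    have : (starRingEnd ℂ) x ∈ x ::ₘ S := by
      rw [← Multiset.one_le_count_iff_mem, hT, Multiset.one_le_count_iff_mem]
      simp
    exact (Multiset.mem_cons.mp this).resolve_left hne
  obtain ⟨S, rfl⟩ := Multiset.exists_cons_of_mem hcx
  refine ⟨S, rfl, fun z => ?_⟩
  have h := hT z
  have e1 : (starRingEnd ℂ) z = x ↔ z = (starRingEnd ℂ) x := by
    constructor <;> rintro rfl <;> simp
  have e2 : (starRingEnd ℂ) z = (starRingEnd ℂ) x ↔ z = x :=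
    (starRingEnd ℂ).injective.eq_iff
  simp only [Multiset.count_cons, e1, e2] at h
  omega

lemma count_conj_erase_of_im_eq_zero {T : Multiset ℂ} {x : ℂ}
    (hT : ∀ z, (x ::ₘ T).count ((starRingEnd ℂ) z) = (x ::ₘ T).count z) (him : x.im = 0) (z : ℂ) :
    T.count ((starRingEnd ℂ) z) = T.count z := by
  have h := hT z
  have hx : (starRingEnd ℂ) x = x := Complex.conj_eq_iff_im.mpr him
  have e1 : (starRingEnd ℂ) z = x ↔ z = x := by
    conv_lhs => rw [← hx]
    exact (starRingEnd ℂ).injective.eq_iff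
  simp only [Multiset.count_cons, e1] at h
  omega

/-- A conjugation invariant multiset of even cardinality splits into pairs which are complex
conjugate or real. -/
lemma exists_pairs {m : ℕ} {T : Multiset ℂ} (hT : ∀ z, T.count ((starRingEnd ℂ) z) = T.count z)
    (hcard : Multiset.card T = 2 * m) :
    ∃ a b : ℕ → ℂ, (∀ i, b i = (starRingEnd ℂ) (a i) ∨ ((a i).im = 0 ∧ (b i).im = 0)) ∧
      T = ∑ i ∈ Finset.range m, ({a i} + {b i}) := by
  induction m generalizing T with
  | zero =>
    refine ⟨fun _ => 0, fun _ => 0, fun _ => by simp, ?_⟩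
    simpa using hcard
  | succ m ih =>
    obtain ⟨x, y, S, rfl, hxy, hS⟩ : ∃ x y : ℂ, ∃ S : Multiset ℂ, T = x ::ₘ y ::ₘ S ∧
        (y = (starRingEnd ℂ) x ∨ (x.im = 0 ∧ y.im = 0)) ∧
        ∀ z, S.count ((starRingEnd ℂ) z) = S.count z := by
      by_cases hreal : ∃ x ∈ T, x.im ≠ 0
      · obtain ⟨x, hx, him⟩ := hreal
        obtain ⟨S, h1, h2⟩ := exists_cons_cons_of_im_ne_zero hT hx him
        exact ⟨x, _, S, h1, Or.inl rfl, h2⟩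
      · push Not at hreal
        obtain ⟨x, T₁, rfl⟩ : ∃ x T₁, T = x ::ₘ T₁ := by
          obtain ⟨x, hx⟩ := Multiset.card_pos_iff_exists_mem.mp (show 0 < Multiset.card T by omega)
          exact ⟨x, Multiset.exists_cons_of_mem hx⟩
        rw [Multiset.card_cons] at hcard
        obtain ⟨y, S, rfl⟩ : ∃ y S, T₁ = y ::ₘ S := by
          obtain ⟨y, hy⟩ := Multiset.card_pos_iff_exists_mem.mp (show 0 < Multiset.card T₁ by omega)
          exact ⟨y, Multiset.exists_cons_of_mem hy⟩
        have hx := hreal x (by simp)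
        have hy := hreal y (by simp)
        exact ⟨x, y, S, rfl, Or.inr ⟨hx, hy⟩, fun z => count_conj_erase_of_im_eq_zero
          (count_conj_erase_of_im_eq_zero hT hx) hy z⟩
    obtain ⟨a, b, hab, hsum⟩ := ih hS (by simp at hcard; omega)
    refine ⟨fun i => if i = m then x else a i, fun i => if i = m then y else b i, fun i => ?_, ?_⟩
    · by_cases hi : i = m
      · simpa [hi] using hxy
      · simpa [hi] using hab i
    · have h1 : ∑ i ∈ Finset.range m, (({if i = m then x else a i} : Multiset ℂ)
          + {if i = m then y else b i}) = ∑ i ∈ Finset.range m, ({a i} + {b i}) :=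
        Finset.sum_congr rfl fun i hi => by
          have : i ≠ m := (Finset.mem_range.mp hi).ne
          simp [this]
      rw [Finset.sum_range_succ, h1, ← hsum]
      simp only [if_true]
      rw [← Multiset.singleton_add, ← Multiset.singleton_add, ← add_assoc, add_comm]

/-- Nonreal elements come in conjugate pairs, so an odd cardinality leaves a real one. -/
lemma exists_real_of_odd {m : ℕ} {T : Multiset ℂ}
    (hT : ∀ z, T.count ((starRingEnd ℂ) z) = T.count z) (hcard : Multiset.card T = 2 * m + 1) :
    ∃ x ∈ T, x.im = 0 := by
  induction m generalizing T with
  | zero =>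
    obtain ⟨x, rfl⟩ := Multiset.card_eq_one.mp hcard
    refine ⟨x, by simp, ?_⟩
    have h := hT x
    rw [Multiset.count_singleton_self, Multiset.count_singleton] at h
    split_ifs at h with h1
    exact Complex.conj_eq_iff_im.mp h1
  | succ m ih =>
    by_contra! hcon
    obtain ⟨x, hx⟩ := Multiset.card_pos_iff_exists_mem.mp (show 0 < Multiset.card T by omega)
    obtain ⟨S, rfl, hS⟩ := exists_cons_cons_of_im_ne_zero hT hx (hcon x hx)
    obtain ⟨y, hy, hyim⟩ := ih hS (by simp at hcard; omega)
    exact hcon y (by simp [hy]) hyim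

lemma exists_pairs_of_odd {m : ℕ} {T : Multiset ℂ}
    (hT : ∀ z, T.count ((starRingEnd ℂ) z) = T.count z) (hcard : Multiset.card T = 2 * m + 1) :
    ∃ (x : ℂ) (a b : ℕ → ℂ), (∀ i, b i = (starRingEnd ℂ) (a i) ∨ ((a i).im = 0 ∧ (b i).im = 0)) ∧
      T = {x} + ∑ i ∈ Finset.range m, ({a i} + {b i}) := by
  obtain ⟨x, hx, him⟩ := exists_real_of_odd hT hcard
  obtain ⟨S, rfl⟩ := Multiset.exists_cons_of_mem hx
  obtain ⟨a, b, hab, hS⟩ := exists_pairs (m := m) (count_conj_erase_of_im_eq_zero hT him)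
    (by simpa using hcard)
  exact ⟨x, a, b, hab, by rw [← hS, Multiset.singleton_add]⟩

/-- Joining an initial segment of pairs, indexed from `1`, with a tail. -/
lemma sum_pairs_join {n₀ : ℕ} (hn₀ : 1 ≤ n₀) {T : ℕ → Multiset ℂ} {E : Multiset ℂ}
    {a b x y : ℕ → ℂ} (hinit : T n₀ = E + ∑ i ∈ Finset.range (n₀ - 1), ({a i} + {b i}))
    (htail : ∀ n, n₀ ≤ n → T (n + 1) = T n + ({x n} + {y n})) {n : ℕ} (hn : n₀ ≤ n) :
    T n = E + ∑ i ∈ Finset.Ico 1 n, (({if i < n₀ then a (i - 1) else x i} : Multiset ℂ)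
      + {if i < n₀ then b (i - 1) else y i}) := by
  induction n, hn using Nat.le_induction with
  | base =>
    rw [hinit, Finset.sum_Ico_eq_sum_range]
    congr 1
    refine Finset.sum_congr rfl fun i hi => ?_
    have : 1 + i < n₀ := by have := Finset.mem_range.mp hi; omega
    simp [this]
  | succ n hn ih =>
    rw [htail n hn, ih, Finset.sum_Ico_succ_top (by omega), add_assoc]
    simp [not_lt.mpr hn]

/-- A family enumerates the transmission eigenvalues if finite parts of it exhaust the zeros of the
characteristic function in growing disks. -/
lemma enumerates_of_exhaustion {q : ℝ → ℝ} (hq : ContinuousOn q (Icc 0 1)) {h : ℝ} {ι : Type}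
    {ev : ι → ℂ} {S : ℕ → Finset ι} (hS : Monotone S) (hSex : ∀ i, ∃ n, i ∈ S n) {R : ℕ → ℝ}
    (hR : Tendsto R atTop atTop) {w : ℂ} (hw : charW q h w ≠ 0) {n₀ : ℕ}
    (hcount : ∀ n, n₀ ≤ n → ∀ z, ((S n).filter fun i => ev i = z).card
      = if ‖z‖ < R n then analyticOrderNatAt (charW q h) z else 0) :
    Enumerates q h ev := by
  classical
  have hd := differentiable_charW hq h
  have hset : ∀ z, {i | ev i = z}.encard = (analyticOrderNatAt (charW q h) z : ℕ∞) := by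
    intro z
    obtain ⟨N, hN⟩ := (hR.eventually_gt_atTop ‖z‖).exists_forall_of_atTop
    have hcard : ∀ n, max n₀ N ≤ n → ((S n).filter fun i => ev i = z).card
        = analyticOrderNatAt (charW q h) z := fun n hn => by
      rw [hcount n ((le_max_left _ _).trans hn), if_pos (hN n ((le_max_right _ _).trans hn))]
    have hsub : {i | ev i = z} = (((S (max n₀ N)).filter fun i => ev i = z : Finset ι) : Set ι) := by
      ext i
      simp only [mem_ofPred_eq, Finset.coe_filter]
      refine ⟨fun hi => ?_, fun hi => hi.2⟩
      obtain ⟨m, hm⟩ := hSex i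
      set M := max (max n₀ N) m with hM
      have h1 : (S (max n₀ N)).filter (fun i => ev i = z) ⊆ (S M).filter fun i => ev i = z :=
        Finset.filter_subset_filter _ (hS (le_max_left _ _))
      have h2 := Finset.eq_of_subset_of_card_le h1
        (by rw [hcard _ (le_max_left _ _), hcard _ le_rfl])
      have h3 : i ∈ (S M).filter fun i => ev i = z :=
        Finset.mem_filter.mpr ⟨hS (le_max_right _ _) hm, hi⟩
      rw [← h2] at h3
      exact Finset.mem_filter.mp h3
    rw [hsub, Set.encard_coe_eq_coe_finsetCard, hcard _ le_rfl]
  have hord : ∀ z, (analyticOrderNatAt (charW q h) z : ℕ∞) = analyticOrderAt (charW q h) z :=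
    fun z => Nat.cast_analyticOrderNatAt (analyticOrderAt_ne_top_of_entire hd hw z)
  refine ⟨?_, fun z => ?_⟩
  · ext z
    rw [mem_ofPred_eq, isTransmissionEigenvalue_iff hq]
    have h1 : z ∈ range ev ↔ {i | ev i = z}.encard ≠ 0 := by
      rw [Set.encard_ne_zero]
      rfl
    rw [h1, hset, hord, (hd.analyticAt z).analyticOrderAt_ne_zero]
  · rw [multiplicity, charFun_eq hq, ← hord, hset]

/-- The positive integers below `n`. -/
def pnatBelow (n : ℕ) : Finset ℕ+ := Finset.subtype (fun m => 0 < m) (Finset.Ico 1 n)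

lemma mem_pnatBelow {n : ℕ} {m : ℕ+} : m ∈ pnatBelow n ↔ (m : ℕ) < n := by
  have : m ∈ pnatBelow n ↔ (m : ℕ) ∈ Finset.Ico 1 n := Finset.mem_subtype
  rw [this, Finset.mem_Ico]
  exact and_iff_right m.pos

lemma monotone_pnatBelow : Monotone pnatBelow := fun _ _ hmn _ hi =>
  mem_pnatBelow.mpr ((mem_pnatBelow.mp hi).trans_le hmn)

lemma sum_pnatBelow {M : Type} [AddCommMonoid M] (f : ℕ → M) (n : ℕ) :
    ∑ m ∈ pnatBelow n, f m = ∑ i ∈ Finset.Ico 1 n, f i :=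
  Finset.sum_subtype_of_mem f fun _ hi => (Finset.mem_Ico.mp hi).1

lemma exists_charW_ne_zero {q : ℝ → ℝ} {h R : ℝ} {T : Multiset ℂ}
    (hT : IsZeroMultiset (charW q h) R T) {x : ℂ} (hx : x ∈ T) : ∃ w, charW q h w ≠ 0 := by
  by_contra! hcon
  have h0 : charW q h = fun _ => 0 := funext hcon
  have h1 := hT x
  have h2 : analyticOrderNatAt (charW q h) x = 0 := by
    have : analyticOrderAt (charW q h) x = ⊤ := by
      rw [analyticOrderAt_eq_top, h0]
      exact Eventually.of_forall fun _ => rfl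
    rw [analyticOrderNatAt, this]
    rfl
  have h3 := Multiset.one_le_count_iff_mem.mpr hx
  rw [h1, h2] at h3
  simp at h3

lemma enumerates_pairs {q : ℝ → ℝ} (hq : ContinuousOn q (Icc 0 1)) {h : ℝ} {R : ℕ → ℝ}
    (hR : Tendsto R atTop atTop) {n₀ : ℕ} {T : ℕ → Multiset ℂ}
    (hT : ∀ n, n₀ ≤ n → IsZeroMultiset (charW q h) (R n) (T n)) {x y : ℕ → ℂ}
    (hsum : ∀ n, n₀ ≤ n → T n = 0 + ∑ i ∈ Finset.Ico 1 n, ({x i} + {y i})) :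
    Enumerates q h (Sum.elim (fun n : ℕ+ => x n) (fun n : ℕ+ => y n)) := by
  classical
  obtain ⟨w, hw⟩ : ∃ w, charW q h w ≠ 0 := by
    refine exists_charW_ne_zero (x := x 1) (hT (max 2 n₀) (le_max_right _ _)) ?_
    rw [hsum _ (le_max_right _ _), zero_add, Multiset.mem_sum]
    exact ⟨1, by simp, by simp⟩
  refine enumerates_of_exhaustion hq (S := fun n => (pnatBelow n).disjSum (pnatBelow n))
    (fun m n hmn => Finset.disjSum_mono (monotone_pnatBelow hmn) (monotone_pnatBelow hmn))
    ?_ hR hw (n₀ := n₀) fun n hn z => ?_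
  · rintro (m | m)
    · exact ⟨m + 1, by simp [mem_pnatBelow]⟩
    · exact ⟨m + 1, by simp [mem_pnatBelow]⟩
  · rw [← hT n hn z, hsum n hn, Finset.card_filter, Finset.sum_disjSum, zero_add,
      Multiset.count_sum']
    simp only [Multiset.count_add, Multiset.count_singleton, Sum.elim_inl, Sum.elim_inr,
      Finset.sum_add_distrib, eq_comm (a := z)]
    exact congrArg₂ (· + ·) (sum_pnatBelow (fun i => if x i = z then 1 else 0) n)
      (sum_pnatBelow (fun i => if y i = z then 1 else 0) n)

lemma enumerates_cons_pairs {q : ℝ → ℝ} (hq : ContinuousOn q (Icc 0 1)) {h : ℝ} {R : ℕ → ℝ}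
    (hR : Tendsto R atTop atTop) {n₀ : ℕ} {T : ℕ → Multiset ℂ}
    (hT : ∀ n, n₀ ≤ n → IsZeroMultiset (charW q h) (R n) (T n)) {x₀ : ℂ} {x y : ℕ → ℂ}
    (hsum : ∀ n, n₀ ≤ n → T n = {x₀} + ∑ i ∈ Finset.Ico 1 n, ({x i} + {y i})) :
    Enumerates q h (Sum.elim (fun _ : Unit => x₀)
      (Sum.elim (fun n : ℕ+ => x n) (fun n : ℕ+ => y n))) := by
  classical
  obtain ⟨w, hw⟩ : ∃ w, charW q h w ≠ 0 :=
    exists_charW_ne_zero (x := x₀) (hT n₀ le_rfl) (by rw [hsum _ le_rfl]; simp)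
  refine enumerates_of_exhaustion hq
    (S := fun n => (Finset.univ : Finset Unit).disjSum ((pnatBelow n).disjSum (pnatBelow n)))
    (fun m n hmn => Finset.disjSum_mono subset_rfl
      (Finset.disjSum_mono (monotone_pnatBelow hmn) (monotone_pnatBelow hmn)))
    ?_ hR hw (n₀ := n₀) fun n hn z => ?_
  · rintro (m | m | m)
    · exact ⟨0, by simp⟩
    · exact ⟨m + 1, by simp [mem_pnatBelow]⟩
    · exact ⟨m + 1, by simp [mem_pnatBelow]⟩
  · rw [← hT n hn z, hsum n hn, Finset.card_filter, Finset.sum_disjSum, Finset.sum_disjSum,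
      Multiset.count_add, Multiset.count_sum']
    simp only [Multiset.count_add, Multiset.count_singleton, Sum.elim_inl, Sum.elim_inr,
      Finset.sum_add_distrib, eq_comm (a := z), Finset.univ_unique, Finset.sum_singleton]
    exact congrArg₂ (· + ·) rfl (congrArg₂ (· + ·) (sum_pnatBelow (fun i => if x i = z then 1 else 0) n)
      (sum_pnatBelow (fun i => if y i = z then 1 else 0) n))

/-! ### Conjugate pairs of eigenvalues -/

/-- The radius `((n + (s-1)/2) π)²` of the disk with `2 (n - 1) + s` zeros. -/
def diskRadius (s n : ℕ) : ℝ := ((n + (s : ℝ) / 2 - 1 / 2) * Real.pi) ^ 2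

lemma diskRadius_nonneg_base {s n : ℕ} (hn : 1 ≤ n) :
    0 ≤ ((n : ℝ) + (s : ℝ) / 2 - 1 / 2) * Real.pi := by
  have h1 : (1 : ℝ) ≤ n := by exact_mod_cast hn
  have h2 : (0 : ℝ) ≤ s := Nat.cast_nonneg s
  have h3 : 0 ≤ (n : ℝ) + (s : ℝ) / 2 - 1 / 2 := by linarith
  exact mul_nonneg h3 Real.pi_pos.le

lemma diskRadius_le_succ {s n : ℕ} (hn : 1 ≤ n) : diskRadius s n ≤ diskRadius s (n + 1) := by
  unfold diskRadius
  refine pow_le_pow_left₀ (diskRadius_nonneg_base hn) ?_ 2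
  push_cast
  gcongr
  linarith

lemma tendsto_diskRadius (s : ℕ) : Tendsto (diskRadius s) atTop atTop := by
  refine tendsto_atTop_mono' atTop ?_ (tendsto_natCast_atTop_atTop (R := ℝ))
  filter_upwards [eventually_ge_atTop 1] with n hn
  have h1 : (1 : ℝ) ≤ n := by exact_mod_cast hn
  have h2 : (0 : ℝ) ≤ s := Nat.cast_nonneg s
  have h3 : (n : ℝ) / 2 * 3 ≤ ((n : ℝ) + (s : ℝ) / 2 - 1 / 2) * Real.pi := by
    have := Real.pi_gt_three
    gcongr <;> linarith
  have h4 : ((n : ℝ) / 2 * 3) ^ 2 ≤ diskRadius s n := pow_le_pow_left₀ (by positivity) h3 2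
  nlinarith

lemma sqrt_bounds_of_diskRadius {s n : ℕ} (hn : 1 ≤ n) {z : ℂ} (h1 : diskRadius s n ≤ ‖z‖)
    (h2 : ‖z‖ < diskRadius s (n + 1)) :
    (n + (s : ℝ) / 2 - 1 / 2) * Real.pi ≤ ‖Complex.sqrt z‖ ∧
      ‖Complex.sqrt z‖ ≤ (n + (s : ℝ) / 2 + 1 / 2) * Real.pi := by
  rw [← norm_complex_sqrt_sq] at h1 h2
  unfold diskRadius at h1 h2
  refine ⟨(pow_le_pow_iff_left₀ (diskRadius_nonneg_base hn) (norm_nonneg _) two_ne_zero).mp h1, ?_⟩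
  have h3 := (pow_lt_pow_iff_left₀ (norm_nonneg _)
    (diskRadius_nonneg_base (s := s) (n := n + 1) (by omega)) two_ne_zero).mp h2
  refine h3.le.trans (le_of_eq ?_)
  push_cast
  ring

/-- The zero multisets of the disks of one parity. -/
lemma exists_zeroMultisets {q : ℝ → ℝ} (hq : MemW22 q) (hq1 : q 1 = 0) (ha : deriv01 q 1 ≠ 0)
    (h : ℝ) {s : ℕ} (hp : ∃ θ < 1, ∃ R : ℝ, ∀ k : ℂ, R ≤ ‖k‖ → |k.im| ≤ |k.re| / 2 →
      -(-(-1 : ℝ) ^ s) * (polyPart q h k).re ≤ θ) :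
    ∃ (n₀ : ℕ) (T : ℕ → Multiset ℂ), 1 ≤ n₀ ∧ ∀ n, n₀ ≤ n →
      IsZeroMultiset (charW q h) (diskRadius s n) (T n) ∧
      Multiset.card (T n) = 2 * (n - 1) + s := by
  obtain ⟨N, hN⟩ := exists_card_zeros hq hq1 ha h hp
  have key : ∀ n, N + 1 ≤ n → ∃ T : Multiset ℂ,
      IsZeroMultiset (charW q h) (diskRadius s n) T ∧ Multiset.card T = 2 * (n - 1) + s := by
    intro n hn
    obtain ⟨m, rfl⟩ : ∃ m, n = m + 1 := ⟨n - 1, by omega⟩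
    obtain ⟨T, hT, hcard⟩ := hN (2 * m + 1 + s) (by omega) (by
      rw [pow_add, pow_succ, pow_mul]; simp)
    refine ⟨T, fun z => ?_, by simp; omega⟩
    rw [hT z]
    have : (((2 * m + 1 + s : ℕ) : ℝ) * Real.pi / 2) ^ 2 = diskRadius s (m + 1) := by
      unfold diskRadius
      push_cast
      ring
    rw [this]
  choose! T hT using key
  exact ⟨N + 1, T, by omega, hT⟩

lemma analyticOrderNatAt_charW_conj {q : ℝ → ℝ} (hq : ContinuousOn q (Icc 0 1)) (h : ℝ) (z : ℂ) :
    analyticOrderNatAt (charW q h) ((starRingEnd ℂ) z) = analyticOrderNatAt (charW q h) z := by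
  by_cases hw : ∃ w, charW q h w ≠ 0
  · obtain ⟨w, hw⟩ := hw
    exact analyticOrderNatAt_conj (differentiable_charW hq h) hw (charW_conj hq h) z
  · push Not at hw
    have h0 : ∀ z, analyticOrderAt (charW q h) z = ⊤ := fun z =>
      analyticOrderAt_eq_top.mpr (Eventually.of_forall hw)
    simp only [analyticOrderNatAt, h0]

lemma IsZeroMultiset.count_conj {q : ℝ → ℝ} (hq : ContinuousOn q (Icc 0 1)) {h R : ℝ}
    {T : Multiset ℂ} (hT : IsZeroMultiset (charW q h) R T) (z : ℂ) :
    T.count ((starRingEnd ℂ) z) = T.count z := by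
  rw [hT, hT, analyticOrderNatAt_charW_conj hq, Complex.norm_conj]

/-- If large zeros are not real, the zeros of the far annuli form conjugate pairs. -/
lemma exists_conj_tail {q : ℝ → ℝ} (hq : MemW22 q) {h : ℝ} {s n₀ : ℕ} (hn₀ : 1 ≤ n₀)
    {T : ℕ → Multiset ℂ}
    (hT : ∀ n, n₀ ≤ n → IsZeroMultiset (charW q h) (diskRadius s n) (T n) ∧
      Multiset.card (T n) = 2 * (n - 1) + s)
    (him : ∃ R : ℝ, ∀ z : ℂ, R ≤ ‖Complex.sqrt z‖ → charW q h z = 0 → z.im ≠ 0) :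
    ∃ (n₁ : ℕ) (x : ℕ → ℂ), n₀ ≤ n₁ ∧ ∀ n, n₁ ≤ n →
      charW q h (x n) = 0 ∧ 0 < (x n).im ∧ diskRadius s n ≤ ‖x n‖ ∧
      ‖x n‖ < diskRadius s (n + 1) ∧ T (n + 1) = T n + ({x n} + {(starRingEnd ℂ) (x n)}) := by
  have hconj := analyticOrderNatAt_charW_conj hq.continuousOn h
  obtain ⟨R, hR⟩ := him
  obtain ⟨N, hN⟩ := ((tendsto_diskRadius s).eventually_ge_atTop (R ^ 2)).exists_forall_of_atTop
  have key : ∀ n, max n₀ N ≤ n → ∃ x : ℂ,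
      charW q h x = 0 ∧ 0 < x.im ∧ diskRadius s n ≤ ‖x‖ ∧
      ‖x‖ < diskRadius s (n + 1) ∧ T (n + 1) = T n + ({x} + {(starRingEnd ℂ) x}) := by
    intro n hn
    have hn1 : n₀ ≤ n := (le_max_left _ _).trans hn
    refine (hT n hn1).1.exists_conj_pair hconj (hT (n + 1) (by omega)).1
      (diskRadius_le_succ (hn₀.trans hn1)) ?_ fun z hz hnz => hR z ?_ hz
    · rw [(hT n hn1).2, (hT (n + 1) (by omega)).2]
      omega
    · have h1 := (hN n ((le_max_right _ _).trans hn)).trans hnz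
      rw [← norm_complex_sqrt_sq] at h1
      exact le_of_sq_le_sq h1 (norm_nonneg _)
  choose! x hx using key
  exact ⟨max n₀ N, x, le_max_left _ _, hx⟩

/-- `x` is an eigenvalue in the upper half-plane, `y` its conjugate, and both belong to the annulus
`diskRadius s n ≤ |z| ≤ diskRadius s (n + 1)`, expressed in terms of square roots. -/
def FarPair (q : ℝ → ℝ) (h : ℝ) (s n : ℕ) (x y : ℂ) : Prop :=
  y = (starRingEnd ℂ) x ∧ charW q h x = 0 ∧ 0 < x.im ∧
    (n + (s : ℝ) / 2 - 1 / 2) * Real.pi ≤ ‖Complex.sqrt x‖ ∧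
    ‖Complex.sqrt x‖ ≤ (n + (s : ℝ) / 2 + 1 / 2) * Real.pi

/-- An enumeration in pairs, if the disks of even parity contain the expected number of zeros and large
zeros are not real. -/
lemma exists_conj_enumeration {q : ℝ → ℝ} (hq : MemW22 q) (hq1 : q 1 = 0) (ha : deriv01 q 1 ≠ 0)
    (h : ℝ) (hp : ∃ θ < 1, ∃ R : ℝ, ∀ k : ℂ, R ≤ ‖k‖ → |k.im| ≤ |k.re| / 2 →
      -(-(-1 : ℝ) ^ 0) * (polyPart q h k).re ≤ θ)
    (him : ∃ R : ℝ, ∀ z : ℂ, R ≤ ‖Complex.sqrt z‖ → charW q h z = 0 → z.im ≠ 0) :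
    ∃ x y : ℕ → ℂ,
      Enumerates q h (Sum.elim (fun n : ℕ+ => x n) (fun n : ℕ+ => y n)) ∧
      (∀ n, y n = (starRingEnd ℂ) (x n) ∨ ((x n).im = 0 ∧ (y n).im = 0)) ∧
      ∀ᶠ n in atTop, FarPair q h 0 n (x n) (y n) := by
  obtain ⟨n₀, T, hn₀, hT⟩ := exists_zeroMultisets hq hq1 ha h hp
  obtain ⟨n₁, e, hn₁, he⟩ := exists_conj_tail hq hn₀ hT him
  obtain ⟨a, b, hab, hsum⟩ := exists_pairs (m := n₁ - 1) ((hT n₁ hn₁).1.count_conj hq.continuousOn)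
    (by rw [(hT n₁ hn₁).2]; omega)
  have hall := fun n hn => sum_pairs_join (hn₀.trans hn₁) (E := 0) (T := T) (n := n)
    (by rw [zero_add]; exact hsum) (fun n hn => (he n hn).2.2.2.2) hn
  refine ⟨fun i => if i < n₁ then a (i - 1) else e i,
    fun i => if i < n₁ then b (i - 1) else (starRingEnd ℂ) (e i),
    enumerates_pairs hq.continuousOn (tendsto_diskRadius 0)
      (fun n hn => (hT n (hn₁.trans hn)).1) hall, fun n => ?_, ?_⟩
  · by_cases hn : n < n₁
    · simpa [hn] using hab (n - 1)
    · simp [hn]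
  · filter_upwards [eventually_ge_atTop n₁] with n hn
    simp only [not_lt.mpr hn, if_false]
    obtain ⟨h1, h2, h3, h4, -⟩ := he n hn
    exact ⟨rfl, h1, h2, sqrt_bounds_of_diskRadius (hn₀.trans (hn₁.trans hn)) h3 h4⟩

/-- An enumeration in pairs with one additional real eigenvalue, if the disks of odd parity contain the
expected number of zeros and large zeros are not real. -/
lemma exists_conj_enumeration_cons {q : ℝ → ℝ} (hq : MemW22 q) (hq1 : q 1 = 0)
    (ha : deriv01 q 1 ≠ 0) (h : ℝ) (hp : ∃ θ < 1, ∃ R : ℝ, ∀ k : ℂ, R ≤ ‖k‖ →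
      |k.im| ≤ |k.re| / 2 → -(-(-1 : ℝ) ^ 1) * (polyPart q h k).re ≤ θ)
    (him : ∃ R : ℝ, ∀ z : ℂ, R ≤ ‖Complex.sqrt z‖ → charW q h z = 0 → z.im ≠ 0) :
    ∃ (x₀ : ℂ) (x y : ℕ → ℂ),
      Enumerates q h (Sum.elim (fun _ : Unit => x₀)
        (Sum.elim (fun n : ℕ+ => x n) (fun n : ℕ+ => y n))) ∧
      (∀ n, y n = (starRingEnd ℂ) (x n) ∨ ((x n).im = 0 ∧ (y n).im = 0)) ∧
      ∀ᶠ n in atTop, FarPair q h 1 n (x n) (y n) := by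
  obtain ⟨n₀, T, hn₀, hT⟩ := exists_zeroMultisets hq hq1 ha h hp
  obtain ⟨n₁, e, hn₁, he⟩ := exists_conj_tail hq hn₀ hT him
  obtain ⟨x₀, a, b, hab, hsum⟩ := exists_pairs_of_odd (m := n₁ - 1) ((hT n₁ hn₁).1.count_conj hq.continuousOn)
    (by rw [(hT n₁ hn₁).2])
  have hall := fun n hn => sum_pairs_join (hn₀.trans hn₁) (T := T) (n := n)
    hsum (fun n hn => (he n hn).2.2.2.2) hn
  refine ⟨x₀, fun i => if i < n₁ then a (i - 1) else e i,
    fun i => if i < n₁ then b (i - 1) else (starRingEnd ℂ) (e i),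
    enumerates_cons_pairs hq.continuousOn (tendsto_diskRadius 1)
      (fun n hn => (hT n (hn₁.trans hn)).1) hall, fun n => ?_, ?_⟩
  · by_cases hn : n < n₁
    · simpa [hn] using hab (n - 1)
    · simp [hn]
  · filter_upwards [eventually_ge_atTop n₁] with n hn
    simp only [not_lt.mpr hn, if_false]
    obtain ⟨h1, h2, h3, h4, -⟩ := he n hn
    exact ⟨rfl, h1, h2, sqrt_bounds_of_diskRadius (hn₀.trans (hn₁.trans hn)) h3 h4⟩

/-- Reordering the index set of an enumeration. -/
lemma Enumerates.comp_equiv {q : ℝ → ℝ} {h : ℝ} {ι κ : Type} {ev : ι → ℂ} (hev : Enumerates q h ev)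
    (e : κ ≃ ι) : Enumerates q h (ev ∘ e) := by
  refine ⟨by rw [e.surjective.range_comp, hev.1], fun z => ?_⟩
  rw [← hev.2 z]
  have : {i | (ev ∘ e) i = z} = e ⁻¹' {i | ev i = z} := rfl
  rw [this, ← Set.encard_preimage_of_bijective e.bijective]

lemma sqrtAsymp_of_summable {x a : ℕ → ℂ} (hx : Summable fun n => ‖Complex.sqrt (x n) - a n‖ ^ 2) :
    SqrtAsymp (fun n : ℕ+ => x n) (fun n : ℕ+ => a n) :=
  hx.comp_injective (i := fun n : ℕ+ => (n : ℕ)) PNat.coe_injective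

/-! ### The case `ω ≠ 0` -/

/-- For `ω ≠ 0` the sign of `ω / q'(1)` decides on which circles the count of zeros succeeds: there
`4ωk²/q'(1)` has the same sign as `cos 2k`. -/
lemma polyPart_re_le_of_omega_ne {q : ℝ → ℝ} (h : ℝ) {σ : ℝ} (hσ : |σ| = 1)
    (hω : 0 < σ * (omega q / deriv01 q 1)) :
    ∃ θ < 1, ∃ R : ℝ, ∀ k : ℂ, R ≤ ‖k‖ → |k.im| ≤ |k.re| / 2 →
      -σ * (polyPart q h k).re ≤ θ := by
  set w := σ * (omega q / deriv01 q 1) with hw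
  set Q := constTerm q h / deriv01 q 1 with hQ
  refine ⟨0, one_pos, |Q| / w + 1, fun k hk him => ?_⟩
  have hre : (polyPart q h k).re = 4 * (omega q / deriv01 q 1) * (k ^ 2).re + Q := by
    have : polyPart q h k = ((4 * (omega q / deriv01 q 1) : ℝ) : ℂ) * k ^ 2 + (Q : ℝ) := by
      rw [polyPart, hQ]
      push_cast
      ring
    rw [this, Complex.add_re, Complex.re_ofReal_mul, Complex.ofReal_re]
  have hk2 : 1 / 4 * ‖k‖ ^ 2 ≤ (k ^ 2).re := by
    have h1 := Complex.sq_norm k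
    rw [Complex.normSq_apply] at h1
    rw [h1, sq, Complex.mul_re]
    have h2 : |k.im| ^ 2 ≤ (|k.re| / 2) ^ 2 := pow_le_pow_left₀ (abs_nonneg _) him 2
    rw [sq_abs, div_pow, sq_abs] at h2
    nlinarith
  have hk1 : 1 ≤ ‖k‖ := le_trans (by have : 0 ≤ |Q| / w := by positivity
                                     linarith) hk
  have hQk : |Q| ≤ w * ‖k‖ := by
    have : |Q| / w ≤ ‖k‖ := by linarith
    rw [div_le_iff₀ hω] at this
    linarith
  have h3 : -σ * Q ≤ |Q| := by
    calc _ ≤ |-σ * Q| := le_abs_self _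
      _ = |Q| := by rw [abs_mul, abs_neg, hσ, one_mul]
  have h4 : w * ‖k‖ * 1 ≤ w * ‖k‖ * ‖k‖ := by gcongr
  have h5 : w * (1 / 4 * ‖k‖ ^ 2) ≤ w * (k ^ 2).re := by gcongr
  have h6 : -σ * (polyPart q h k).re = -4 * (w * (k ^ 2).re) + -σ * Q := by
    rw [hre, hw]; ring
  rw [h6]
  nlinarith

lemma mu₁_eq_logCurve_of_neg {r : ℝ} (hr : r < 0) (n : ℕ+) :
    mu₁ r n = logCurve (Real.log (2 * Real.pi) - 1 / 2 * Real.log (-(r / 2))) 0 n := by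
  have hn : (n : ℝ) ≠ 0 := by exact_mod_cast n.ne_zero
  have h1 : Real.log (2 * (n : ℝ) * Real.pi) = Real.log n + Real.log (2 * Real.pi) := by
    rw [← Real.log_mul hn (by have := Real.pi_pos; positivity)]
    congr 1
    ring
  rw [mu₁, if_pos hr, logCurve, h1]
  generalize Real.log (2 * Real.pi) = l
  generalize Real.log (-(r / 2)) = m
  generalize Real.log (n : ℝ) = j
  push_cast
  ring

lemma mu₁_eq_logCurve_of_pos {r : ℝ} (hr : 0 < r) (n : ℕ+) :
    mu₁ r n = logCurve (Real.log (2 * Real.pi) - 1 / 2 * Real.log (r / 2)) 1 n := by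
  have hn : (n : ℝ) ≠ 0 := by exact_mod_cast n.ne_zero
  have h1 : Real.log (2 * (n : ℝ) * Real.pi) = Real.log n + Real.log (2 * Real.pi) := by
    rw [← Real.log_mul hn (by have := Real.pi_pos; positivity)]
    congr 1
    ring
  rw [mu₁, if_neg (not_lt.mpr hr.le), logCurve, h1]
  generalize Real.log (2 * Real.pi) = l
  generalize Real.log (r / 2) = m
  generalize Real.log (n : ℝ) = j
  push_cast
  ring

/-- The constant of the logarithmic curve is adapted to the equation for `e^{-2ik}`. -/
lemma exp_two_mul_log_sub {r : ℝ} (hr : 0 < r) :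
    Real.exp (2 * (Real.log (2 * Real.pi) - 1 / 2 * Real.log (r / 2))) = 8 * Real.pi ^ 2 / r := by
  have hpi := Real.pi_pos
  have : 2 * (Real.log (2 * Real.pi) - 1 / 2 * Real.log (r / 2))
      = Real.log (2 * Real.pi) + Real.log (2 * Real.pi) - Real.log (r / 2) := by ring
  rw [this, Real.exp_sub, Real.exp_add, Real.exp_log (by positivity), Real.exp_log (by positivity)]
  field_simp
  ring

lemma FarPair.zero_bounds {q : ℝ → ℝ} {h : ℝ} {s : ℕ} {x y : ℕ → ℂ}
    (hxy : ∀ᶠ n in atTop, FarPair q h s n (x n) (y n)) :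
    ∀ᶠ n in atTop, charW q h (x n) = 0 ∧ 0 < (x n).im ∧
      (n + ((s : ℤ) : ℝ) / 2 - 1 / 2) * Real.pi ≤ ‖Complex.sqrt (x n)‖ ∧
      ‖Complex.sqrt (x n)‖ ≤ (n + ((s : ℤ) : ℝ) / 2 + 1 / 2) * Real.pi := by
  filter_upwards [hxy] with n hn
  simpa using hn.2

/-- For `q'(1)/ω < 0` the disks of radius `(n - 1/2)π` contain `2n - 2` square roots in the right
half-plane: no eigenvalue is left over, and the argument of `e^{-2ik}` tends to `0` along the large ones in the
upper half-plane, so that their real parts are close to `nπ`. -/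
theorem exists_enumeration_of_neg {q : ℝ → ℝ} (hq : MemW22 q) (hq1 : q 1 = 0)
    (ha : deriv01 q 1 ≠ 0) (h : ℝ) (hω : omega q ≠ 0) (hr : deriv01 q 1 / omega q < 0) :
    ∃ ev ev' : ℕ+ → ℂ, Enumerates q h (Sum.elim ev ev') ∧ ConjPaired ev ev' ∧
      SqrtAsymp ev (mu₁ (deriv01 q 1 / omega q)) := by
  have hr' : omega q / deriv01 q 1 < 0 := by
    rw [← inv_div]; exact inv_lt_zero.mpr hr
  obtain ⟨x, y, hen, hpair, hfar⟩ := exists_conj_enumeration hq hq1 ha h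
    (polyPart_re_le_of_omega_ne h (σ := -(-1 : ℝ) ^ 0) (by simp) (by simpa using hr'))
    (exists_zero_im_ne_zero hq hq1 ha h hω)
  refine ⟨_, _, hen, fun n => hpair n, ?_⟩
  have hsum := summable_sqrt_sub_logCurve hq hq1 ha h hω (s := ((0 : ℕ) : ℤ))
    (c := Real.log (2 * Real.pi) - 1 / 2 * Real.log (-(deriv01 q 1 / omega q) / 2))
    (by norm_num) (by norm_num) (by
      rw [exp_two_mul_log_sub (neg_pos.mpr hr)]
      simp only [Nat.cast_zero, zpow_zero, one_mul]
      field_simp) (FarPair.zero_bounds hfar)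
  have := sqrtAsymp_of_summable hsum
  refine this.congr fun n => ?_
  rw [mu₁_eq_logCurve_of_neg hr, neg_div]
  rfl

/-- For `q'(1)/ω > 0` the admissible radii are `nπ`, with an odd number `2n - 1` of zeros; the one
left over is `λ₀`, and the argument of `e^{-2ik}` tends to `π` modulo `2π`, whence the real parts
close to `(n + 1/2)π`. -/
theorem exists_enumeration_of_pos {q : ℝ → ℝ} (hq : MemW22 q) (hq1 : q 1 = 0)
    (ha : deriv01 q 1 ≠ 0) (h : ℝ) (hω : omega q ≠ 0) (hr : 0 < deriv01 q 1 / omega q) :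
    ∃ (ev₀ : ℂ) (ev ev' : ℕ+ → ℂ),
      Enumerates q h (Sum.elim (fun _ : Unit => ev₀) (Sum.elim ev ev')) ∧ ConjPaired ev ev' ∧
      SqrtAsymp ev (mu₁ (deriv01 q 1 / omega q)) := by
  have hr' : 0 < omega q / deriv01 q 1 := by
    rw [← inv_div]; exact inv_pos.mpr hr
  obtain ⟨x₀, x, y, hen, hpair, hfar⟩ := exists_conj_enumeration_cons hq hq1 ha h
    (polyPart_re_le_of_omega_ne h (σ := -(-1 : ℝ) ^ 1) (by simp) (by simpa using hr'))
    (exists_zero_im_ne_zero hq hq1 ha h hω)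
  refine ⟨x₀, _, _, hen, fun n => hpair n, ?_⟩
  have hsum := summable_sqrt_sub_logCurve hq hq1 ha h hω (s := ((1 : ℕ) : ℤ))
    (c := Real.log (2 * Real.pi) - 1 / 2 * Real.log (deriv01 q 1 / omega q / 2))
    (by norm_num) (by norm_num) (by
      rw [exp_two_mul_log_sub hr]
      simp only [Nat.cast_one, zpow_one]
      field_simp) (FarPair.zero_bounds hfar)
  have := sqrtAsymp_of_summable hsum
  refine this.congr fun n => ?_
  rw [mu₁_eq_logCurve_of_pos hr]
  rfl

/-! ### The case `ω = 0` -/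

/-- For `ω = 0` the non-oscillating part is the constant `Q₂ / q'(1)`; the count of zeros succeeds on the
circles where it does not cancel `cos 2k`. -/
lemma polyPart_re_le_of_omega_eq {q : ℝ → ℝ} (hq : MemW22 q) (h : ℝ) (hω : omega q = 0) {σ : ℝ}
    (hσ : σ * -(Q₂ q h / deriv01 q 1) < 1) :
    ∃ θ < 1, ∃ R : ℝ, ∀ k : ℂ, R ≤ ‖k‖ → |k.im| ≤ |k.re| / 2 →
      -σ * (polyPart q h k).re ≤ θ := by
  refine ⟨_, hσ, 0, fun k _ _ => le_of_eq ?_⟩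
  have : polyPart q h k = ((Q₂ q h / deriv01 q 1 : ℝ) : ℂ) := by
    rw [polyPart, hω, constTerm_eq_Q₂ hq h hω]
    simp
  rw [this, Complex.ofReal_re]
  ring

/-- The two solutions `c ± √(c² - 1)` of `x + 1/x = 2c`. -/
lemma inv_add_mul_sqrt {σ c : ℝ} (hσ : σ ^ 2 = 1) (hc : 1 < |c|) :
    c + σ * Real.sqrt (c ^ 2 - 1) ≠ 0 ∧
    (c + σ * Real.sqrt (c ^ 2 - 1))⁻¹ = c - σ * Real.sqrt (c ^ 2 - 1) := by
  have h1 : 0 ≤ c ^ 2 - 1 := by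
    rw [← sq_abs]; nlinarith
  have h2 := Real.sq_sqrt h1
  have h3 : (c + σ * Real.sqrt (c ^ 2 - 1)) * (c - σ * Real.sqrt (c ^ 2 - 1)) = 1 := by
    have : (c + σ * Real.sqrt (c ^ 2 - 1)) * (c - σ * Real.sqrt (c ^ 2 - 1))
        = c ^ 2 - σ ^ 2 * Real.sqrt (c ^ 2 - 1) ^ 2 := by ring
    rw [this, hσ, h2]
    ring
  exact ⟨left_ne_zero_of_mul_eq_one h3, inv_eq_of_mul_eq_one_right h3⟩

lemma exp_two_mul_shift {σ c : ℝ} (hσ : σ ^ 2 = 1) (hc : 1 < |c|) :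
    Complex.exp (2 * Complex.I * shift σ c) = ((c + σ * Real.sqrt (c ^ 2 - 1) : ℝ) : ℂ) := by
  have h0 := (inv_add_mul_sqrt hσ hc).1
  rw [shift, if_neg (not_lt.mpr hc.le)]
  have h1 : ((c + σ * Real.sqrt (c ^ 2 - 1) : ℝ) : ℂ) ≠ 0 := by exact_mod_cast h0
  rw [← Complex.exp_log h1]
  congr 1
  rw [Complex.exp_log h1]
  linear_combination (-Complex.log ((c + σ * Real.sqrt (c ^ 2 - 1) : ℝ) : ℂ)) * Complex.I_sq

lemma cos_two_mul_shift {σ c : ℝ} (hσ : σ ^ 2 = 1) (hc : |c| ≠ 1) :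
    Complex.cos (2 * shift σ c) = c := by
  rcases lt_or_gt_of_ne hc with h | h
  · have hc' := abs_le.mp h.le
    rw [shift, if_pos h]
    have e : (2 : ℂ) * ((σ * (1 / 2) * Real.arccos c : ℝ) : ℂ) = ((σ * Real.arccos c : ℝ) : ℂ) := by
      push_cast; ring
    rw [e, ← Complex.ofReal_cos]
    rcases mul_self_eq_one_iff.mp ((sq σ).symm.trans hσ) with h1 | h1
    · rw [h1, one_mul, Real.cos_arccos hc'.1 hc'.2]
    · rw [h1, neg_one_mul, Real.cos_neg, Real.cos_arccos hc'.1 hc'.2]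
  · have h1 := exp_two_mul_shift hσ h
    have e1 : 2 * shift σ c * Complex.I = 2 * Complex.I * shift σ c := by ring
    rw [Complex.cos, neg_mul, e1, Complex.exp_neg, h1, ← Complex.ofReal_inv,
      (inv_add_mul_sqrt hσ h).2]
    push_cast
    ring

lemma shift_re {σ c : ℝ} (hc : 1 < |c|) :
    (shift σ c).re = ((c + σ * Real.sqrt (c ^ 2 - 1) : ℝ) : ℂ).arg / 2 := by
  rw [shift, if_neg (not_lt.mpr hc.le), ← Complex.log_im]
  simp
  ring

lemma add_mul_sqrt_bounds_of_gt {c : ℝ} (hc : 1 < c) :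
    1 < c + 1 * Real.sqrt (c ^ 2 - 1) ∧ 0 < c + (-1) * Real.sqrt (c ^ 2 - 1) ∧
      c + (-1) * Real.sqrt (c ^ 2 - 1) < 1 := by
  have habs : 1 < |c| := hc.trans_le (le_abs_self c)
  have h1 : 1 < c + 1 * Real.sqrt (c ^ 2 - 1) := by
    linarith [Real.sqrt_nonneg (c ^ 2 - 1)]
  have h2 := (inv_add_mul_sqrt (σ := 1) (by norm_num) habs).2
  have h3 : (c + 1 * Real.sqrt (c ^ 2 - 1))⁻¹ < 1 := inv_lt_one_of_one_lt₀ h1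
  have h4 : 0 < (c + 1 * Real.sqrt (c ^ 2 - 1))⁻¹ := inv_pos.mpr (by linarith)
  rw [h2] at h3 h4
  exact ⟨h1, by linarith, by linarith⟩

lemma add_mul_sqrt_bounds_of_lt {c : ℝ} (hc : c < -1) :
    c + (-1) * Real.sqrt (c ^ 2 - 1) < -1 ∧ -1 < c + 1 * Real.sqrt (c ^ 2 - 1) ∧
      c + 1 * Real.sqrt (c ^ 2 - 1) < 0 := by
  have h := add_mul_sqrt_bounds_of_gt (c := -c) (by linarith)
  rw [neg_sq] at h
  obtain ⟨h1, h2, h3⟩ := h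
  exact ⟨by linarith, by linarith, by linarith⟩

lemma norm_exp_two_I_mul_sqrt (k : ℂ) :
    ‖Complex.exp (2 * Complex.I * k)‖ = Real.exp (-(2 * k.im)) := by
  have := norm_exp_two_I_mul k 1
  rwa [Complex.ofReal_one, mul_one, mul_one] at this

/-- For `ω = 0`, `|Q₂ / q'(1)| > 1` large zeros are not real: both solutions of the limit equation
have `|e^{2ik}| ≠ 1`. -/
lemma exists_zero_im_ne_zero_of_one_lt {q : ℝ → ℝ} (hq : MemW22 q) (hq1 : q 1 = 0)
    (ha : deriv01 q 1 ≠ 0) (h : ℝ) (hω : omega q = 0) (hc : 1 < |-(Q₂ q h / deriv01 q 1)|) :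
    ∃ R : ℝ, ∀ z : ℂ, R ≤ ‖Complex.sqrt z‖ → charW q h z = 0 → z.im ≠ 0 := by
  set c := -(Q₂ q h / deriv01 q 1) with hcdef
  have hcos := cos_two_mul_shift (σ := 1) (by norm_num) hc.ne'
  set X := c + 1 * Real.sqrt (c ^ 2 - 1) with hX
  have hX0 := (inv_add_mul_sqrt (σ := 1) (by norm_num) hc).1
  set r := |X| with hr
  have hX1 : r ≠ 1 := by
    rcases lt_abs.mp hc with h1 | h1
    · have h2 : 1 < X := (add_mul_sqrt_bounds_of_gt h1).1
      rw [hr, abs_of_pos (by linarith)]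
      exact h2.ne'
    · obtain ⟨-, h2, h3⟩ := add_mul_sqrt_bounds_of_lt (c := c) (by linarith)
      have h4 : -X < 1 := by linarith
      rw [hr, abs_of_neg h3]
      exact h4.ne
  have hε : 0 < |1 - r| * |1 - r⁻¹| := by
    refine mul_pos (abs_pos.mpr (sub_ne_zero.mpr hX1.symm)) (abs_pos.mpr (sub_ne_zero.mpr ?_))
    exact fun h2 => hX1 (by rw [← inv_inv r, ← h2, inv_one])
  obtain ⟨K, hK⟩ := exists_norm_mul_le_const hq hq1 ha h hω hcos (half_pos hε)
  obtain ⟨R, hR⟩ := exists_zero_re_bounds hq hq1 ha h one_pos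
  refine ⟨max 2 (max K R), fun z hz h0 him => ?_⟩
  have h2z : 2 ≤ ‖Complex.sqrt z‖ := (le_max_left _ _).trans hz
  have hKz : K ≤ ‖Complex.sqrt z‖ := ((le_max_left _ _).trans (le_max_right _ _)).trans hz
  have hRz : R ≤ ‖Complex.sqrt z‖ := ((le_max_right _ _).trans (le_max_right _ _)).trans hz
  have hre := hR z hRz h0
  have hkim : (Complex.sqrt z).im = 0 := by
    rw [im_eq_two_mul_sqrt] at him
    rcases mul_eq_zero.mp him with h | h
    · linarith
    · exact h
  have hprod := hK _ hKz (by rwa [complex_sq_sqrt])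
  have hw : ‖Complex.exp (2 * Complex.I * Complex.sqrt z)‖ = 1 := by
    rw [norm_exp_two_I_mul_sqrt, hkim]
    simp
  rw [Complex.exp_neg, exp_two_mul_shift (by norm_num) hc] at hprod
  have h1 := abs_norm_sub_norm_le (Complex.exp (2 * Complex.I * Complex.sqrt z)) (X : ℂ)
  have h2 := abs_norm_sub_norm_le (Complex.exp (2 * Complex.I * Complex.sqrt z)) ((X : ℂ)⁻¹)
  rw [norm_inv] at h2
  rw [hw, Complex.norm_real, Real.norm_eq_abs] at h1 h2
  have h3 := mul_le_mul h1 h2 (abs_nonneg _) (norm_nonneg _)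
  linarith

/-- The asymptotics for `|Q₂ / q'(1)| > 1`: the sign of the imaginary part selects the solution of
the limit equation. -/
lemma sqrtAsymp_shift_of_one_lt {q : ℝ → ℝ} (hq : MemW22 q) (hq1 : q 1 = 0)
    (ha : deriv01 q 1 ≠ 0) (h : ℝ) (hω : omega q = 0) {σ : ℝ} (hσ : σ ^ 2 = 1)
    (hc : 1 < |-(Q₂ q h / deriv01 q 1)|) {s : ℕ}
    (hs : (shift σ (-(Q₂ q h / deriv01 q 1))).re = s * Real.pi / 2)
    {z : ℕ → ℂ} (hz : ∀ᶠ n : ℕ in atTop, charW q h (z n) = 0 ∧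
      (n + (s : ℝ) / 2 - 1 / 2) * Real.pi ≤ ‖Complex.sqrt (z n)‖ ∧
      ‖Complex.sqrt (z n)‖ ≤ (n + (s : ℝ) / 2 + 1 / 2) * Real.pi)
    (him : ∀ᶠ n in atTop,
      (1 < |-(Q₂ q h / deriv01 q 1) + σ * Real.sqrt ((-(Q₂ q h / deriv01 q 1)) ^ 2 - 1)| ∧
        (z n).im < 0) ∨
      (|-(Q₂ q h / deriv01 q 1) + σ * Real.sqrt ((-(Q₂ q h / deriv01 q 1)) ^ 2 - 1)| < 1 ∧
        0 < (z n).im)) :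
    SqrtAsymp (fun n : ℕ+ => z n)
      (fun n => ((n : ℝ) * Real.pi : ℝ) + shift σ (-(Q₂ q h / deriv01 q 1))) := by
  set c := -(Q₂ q h / deriv01 q 1) with hcdef
  set X := c + σ * Real.sqrt (c ^ 2 - 1) with hX
  have hX0 : 0 < |X| := abs_pos.mpr (inv_add_mul_sqrt hσ hc).1
  have hd : 0 < |1 - |X|⁻¹| ∨ |X| = 1 := by
    by_cases h1 : |X| = 1
    · exact Or.inr h1
    · refine Or.inl (abs_pos.mpr (sub_ne_zero.mpr fun h2 => h1 ?_))
      rw [← inv_inv |X|, ← h2, inv_one]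
  have hd' : 0 < |1 - |X|⁻¹| := by
    rcases hd with h1 | h1
    · exact h1
    · obtain ⟨n, hn⟩ := him.exists
      rcases hn with h2 | h2 <;> linarith [h2.1]
  obtain ⟨Rr, hRr⟩ := exists_zero_re_bounds hq hq1 ha h (δ := 1 / 2) (by norm_num)
  obtain ⟨N, hN⟩ := exists_nat_ge Rr
  have hpi := Real.pi_gt_three
  have key := summable_sqrt_sub_linear hq hq1 ha h hω (cos_two_mul_shift hσ hc.ne') hd'
    (z := z) ?_
  · have := sqrtAsymp_of_summable key
    refine this.congr fun n => ?_
    push_cast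
    rfl
  filter_upwards [hz, him, eventually_ge_atTop (max 1 N)] with n hzn himn hnN
  obtain ⟨h0, hlow, hhigh⟩ := hzn
  have hn1 : (1 : ℝ) ≤ n := by exact_mod_cast (le_max_left _ _).trans hnN
  have hnN' : (N : ℝ) ≤ n := by exact_mod_cast (le_max_right _ _).trans hnN
  set k := Complex.sqrt (z n) with hk
  have hs0 : (0 : ℝ) ≤ s / 2 * Real.pi := by positivity
  have hn3 : (n : ℝ) * 3 ≤ n * Real.pi := by gcongr
  have hnk : (n : ℝ) ≤ ‖k‖ := by nlinarith
  have hre := hRr (z n) ((hN.trans hnN').trans hnk) h0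
  have hre' := Complex.abs_re_le_norm k
  rw [abs_of_nonneg (complex_sqrt_re_nonneg (z n))] at hre'
  refine ⟨h0, hnk, ?_, ?_⟩
  · have e1 : (k - (n * Real.pi + shift σ c)).re = k.re - (n * Real.pi + s * Real.pi / 2) := by
      rw [← hs]; simp
    rw [e1, abs_le]
    constructor <;> linarith
  · rw [Complex.exp_neg, exp_two_mul_shift hσ hc]
    have hw := norm_exp_two_I_mul_sqrt k
    have hXn : ‖((c + σ * Real.sqrt (c ^ 2 - 1) : ℝ) : ℂ)⁻¹‖ = |X|⁻¹ := by
      rw [norm_inv, Complex.norm_real, Real.norm_eq_abs]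
    rcases himn with ⟨h1, h2⟩ | ⟨h1, h2⟩
    · have hkim := complex_sqrt_im_neg h2
      have h3 : 1 ≤ ‖Complex.exp (2 * Complex.I * k)‖ := by
        rw [hw]; exact Real.one_le_exp (by linarith)
      have h4 : |X|⁻¹ < 1 := inv_lt_one_of_one_lt₀ h1
      have h5 := norm_sub_norm_le (Complex.exp (2 * Complex.I * k))
        ((c + σ * Real.sqrt (c ^ 2 - 1) : ℝ) : ℂ)⁻¹
      rw [hXn] at h5
      rw [abs_of_pos (by linarith)]
      linarith
    · have hkim := complex_sqrt_im_pos h2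
      have h3 : ‖Complex.exp (2 * Complex.I * k)‖ ≤ 1 := by
        rw [hw, Real.exp_le_one_iff]; linarith
      have h4 : 1 < |X|⁻¹ := (one_lt_inv₀ hX0).mpr h1
      have h5 := norm_sub_norm_le ((c + σ * Real.sqrt (c ^ 2 - 1) : ℝ) : ℂ)⁻¹
        (Complex.exp (2 * Complex.I * k))
      rw [hXn, norm_sub_rev] at h5
      rw [abs_of_neg (by linarith)]
      linarith

lemma neg_sin_le_of_mem {θ δ : ℝ} (hδ : 0 ≤ δ) (h1 : -δ ≤ θ) (h2 : θ ≤ Real.pi) :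
    -δ ≤ Real.sin θ := by
  rcases le_total 0 θ with h | h
  · linarith [Real.sin_nonneg_of_nonneg_of_le_pi h h2]
  · have := Real.sin_le (x := -θ) (by linarith)
    rw [Real.sin_neg] at this
    linarith

lemma diskRadius_le {s s' n n' : ℕ} (hn : 1 ≤ n) (h : 2 * n + s ≤ 2 * n' + s') :
    diskRadius s n ≤ diskRadius s' n' := by
  have h' : 2 * (n : ℝ) + s ≤ 2 * n' + s' := by exact_mod_cast h
  refine pow_le_pow_left₀ (diskRadius_nonneg_base hn) ?_ 2
  exact mul_le_mul_of_nonneg_right (by linarith) Real.pi_pos.le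

lemma sqrt_bounds_of_diskRadius_le {s s' n n' : ℕ} (hn : 1 ≤ n) (hn' : 1 ≤ n') {z : ℂ}
    (h1 : diskRadius s n ≤ ‖z‖) (h2 : ‖z‖ < diskRadius s' n') :
    (n + (s : ℝ) / 2 - 1 / 2) * Real.pi ≤ ‖Complex.sqrt z‖ ∧
      ‖Complex.sqrt z‖ ≤ (n' + (s' : ℝ) / 2 - 1 / 2) * Real.pi := by
  rw [← norm_complex_sqrt_sq] at h1 h2
  exact ⟨(pow_le_pow_iff_left₀ (diskRadius_nonneg_base hn) (norm_nonneg _) two_ne_zero).mp h1,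
    ((pow_lt_pow_iff_left₀ (norm_nonneg _) (diskRadius_nonneg_base hn') two_ne_zero).mp h2).le⟩

/-- If the disks of both parities contain the expected number of zeros, the annuli between
consecutive ones contain a single zero each. -/
lemma exists_alternating_enumeration {q : ℝ → ℝ} (hq : MemW22 q) (hq1 : q 1 = 0)
    (ha : deriv01 q 1 ≠ 0) (h : ℝ)
    (hp₀ : ∃ θ < 1, ∃ R : ℝ, ∀ k : ℂ, R ≤ ‖k‖ → |k.im| ≤ |k.re| / 2 →
      -(-(-1 : ℝ) ^ 0) * (polyPart q h k).re ≤ θ)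
    (hp₁ : ∃ θ < 1, ∃ R : ℝ, ∀ k : ℂ, R ≤ ‖k‖ → |k.im| ≤ |k.re| / 2 →
      -(-(-1 : ℝ) ^ 1) * (polyPart q h k).re ≤ θ) :
    ∃ x y : ℕ → ℂ, Enumerates q h (Sum.elim (fun n : ℕ+ => x n) (fun n : ℕ+ => y n)) ∧
      (∀ᶠ n : ℕ in atTop, charW q h (x n) = 0 ∧ n * Real.pi ≤ ‖Complex.sqrt (x n)‖ ∧
        ‖Complex.sqrt (x n)‖ ≤ (n + 1 / 2) * Real.pi) ∧
      ∀ᶠ n : ℕ in atTop, charW q h (y n) = 0 ∧ (n - 1 / 2) * Real.pi ≤ ‖Complex.sqrt (y n)‖ ∧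
        ‖Complex.sqrt (y n)‖ ≤ n * Real.pi := by
  obtain ⟨n₀, T, hn₀, hT⟩ := exists_zeroMultisets hq hq1 ha h hp₀
  obtain ⟨n₀', T', -, hT'⟩ := exists_zeroMultisets hq hq1 ha h hp₁
  set n₁ := max n₀ n₀' with hn₁
  have h1n₁ : 1 ≤ n₁ := hn₀.trans (le_max_left _ _)
  have hx : ∀ n, n₁ ≤ n → ∃ e : ℂ, charW q h e = 0 ∧ diskRadius 1 n ≤ ‖e‖ ∧
      ‖e‖ < diskRadius 0 (n + 1) ∧ T (n + 1) = T' n + {e} := by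
    intro n hn
    have hn0 : n₀ ≤ n := (le_max_left _ _).trans hn
    have hn0' : n₀' ≤ n := (le_max_right _ _).trans hn
    refine (hT' n hn0').1.exists_singleton (hT (n + 1) (by omega)).1
      (diskRadius_le (hn₀.trans hn0) (by omega)) ?_
    rw [(hT' n hn0').2, (hT (n + 1) (by omega)).2]
    omega
  have hy : ∀ n, n₁ ≤ n → ∃ e : ℂ, charW q h e = 0 ∧ diskRadius 0 n ≤ ‖e‖ ∧
      ‖e‖ < diskRadius 1 n ∧ T' n = T n + {e} := by
    intro n hn
    have hn0 : n₀ ≤ n := (le_max_left _ _).trans hn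
    have hn0' : n₀' ≤ n := (le_max_right _ _).trans hn
    refine (hT n hn0).1.exists_singleton (hT' n hn0').1
      (diskRadius_le (hn₀.trans hn0) (by omega)) ?_
    rw [(hT' n hn0').2, (hT n hn0).2]
  choose! x hx using hx
  choose! y hy using hy
  obtain ⟨a, b, -, hsum⟩ := exists_pairs (m := n₁ - 1)
    ((hT n₁ (le_max_left _ _)).1.count_conj hq.continuousOn)
    (by rw [(hT n₁ (le_max_left _ _)).2]; omega)
  have hall := fun n hn => sum_pairs_join h1n₁ (E := 0) (T := T) (x := x) (y := y) (n := n)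
    (by rw [zero_add]; exact hsum)
    (fun n hn => by rw [(hx n hn).2.2.2, (hy n hn).2.2.2, add_assoc, add_comm {y n}]) hn
  refine ⟨_, _, enumerates_pairs hq.continuousOn (tendsto_diskRadius 0)
      (fun n hn => (hT n ((le_max_left _ _).trans hn)).1) hall, ?_, ?_⟩
  · filter_upwards [eventually_ge_atTop n₁] with n hn
    simp only [not_lt.mpr hn, if_false]
    obtain ⟨h1, h2, h3, -⟩ := hx n hn
    obtain ⟨h4, h5⟩ := sqrt_bounds_of_diskRadius_le (h1n₁.trans hn) (by omega) h2 h3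
    refine ⟨h1, (le_of_eq ?_).trans h4, h5.trans (le_of_eq ?_)⟩
    · push_cast; ring
    · push_cast; ring
  · filter_upwards [eventually_ge_atTop n₁] with n hn
    simp only [not_lt.mpr hn, if_false]
    obtain ⟨h1, h2, h3, -⟩ := hy n hn
    obtain ⟨h4, h5⟩ := sqrt_bounds_of_diskRadius_le (h1n₁.trans hn) (h1n₁.trans hn) h2 h3
    refine ⟨h1, (le_of_eq ?_).trans h4, h5.trans (le_of_eq ?_)⟩
    · push_cast; ring
    · push_cast; ring

/-- The asymptotics for `|Q₂ / q'(1)| < 1`: the annulus determines the sign of `sin (2 Re k)`, and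
this selects the solution of the limit equation. -/
lemma sqrtAsymp_shift_of_lt_one {q : ℝ → ℝ} (hq : MemW22 q) (hq1 : q 1 = 0)
    (ha : deriv01 q 1 ≠ 0) (h : ℝ) (hω : omega q = 0) {σ : ℝ} (hσ : σ ^ 2 = 1)
    (hc : |-(Q₂ q h / deriv01 q 1)| < 1) {z : ℕ → ℂ}
    (hz : ∀ᶠ n : ℕ in atTop, charW q h (z n) = 0 ∧
      (n + σ / 4 - 1 / 4) * Real.pi ≤ ‖Complex.sqrt (z n)‖ ∧
      ‖Complex.sqrt (z n)‖ ≤ (n + σ / 4 + 1 / 4) * Real.pi) :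
    SqrtAsymp (fun n : ℕ+ => z n)
      (fun n => ((n : ℝ) * Real.pi : ℝ) + shift σ (-(Q₂ q h / deriv01 q 1))) := by
  set c := -(Q₂ q h / deriv01 q 1) with hcdef
  set α := Real.arccos c with hα
  obtain ⟨hc1, hc2⟩ := abs_lt.mp hc
  have hpi := Real.pi_gt_three
  have hα0 : 0 < α := Real.arccos_pos.mpr hc2
  have hαpi : α < Real.pi := by
    refine lt_of_le_of_ne (Real.arccos_le_pi c) fun hcon => ?_
    have := Real.arccos_eq_pi.mp hcon
    linarith
  have hsin : 0 < Real.sin α := Real.sin_pos_of_pos_of_lt_pi hα0 hαpi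
  have hσ' : σ = 1 ∨ σ = -1 := mul_self_eq_one_iff.mp ((sq σ).symm.trans hσ)
  have hshift : shift σ c = ((σ * (1 / 2) * α : ℝ) : ℂ) := by rw [shift, if_pos hc]
  have hcos := cos_two_mul_shift hσ hc.ne
  obtain ⟨B, C, K, -, -, -, hBK⟩ := exists_norm_mul_le hq hq1 ha h hω hcos
  set δ := min (1 / 2) (Real.sin α / (4 * Real.exp (2 * B))) with hδ
  have hδ0 : 0 < δ := by positivity
  have hδ1 : δ ≤ 1 / 2 := min_le_left _ _
  have hδ2 : 2 * δ * Real.exp (2 * B) ≤ Real.sin α / 2 := by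
    have : δ * (4 * Real.exp (2 * B)) ≤ Real.sin α := by
      rw [← le_div_iff₀ (by positivity)]; exact min_le_right _ _
    linarith
  obtain ⟨R, hR⟩ := exists_zero_re_bounds hq hq1 ha h hδ0
  obtain ⟨N, hN⟩ := exists_nat_ge (max K R)
  have key := summable_sqrt_sub_linear hq hq1 ha h hω hcos (half_pos hsin) (z := z) ?_
  · have := sqrtAsymp_of_summable key
    refine this.congr fun n => ?_
    push_cast
    rfl
  filter_upwards [hz, eventually_ge_atTop (max 1 N)] with n hzn hnN
  obtain ⟨h0, hlow, hhigh⟩ := hzn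
  have hn1 : (1 : ℝ) ≤ n := by exact_mod_cast (le_max_left _ _).trans hnN
  have hnN' : (N : ℝ) ≤ n := by exact_mod_cast (le_max_right _ _).trans hnN
  set k := Complex.sqrt (z n) with hk
  have hσb : -1 ≤ σ ∧ σ ≤ 1 := by rcases hσ' with h | h <;> constructor <;> linarith
  have hnk : (n : ℝ) ≤ ‖k‖ := by
    have h1 : ((n : ℝ) + σ / 4 - 1 / 4) * 3 ≤ (n + σ / 4 - 1 / 4) * Real.pi := by
      gcongr
      linarith [hσb.1]
    linarith [hσb.1]
  have hre := hR (z n) ((le_max_right _ _).trans (hN.trans (hnN'.trans hnk))) h0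
  have hre' := Complex.abs_re_le_norm k
  rw [abs_of_nonneg (complex_sqrt_re_nonneg (z n))] at hre'
  refine ⟨h0, hnk, ?_, ?_⟩
  · have e1 : (k - (n * Real.pi + shift σ c)).re = k.re - (n * Real.pi + σ * (1 / 2) * α) := by
      rw [hshift, Complex.sub_re, Complex.add_re, Complex.ofReal_re]
      simp
    rw [e1, abs_le]
    rcases hσ' with h | h <;> rw [h] at hlow hhigh ⊢ <;> constructor <;> linarith
  · have him := (hBK k ((le_max_left _ _).trans (hN.trans (hnN'.trans hnk)))
      (by rwa [hk, complex_sq_sqrt])).1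
    have e1 : (Complex.exp (2 * Complex.I * k)).im
        = Real.exp (-(2 * k.im)) * Real.sin (2 * k.re) := by
      rw [Complex.exp_im]
      simp
    have e2 : (Complex.exp (-(2 * Complex.I * shift σ c))).im = -σ * Real.sin α := by
      have : -(2 * Complex.I * shift σ c) = ((-σ * α : ℝ) : ℂ) * Complex.I := by
        rw [hshift]; push_cast; ring
      rw [this, Complex.exp_ofReal_mul_I_im]
      rcases hσ' with h | h <;> rw [h] <;> simp
    have hs : -(2 * δ) ≤ σ * Real.sin (2 * k.re) := by
      have e3 : Real.sin (2 * k.re) = Real.sin (2 * k.re - n * (2 * Real.pi)) :=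
        (Real.sin_sub_nat_mul_two_pi _ _).symm
      rw [e3]
      rcases hσ' with h | h <;> rw [h] at hlow hhigh ⊢
      · rw [one_mul]
        exact neg_sin_le_of_mem (by positivity) (by linarith) (by linarith)
      · rw [neg_one_mul, ← Real.sin_add_pi]
        exact neg_sin_le_of_mem (by positivity) (by linarith) (by linarith)
    have hE : Real.exp (-(2 * k.im)) ≤ Real.exp (2 * B) := by
      gcongr
      linarith [(abs_le.mp him).1]
    have h2 : -(2 * δ * Real.exp (2 * B))
        ≤ Real.exp (-(2 * k.im)) * (σ * Real.sin (2 * k.re)) := by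
      have h3 := mul_le_mul_of_nonneg_left hs (Real.exp_pos (-(2 * k.im))).le
      have h4 := mul_le_mul_of_nonneg_left hE (show 0 ≤ 2 * δ by positivity)
      linarith
    have h3 := Complex.abs_im_le_norm
      (Complex.exp (2 * Complex.I * k) - Complex.exp (-(2 * Complex.I * shift σ c)))
    rw [Complex.sub_im, e1, e2] at h3
    refine le_trans ?_ h3
    rcases hσ' with h | h <;> rw [h] at h2 ⊢
    · refine le_trans ?_ (le_abs_self _)
      linarith
    · refine le_trans ?_ (neg_le_abs _)
      linarith

lemma FarPair.conj_bounds {q : ℝ → ℝ} (hq : MemW22 q) {h : ℝ} {s n : ℕ} {x y : ℂ}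
    (hxy : FarPair q h s n x y) : charW q h y = 0 ∧ y.im < 0 ∧
      (n + (s : ℝ) / 2 - 1 / 2) * Real.pi ≤ ‖Complex.sqrt y‖ ∧
      ‖Complex.sqrt y‖ ≤ (n + (s : ℝ) / 2 + 1 / 2) * Real.pi := by
  obtain ⟨rfl, h0, him, h1, h2⟩ := hxy
  have hn : ‖Complex.sqrt ((starRingEnd ℂ) x)‖ = ‖Complex.sqrt x‖ := by
    rw [← sq_eq_sq₀ (norm_nonneg _) (norm_nonneg _), norm_complex_sqrt_sq, norm_complex_sqrt_sq,
      Complex.norm_conj]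
  rw [hn]
  exact ⟨by rw [charW_conj hq.continuousOn, h0, map_zero], by simpa using him, h1, h2⟩

/-- Let `c = -Q₂/q'(1)`. For `c > 1` the large zeros are nonreal and come in conjugate pairs, and the
sign of the imaginary part tells `s⁺` from `s⁻`. For `|c| < 1` both parities of radii are admissible,
so that each annulus between consecutive radii contains one zero, and the parity of the annulus tells
`s⁺` from `s⁻`. -/
theorem exists_enumeration_of_lt_one {q : ℝ → ℝ} (hq : MemW22 q) (hq1 : q 1 = 0)
    (ha : deriv01 q 1 ≠ 0) (h : ℝ) (hω : omega q = 0) (hlt : Q₂ q h / deriv01 q 1 < 1)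
    (hne : Q₂ q h / deriv01 q 1 ≠ -1) :
    ∃ evp evm : ℕ+ → ℂ, Enumerates q h (Sum.elim evp evm) ∧
      SqrtAsymp evp
        (fun n => ((n : ℝ) * Real.pi : ℝ) + shift 1 (-(Q₂ q h / deriv01 q 1))) ∧
      SqrtAsymp evm
        (fun n => ((n : ℝ) * Real.pi : ℝ) + shift (-1) (-(Q₂ q h / deriv01 q 1))) := by
  have hp₀ := polyPart_re_le_of_omega_eq hq h hω (σ := -(-1 : ℝ) ^ 0) (by simpa using hlt)
  rcases lt_or_gt_of_ne hne with hlt' | hgt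
  · have hc : 1 < -(Q₂ q h / deriv01 q 1) := by linarith
    have habs := hc.trans_le (le_abs_self _)
    obtain ⟨x, y, hen, -, hfar⟩ := exists_conj_enumeration hq hq1 ha h hp₀
      (exists_zero_im_ne_zero_of_one_lt hq hq1 ha h hω habs)
    obtain ⟨hb1, hb2, hb3⟩ := add_mul_sqrt_bounds_of_gt hc
    have hen' := hen.comp_equiv (Equiv.sumComm _ _)
    refine ⟨fun n => y n, fun n => x n, ?_, ?_, ?_⟩
    · convert hen' using 1
      ext (i | i) <;> rfl
    · refine sqrtAsymp_shift_of_one_lt hq hq1 ha h hω (by norm_num) habs (s := 0) ?_ ?_ ?_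
      · rw [shift_re habs, Complex.arg_ofReal_of_nonneg (by linarith)]
        simp
      · filter_upwards [hfar] with n hn
        obtain ⟨h1, -, h2, h3⟩ := hn.conj_bounds hq
        exact ⟨h1, h2, h3⟩
      · filter_upwards [hfar] with n hn
        exact Or.inl ⟨hb1.trans_le (le_abs_self _), (hn.conj_bounds hq).2.1⟩
    · refine sqrtAsymp_shift_of_one_lt hq hq1 ha h hω (by norm_num) habs (s := 0) ?_ ?_ ?_
      · rw [shift_re habs, Complex.arg_ofReal_of_nonneg (by linarith)]
        simp
      · filter_upwards [hfar] with n hn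
        exact ⟨hn.2.1, hn.2.2.2⟩
      · filter_upwards [hfar] with n hn
        exact Or.inr ⟨abs_lt.mpr ⟨by linarith, hb3⟩, hn.2.2.1⟩
  · have hc : |-(Q₂ q h / deriv01 q 1)| < 1 := by
      rw [abs_neg, abs_lt]
      exact ⟨hgt, hlt⟩
    have hp₁ := polyPart_re_le_of_omega_eq hq h hω (σ := -(-1 : ℝ) ^ 1) (by simpa using by linarith)
    obtain ⟨x, y, hen, hx, hy⟩ := exists_alternating_enumeration hq hq1 ha h hp₀ hp₁
    refine ⟨_, _, hen, ?_, ?_⟩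
    · refine sqrtAsymp_shift_of_lt_one hq hq1 ha h hω (by norm_num) hc ?_
      filter_upwards [hx] with n hn
      exact ⟨hn.1, by linarith [hn.2.1], by linarith [hn.2.2]⟩
    · refine sqrtAsymp_shift_of_lt_one hq hq1 ha h hω (by norm_num) hc ?_
      filter_upwards [hy] with n hn
      exact ⟨hn.1, by linarith [hn.2.1], by linarith [hn.2.2]⟩

/-- Here `-Q₂/q'(1) < -1`: the large zeros come in conjugate pairs with real parts of the square roots
close to `(n + 1/2)π`, and the admissible disks contain an odd number of zeros. -/
theorem exists_enumeration_of_one_lt {q : ℝ → ℝ} (hq : MemW22 q) (hq1 : q 1 = 0)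
    (ha : deriv01 q 1 ≠ 0) (h : ℝ) (hω : omega q = 0) (hgt : 1 < Q₂ q h / deriv01 q 1) :
    ∃ (ev₀ : ℂ) (evp evm : ℕ+ → ℂ),
      Enumerates q h (Sum.elim (fun _ : Unit => ev₀) (Sum.elim evp evm)) ∧
      SqrtAsymp evp
        (fun n => ((n : ℝ) * Real.pi : ℝ) + shift 1 (-(Q₂ q h / deriv01 q 1))) ∧
      SqrtAsymp evm
        (fun n => ((n : ℝ) * Real.pi : ℝ) + shift (-1) (-(Q₂ q h / deriv01 q 1))) := by
  have hc : -(Q₂ q h / deriv01 q 1) < -1 := by linarith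
  have habs : 1 < |-(Q₂ q h / deriv01 q 1)| := lt_abs.mpr (Or.inr (by linarith))
  have hp₁ := polyPart_re_le_of_omega_eq hq h hω (σ := -(-1 : ℝ) ^ 1) (by simpa using by linarith)
  obtain ⟨x₀, x, y, hen, -, hfar⟩ := exists_conj_enumeration_cons hq hq1 ha h hp₁
    (exists_zero_im_ne_zero_of_one_lt hq hq1 ha h hω habs)
  obtain ⟨hb1, hb2, hb3⟩ := add_mul_sqrt_bounds_of_lt hc
  refine ⟨x₀, _, _, hen, ?_, ?_⟩
  · refine sqrtAsymp_shift_of_one_lt hq hq1 ha h hω (by norm_num) habs (s := 1) ?_ ?_ ?_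
    · rw [shift_re habs, Complex.arg_ofReal_of_neg hb3]
      simp
    · filter_upwards [hfar] with n hn
      exact ⟨hn.2.1, hn.2.2.2⟩
    · filter_upwards [hfar] with n hn
      exact Or.inr ⟨abs_lt.mpr ⟨hb2, by linarith⟩, hn.2.2.1⟩
  · refine sqrtAsymp_shift_of_one_lt hq hq1 ha h hω (by norm_num) habs (s := 1) ?_ ?_ ?_
    · rw [shift_re habs, Complex.arg_ofReal_of_neg (by linarith)]
      simp
    · filter_upwards [hfar] with n hn
      obtain ⟨h1, -, h2, h3⟩ := hn.conj_bounds hq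
      exact ⟨h1, h2, h3⟩
    · filter_upwards [hfar] with n hn
      exact Or.inl ⟨lt_abs.mpr (Or.inr (by linarith)), (hn.conj_bounds hq).2.1⟩

end RobinTransmission

end

theorem theorem4p2 (q : ℝ → ℝ) (h : ℝ) (hq : MemW22 q) (hq1 : q 1 = 0)
    (hq'1 : deriv01 q 1 ≠ 0) :
    -- case (i), `q'(1)/ω > 0`: the index `0` occurs once
    (omega q ≠ 0 → 0 < deriv01 q 1 / omega q →
      ∃ (ev₀ : ℂ) (ev ev' : ℕ+ → ℂ),
        Enumerates q h (Sum.elim (fun _ : Unit => ev₀) (Sum.elim ev ev')) ∧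
        ConjPaired ev ev' ∧
        SqrtAsymp ev (mu₁ (deriv01 q 1 / omega q))) ∧
    -- case (i), `q'(1)/ω < 0`
    (omega q ≠ 0 → deriv01 q 1 / omega q < 0 →
      ∃ ev ev' : ℕ+ → ℂ,
        Enumerates q h (Sum.elim ev ev') ∧
        ConjPaired ev ev' ∧
        SqrtAsymp ev (mu₁ (deriv01 q 1 / omega q))) ∧
    -- case (ii), `Q₂/q'(1) < 1`, `Q₂/q'(1) ≠ -1`
    (omega q = 0 → Q₂ q h / deriv01 q 1 < 1 → Q₂ q h / deriv01 q 1 ≠ -1 →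
      ∃ evp evm : ℕ+ → ℂ,
        Enumerates q h (Sum.elim evp evm) ∧
        SqrtAsymp evp
          (fun n => ((n : ℝ) * Real.pi : ℝ) + shift 1 (-(Q₂ q h / deriv01 q 1))) ∧
        SqrtAsymp evm
          (fun n => ((n : ℝ) * Real.pi : ℝ) + shift (-1) (-(Q₂ q h / deriv01 q 1)))) ∧
    -- case (ii), `Q₂/q'(1) > 1`: there is one more eigenvalue
    (omega q = 0 → 1 < Q₂ q h / deriv01 q 1 →
      ∃ (ev₀ : ℂ) (evp evm : ℕ+ → ℂ),
        Enumerates q h (Sum.elim (fun _ : Unit => ev₀) (Sum.elim evp evm)) ∧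
        SqrtAsymp evp
          (fun n => ((n : ℝ) * Real.pi : ℝ) + shift 1 (-(Q₂ q h / deriv01 q 1))) ∧
        SqrtAsymp evm
          (fun n => ((n : ℝ) * Real.pi : ℝ) + shift (-1) (-(Q₂ q h / deriv01 q 1)))) := by
  exact ⟨exists_enumeration_of_pos hq hq1 hq'1 h, exists_enumeration_of_neg hq hq1 hq'1 h,
    exists_enumeration_of_lt_one hq hq1 hq'1 h, exists_enumeration_of_one_lt hq hq1 hq'1 h⟩
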